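/- **Definitions.** For a meromorphic function $F$ on $\mathbb{C}$ put $\overline{F}(s)=\overline{F(\overline{s})}$. For an integer $d\ge 0$, the class $\mathcal{S}^*(d)$ consists of the Dirichlet series $F(s)=\sum_{n\ge1}a_n n^{-s}$ ($\Re s>1$) such that: 1. for some integer $m\ge 0$, $(s-1)^mF(s)$ extends to an entire function of finite order; 2. $a_n\ll_\varepsilon n^{\varepsilon}$ for every $\varepsilon>0$; 3. there are $Q>0$, $\epsilon\in\mathbb{C}$ with $|\epsilon|=1$, and $\mu_1,\dots,\mu_d\in\mathbb{C}$ with $\Re\mu_i\ge 0$ such that, as an identity of meromorphic functions, $$\epsilon^2Q^s\prod_{i=1}^d\Gamma\!\left(\tfrac s2+\mu_i\right)F(s)=Q^{1-s}\prod_{i=1}^d\Gamma\!\left(\tfrac{1-s}2+\overline{\mu_i}\right)\overline{F}(1-s);$$ 4. $a_1=1$ and $\log F(s)=\sum_{n\ge1}b_nn^{-s}$ for $\Re s>1$, where $b_n=0$ unless $n$ is a positive power of a prime, and $b_n\ll n^{\theta}$ for some $\theta<1/2$. **Theorem 5.1.** Let $F\in\mathcal{S}^*(1)$, and let $Q>0$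 be the number occurring in a functional equation (3) of $F$ with $d=1$. Then $q:=\pi Q^2$ is a positive integer, and there exist a primitive Dirichlet character $\chi$ modulo $q$ and a real number $\alpha$ such that $F(s)=L(s+i\alpha,\chi)$ as meromorphic functions on $\mathbb{C}$. -/

import Mathlib

open Complex Filter Topology Asymptotics
open scoped ComplexConjugate

/-- A function on the complex plane is of finite order if it is `O(exp (|s| ^ ρ))` as `|s| → ∞`,
for some real `ρ`. -/
def IsOfFiniteOrder (G : ℂ → ℂ) : Prop :=
  ∃ ρ : ℝ, G =O[cocompact ℂ] fun s : ℂ => Real.exp (‖s‖ ^ ρ)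

/-- The axioms, other than the functional equation, for `F` to be a Dirichlet series in the
Selberg class, with coefficients `a 1, a 2, …` (the values `a 0`, `b 0` play no role).
`F` is a meromorphic function whose only possible pole is at `1`; its value at `1` has a meaning
only if there is no pole there. -/
structure SelbergAxioms (F : ℂ → ℂ) (a : ℕ → ℂ) : Prop where
  /-- `F(s) = ∑ a n / n ^ s` for `Re s > 1`. -/
  dirichletSeries : ∀ s : ℂ, 1 < s.re → LSeriesHasSum a s (F s)
  /-- `(s - 1) ^ m * F s` extends to an entire function of finite order, for some `m ≥ 0`. -/
  analyticity : ∃ (m : ℕ) (G : ℂ → ℂ), Differentiable ℂ G ∧ IsOfFiniteOrder G ∧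
    ∀ s : ℂ, s ≠ 1 → G s = (s - 1) ^ m * F s
  /-- A removable singularity of `F` at `1` has been removed. -/
  regular_at_one : (∃ l : ℂ, Tendsto F (𝓝[≠] 1) (𝓝 l)) → ContinuousAt F 1
  /-- The Ramanujan hypothesis. -/
  ramanujan : ∀ ε : ℝ, 0 < ε → a =O[atTop] fun n : ℕ => (n : ℝ) ^ ε
  /-- The Euler product: `a 1 = 1` and `log F(s) = ∑ b n / n ^ s`. -/
  eulerProduct : a 1 = 1 ∧ ∃ b : ℕ → ℂ,
    (∀ n : ℕ, ¬ IsPrimePow n → b n = 0) ∧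
    (∃ θ : ℝ, θ < 1 / 2 ∧ b =O[atTop] fun n : ℕ => (n : ℝ) ^ θ) ∧
    ∀ s : ℂ, 1 < s.re → LSeriesSummable b s ∧ Complex.exp (LSeries b s) = F s

/-- The functional equation of degree `d` in which all gamma factors are `Γ(s / 2 + μ i)`,
as an identity of meromorphic functions (that is, at every `s` at which none of the factors on
either side has a pole). Here `conj (F (1 - conj s))` is the value at `1 - s` of the conjugate
function `s ↦ conj (F (conj s))`. -/
structure HasStarFunctionalEquation (F : ℂ → ℂ) (d : ℕ) (Q : ℝ) (μ : Fin d → ℂ) (ε : ℂ) :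
    Prop where
  Q_pos : 0 < Q
  norm_ε : ‖ε‖ = 1
  μ_re : ∀ i, 0 ≤ (μ i).re
  equation : ∀ s : ℂ, s ≠ 0 → s ≠ 1 →
    (∀ (i : Fin d) (k : ℕ), s / 2 + μ i ≠ -(k : ℂ)) →
    (∀ (i : Fin d) (k : ℕ), (1 - s) / 2 + conj (μ i) ≠ -(k : ℂ)) →
    ε ^ 2 * (Q : ℂ) ^ s * (∏ i, Gamma (s / 2 + μ i)) * F s =
      (Q : ℂ) ^ (1 - s) * (∏ i, Gamma ((1 - s) / 2 + conj (μ i))) * conj (F (1 - conj s))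

/-- The class `S*(d)`. -/
def SelbergStar (d : ℕ) : Set (ℂ → ℂ) :=
  {F | (∃ a : ℕ → ℂ, SelbergAxioms F a) ∧
    ∃ (Q : ℝ) (μ : Fin d → ℂ) (ε : ℂ), HasStarFunctionalEquation F d Q μ ε}

/-- The conductor `q = π ^ d * Q ^ 2` of a functional equation of degree `d`. -/
noncomputable def starConductor (d : ℕ) (Q : ℝ) : ℝ := Real.pi ^ d * Q ^ 2

/-! ### Bounds for the Gamma function and inverse Mellin transforms -/

lemma norm_Gamma_le_Gamma_re {s : ℂ} (hs : 0 < s.re) : ‖Gamma s‖ ≤ Real.Gamma s.re := by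
  rw [Gamma_eq_integral hs, Real.Gamma_eq_integral hs, GammaIntegral]
  refine (MeasureTheory.norm_integral_le_integral_norm _).trans (le_of_eq ?_)
  refine MeasureTheory.setIntegral_congr_fun measurableSet_Ioi fun x (hx : 0 < x) => ?_
  simp only [norm_mul, norm_real, Real.norm_eq_abs, Real.abs_exp]
  rw [norm_cpow_eq_rpow_re_of_pos hx]
  simp

lemma norm_sq_mul_norm_Gamma_le {s : ℂ} (hs : 0 < s.re) :
    ‖s‖ ^ 2 * ‖Gamma s‖ ≤ Real.Gamma (s.re + 2) := by
  have h0 : s ≠ 0 := fun h => by simp [h] at hs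
  have h1 : s + 1 ≠ 0 := fun h => by
    have := congrArg re h
    simp at this
    linarith
  have h2 : Gamma (s + 2) = (s + 1) * (s * Gamma s) := by
    rw [← Gamma_add_one s h0, ← Gamma_add_one _ h1]
    ring_nf
  have h3 : ‖s‖ ≤ ‖s + 1‖ := by
    rw [← sq_le_sq₀ (norm_nonneg _) (norm_nonneg _), ← normSq_eq_norm_sq, ← normSq_eq_norm_sq,
      normSq_apply, normSq_apply]
    simp
    nlinarith
  calc ‖s‖ ^ 2 * ‖Gamma s‖ ≤ ‖s + 1‖ * (‖s‖ * ‖Gamma s‖) := by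
        rw [sq, mul_assoc]
        gcongr
    _ = ‖Gamma (s + 2)‖ := by rw [h2, norm_mul, norm_mul]
    _ ≤ Real.Gamma (s.re + 2) := by
        have := norm_Gamma_le_Gamma_re (s := s + 2) (by simp; linarith)
        simpa using this

lemma differentiableAt_Gamma_of_re_pos {s : ℂ} (hs : 0 < s.re) : DifferentiableAt ℂ Gamma s :=
  differentiableAt_Gamma s fun m h => by
    have := congrArg re h
    simp at this
    have : (0 : ℝ) ≤ m := m.cast_nonneg
    linarith

lemma continuousAt_Gamma_of_re_pos {s : ℂ} (hs : 0 < s.re) : ContinuousAt Gamma s :=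
  (differentiableAt_Gamma_of_re_pos hs).continuousAt

/-- A continuous function on a vertical line which is `O(1 / |s| ^ 2)` is integrable. -/
lemma integrable_of_norm_sq_mul_le {f : ℝ → ℂ} {w : ℂ} {C : ℝ} (hw : 0 < w.re)
    (hf : Continuous f) (h : ∀ t : ℝ, ‖w + t * I‖ ^ 2 * ‖f t‖ ≤ C) :
    MeasureTheory.Integrable f := by
  have hshift : MeasureTheory.Integrable (fun t : ℝ => f (t - w.im)) := by
    have hint := (integrable_inv_one_add_sq.const_mul (C * max 1 (w.re ^ 2)⁻¹))
    refine hint.mono' (by fun_prop) (Eventually.of_forall fun t => ?_)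
    have h1 := h (t - w.im)
    have h2 : ‖w + (t - w.im : ℝ) * I‖ ^ 2 = w.re ^ 2 + t ^ 2 := by
      rw [← normSq_eq_norm_sq, normSq_apply]
      simp
      ring
    rw [h2] at h1
    have hw2 : 0 < w.re ^ 2 := by positivity
    have hC : 0 ≤ C := le_trans (by positivity) h1
    have h3 : (1 + t ^ 2) ≤ max 1 (w.re ^ 2)⁻¹ * (w.re ^ 2 + t ^ 2) := by
      have e1 : 1 ≤ max 1 (w.re ^ 2)⁻¹ * w.re ^ 2 := by
        calc 1 = (w.re ^ 2)⁻¹ * w.re ^ 2 := by field_simp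
          _ ≤ _ := by gcongr; exact le_max_right _ _
      have e2 : t ^ 2 ≤ max 1 (w.re ^ 2)⁻¹ * t ^ 2 :=
        le_mul_of_one_le_left (sq_nonneg t) (le_max_left _ _)
      linarith
    rw [← div_eq_mul_inv, le_div_iff₀ (by positivity)]
    calc ‖f (t - w.im)‖ * (1 + t ^ 2)
        ≤ ‖f (t - w.im)‖ * (max 1 (w.re ^ 2)⁻¹ * (w.re ^ 2 + t ^ 2)) := by gcongr
      _ = max 1 (w.re ^ 2)⁻¹ * ((w.re ^ 2 + t ^ 2) * ‖f (t - w.im)‖) := by ring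
      _ ≤ max 1 (w.re ^ 2)⁻¹ * C := by gcongr
      _ = _ := by ring
  simpa using hshift.comp_add_right w.im

lemma continuous_Gamma_vertical {w : ℂ} (hw : 0 < w.re) :
    Continuous fun t : ℝ => Gamma (w + t * I) := by
  refine continuous_iff_continuousAt.2 fun t => ?_
  exact ContinuousAt.comp (f := fun t : ℝ => w + t * I) (continuousAt_Gamma_of_re_pos (by simpa))
    (by fun_prop)

lemma integrable_Gamma_vertical {w : ℂ} (hw : 0 < w.re) :
    MeasureTheory.Integrable fun t : ℝ => Gamma (w + t * I) := by
  refine integrable_of_norm_sq_mul_le (C := Real.Gamma (w.re + 2)) hw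
    (continuous_Gamma_vertical hw) fun t => ?_
  simpa using norm_sq_mul_norm_Gamma_le (s := w + t * I) (by simpa)

/-- The inverse Mellin transform of `Γ` along a vertical line. -/
lemma integral_cpow_mul_Gamma {w : ℂ} (hw : 0 < w.re) {x : ℝ} (hx : 0 < x) :
    ∫ t : ℝ, (x : ℂ) ^ (-(w + t * I)) * Gamma (w + t * I) = 2 * Real.pi * Real.exp (-x) := by
  have hm : ∀ s : ℂ, 0 < s.re → mellin (fun x : ℝ => (Real.exp (-x) : ℂ)) s = Gamma s :=
    fun s hs => by rw [← GammaIntegral_eq_mellin, Gamma_eq_integral hs]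
  have hre : ∀ y : ℝ, 0 < ((w.re : ℂ) + y * I).re := fun y => by simpa
  have hinv := mellinInv_mellin_eq w.re (fun x : ℝ => (Real.exp (-x) : ℂ)) hx
    (by
      have := GammaIntegral_convergent (s := w.re) (by simpa)
      refine this.congr_fun (fun x _ => ?_) measurableSet_Ioi
      simp [mul_comm])
    (by
      refine (integrable_Gamma_vertical (w := w.re) (by simpa)).congr (Eventually.of_forall fun y => ?_)
      simp only
      rw [hm _ (hre y)])
    (by fun_prop)
  rw [mellinInv] at hinv
  have h2 := MeasureTheory.integral_add_right_eq_self (μ := MeasureTheory.volume)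
    (fun t : ℝ => (x : ℂ) ^ (-((w.re : ℂ) + t * I)) * Gamma ((w.re : ℂ) + t * I)) w.im
  have h3 : ∀ t : ℝ, (w.re : ℂ) + (t + w.im : ℝ) * I = w + t * I := fun t => by
    apply Complex.ext <;> simp [add_comm]
  simp only [h3] at h2
  rw [h2]
  have h4 : ∀ y : ℝ, (x : ℂ) ^ (-((w.re : ℂ) + y * I)) •
      mellin (fun x : ℝ => (Real.exp (-x) : ℂ)) ((w.re : ℂ) + y * I) =
      (x : ℂ) ^ (-((w.re : ℂ) + y * I)) * Gamma ((w.re : ℂ) + y * I) := fun y => by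
    rw [hm _ (hre y), smul_eq_mul]
  simp only [h4] at hinv
  rw [← hinv, real_smul]
  have : (Real.pi : ℂ) ≠ 0 := by exact_mod_cast Real.pi_ne_zero
  generalize (∫ t : ℝ, (x : ℂ) ^ (-((w.re : ℂ) + t * I)) * Gamma ((w.re : ℂ) + t * I)) = J
  push_cast
  field_simp

lemma image_div_one_add : (fun u : ℝ => u / (1 + u)) '' Set.Ioi 0 = Set.Ioo 0 1 := by
  ext y
  simp only [Set.mem_image, Set.mem_Ioi, Set.mem_Ioo]
  constructor
  · rintro ⟨u, hu, rfl⟩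
    exact ⟨by positivity, by rw [div_lt_one (by positivity)]; linarith⟩
  · rintro ⟨h0, h1⟩
    refine ⟨y / (1 - y), div_pos h0 (by linarith), ?_⟩
    have : 1 - y ≠ 0 := by linarith
    field_simp
    ring

lemma hasDerivAt_div_one_add {u : ℝ} (hu : 0 < u) :
    HasDerivAt (fun u : ℝ => u / (1 + u)) ((1 + u) ^ 2)⁻¹ u := by
  have h1 : (1 + u) ≠ 0 := by positivity
  refine ((hasDerivAt_id' u).div ((hasDerivAt_id' u).const_add 1) h1).congr_deriv ?_
  field_simp
  ring

lemma injOn_div_one_add : Set.InjOn (fun u : ℝ => u / (1 + u)) (Set.Ioi 0) := by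
  intro u (hu : 0 < u) v (hv : 0 < v) h
  have h1 : (1 + u) ≠ 0 := by positivity
  have h2 : (1 + v) ≠ 0 := by positivity
  have h3 : u / (1 + u) = v / (1 + v) := h
  field_simp at h3
  linarith

lemma beta_integrand_div_one_add (a : ℝ) (v : ℂ) {u : ℝ} (hu : 0 < u) :
    |((1 + u) ^ 2)⁻¹| • (((u / (1 + u) : ℝ) : ℂ) ^ (v - 1) *
      (1 - ((u / (1 + u) : ℝ) : ℂ)) ^ ((a : ℂ) - v - 1)) =
    (u : ℂ) ^ (v - 1) • (((1 + u) ^ (-a) : ℝ) : ℂ) := by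
  have h1 : (0 : ℝ) < 1 + u := by positivity
  have h1' : ((1 + u : ℝ) : ℂ) ≠ 0 := by exact_mod_cast h1.ne'
  have e1 : (1 - ((u / (1 + u) : ℝ) : ℂ)) = (((1 + u)⁻¹ : ℝ) : ℂ) := by
    rw [← ofReal_one, ← ofReal_sub]
    congr 1
    field_simp
    ring
  have e2 : ((u / (1 + u) : ℝ) : ℂ) = (u : ℂ) * (((1 + u)⁻¹ : ℝ) : ℂ) := by
    rw [← ofReal_mul, div_eq_mul_inv]
  rw [e1, e2, mul_cpow_ofReal_nonneg hu.le (by positivity), abs_of_pos (by positivity), real_smul,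
    smul_eq_mul, ofReal_inv (1 + u), ofReal_cpow h1.le,
    inv_cpow _ _ (by rw [arg_ofReal_of_nonneg h1.le]; exact Real.pi_pos.ne),
    inv_cpow _ _ (by rw [arg_ofReal_of_nonneg h1.le]; exact Real.pi_pos.ne), ofReal_inv, ofReal_pow,
    ← cpow_natCast, ← cpow_neg, ← cpow_neg, ← cpow_neg]
  have : ((1 + u : ℝ) : ℂ) ^ (((-a : ℝ)) : ℂ) = ((1 + u : ℝ) : ℂ) ^ (-((2 : ℕ) : ℂ)) *
      (((1 + u : ℝ) : ℂ) ^ (-(v - 1)) * ((1 + u : ℝ) : ℂ) ^ (-((a : ℂ) - v - 1))) := by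
    rw [← cpow_add _ _ h1', ← cpow_add _ _ h1']
    congr 1
    push_cast
    ring
  rw [this]
  ring

lemma mellinConvergent_one_add_rpow {a : ℝ} {v : ℂ} (hv : 0 < v.re) (hva : v.re < a) :
    MellinConvergent (fun u : ℝ => (((1 + u) ^ (-a) : ℝ) : ℂ)) v := by
  have h := betaIntegral_convergent (u := v) (v := (a : ℂ) - v) hv (by simpa)
  rw [intervalIntegrable_iff_integrableOn_Ioo_of_le zero_le_one, ← image_div_one_add,
    MeasureTheory.integrableOn_image_iff_integrableOn_abs_deriv_smul measurableSet_Ioi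
      (fun u hu => (hasDerivAt_div_one_add hu).hasDerivWithinAt) injOn_div_one_add] at h
  exact h.congr_fun (fun u hu => beta_integrand_div_one_add a v hu) measurableSet_Ioi

lemma mellin_one_add_rpow {a : ℝ} {v : ℂ} (hv : 0 < v.re) (hva : v.re < a) :
    Gamma a * mellin (fun u : ℝ => (((1 + u) ^ (-a) : ℝ) : ℂ)) v = Gamma v * Gamma (a - v) := by
  rw [Gamma_mul_Gamma_eq_betaIntegral hv (by simpa), add_sub_cancel, betaIntegral,
    intervalIntegral.integral_of_le zero_le_one, MeasureTheory.integral_Ioc_eq_integral_Ioo,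
    ← image_div_one_add,
    MeasureTheory.integral_image_eq_integral_abs_deriv_smul measurableSet_Ioi
      (fun u hu => (hasDerivAt_div_one_add hu).hasDerivWithinAt) injOn_div_one_add, mellin]
  congr 1
  exact MeasureTheory.setIntegral_congr_fun measurableSet_Ioi
    fun u hu => (beta_integrand_div_one_add a v hu).symm

lemma norm_Gamma_mul_Gamma_le {w : ℂ} {a : ℝ} (hw : 0 < w.re) (hwa : w.re < a) (t : ℝ) :
    ‖w + t * I‖ ^ 2 * ‖Gamma (w + t * I) * Gamma (a - (w + t * I))‖ ≤
      Real.Gamma (w.re + 2) * Real.Gamma (a - w.re) := by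
  rw [norm_mul, ← mul_assoc]
  have h1 := norm_sq_mul_norm_Gamma_le (s := w + t * I) (by simpa)
  have h2 := norm_Gamma_le_Gamma_re (s := a - (w + t * I)) (by simpa)
  simp only [add_re, mul_re, ofReal_re, I_re, mul_zero, ofReal_im, I_im, mul_one, sub_self,
    add_zero, sub_re] at h1 h2
  exact mul_le_mul h1 h2 (norm_nonneg _) (Real.Gamma_pos_of_pos (by linarith)).le

lemma integrable_Gamma_mul_Gamma {w : ℂ} {a : ℝ} (hw : 0 < w.re) (hwa : w.re < a) :
    MeasureTheory.Integrable fun t : ℝ => Gamma (w + t * I) * Gamma (a - (w + t * I)) := by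
  refine integrable_of_norm_sq_mul_le hw ((continuous_Gamma_vertical hw).mul ?_)
    (norm_Gamma_mul_Gamma_le hw hwa)
  refine continuous_iff_continuousAt.2 fun t => ?_
  exact ContinuousAt.comp (f := fun t : ℝ => a - (w + t * I))
    (continuousAt_Gamma_of_re_pos (by simpa)) (by fun_prop)

/-- The inverse Mellin transform of `Γ(s) Γ(a - s)` along a vertical line. -/
lemma integral_cpow_mul_Gamma_mul_Gamma {w : ℂ} {a : ℝ} (hw : 0 < w.re) (hwa : w.re < a)
    {x : ℝ} (hx : 0 < x) :
    ∫ t : ℝ, (x : ℂ) ^ (-(w + t * I)) * (Gamma (w + t * I) * Gamma (a - (w + t * I))) =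
      2 * Real.pi * Gamma a * ((1 + x) ^ (-a) : ℝ) := by
  have ha : Gamma a ≠ 0 := Gamma_ne_zero_of_re_pos (by simp; linarith)
  set f : ℝ → ℂ := fun u : ℝ => (((1 + u) ^ (-a) : ℝ) : ℂ)
  have hm : ∀ y : ℝ, mellin f ((w.re : ℂ) + y * I) =
      (Gamma a)⁻¹ * (Gamma ((w.re : ℂ) + y * I) * Gamma (a - ((w.re : ℂ) + y * I))) := fun y => by
    rw [← mellin_one_add_rpow (by simpa) (by simpa), inv_mul_cancel_left₀ ha]
  have hinv := mellinInv_mellin_eq w.re f hx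
    (mellinConvergent_one_add_rpow (by simpa) (by simpa))
    (by
      refine ((integrable_Gamma_mul_Gamma (w := w.re) (a := a) (by simpa) (by simpa)).const_mul
        (Gamma a)⁻¹).congr (Eventually.of_forall fun y => ?_)
      simp only [hm])
    (by
      refine continuous_ofReal.continuousAt.comp (ContinuousAt.rpow_const (by fun_prop) ?_)
      left
      positivity)
  rw [mellinInv] at hinv
  have h2 := MeasureTheory.integral_add_right_eq_self (μ := MeasureTheory.volume)
    (fun t : ℝ => (x : ℂ) ^ (-((w.re : ℂ) + t * I)) * (Gamma ((w.re : ℂ) + t * I) *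
      Gamma (a - ((w.re : ℂ) + t * I)))) w.im
  have h3 : ∀ t : ℝ, (w.re : ℂ) + (t + w.im : ℝ) * I = w + t * I := fun t => by
    apply Complex.ext <;> simp [add_comm]
  simp only [h3] at h2
  rw [h2]
  simp only [hm, smul_eq_mul, mul_left_comm _ (Gamma a)⁻¹] at hinv
  rw [MeasureTheory.integral_const_mul] at hinv
  change _ = 2 * Real.pi * Gamma a * f x
  rw [← hinv, real_smul]
  have : (Real.pi : ℂ) ≠ 0 := by exact_mod_cast Real.pi_ne_zero
  generalize (∫ t : ℝ, (x : ℂ) ^ (-((w.re : ℂ) + t * I)) * (Gamma ((w.re : ℂ) + t * I) *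
      Gamma (a - ((w.re : ℂ) + t * I)))) = J
  push_cast
  field_simp

/-! ### Shifting a contour across two simple poles -/

/-- An open vertical strip containing the closed strip `-1/2 ≤ Re s ≤ 3/2`. -/
def openStrip : Set ℂ := re ⁻¹' Set.Ioo (-1) 2

lemma isOpen_openStrip : IsOpen openStrip := isOpen_Ioo.preimage continuous_re

lemma mem_openStrip {s : ℂ} (h1 : -1 / 2 ≤ s.re) (h2 : s.re ≤ 3 / 2) : s ∈ openStrip :=
  ⟨by linarith, by linarith⟩

lemma integral_vertical_eq_of_decay {k : ℂ → ℂ} {C : ℝ} (hk : DifferentiableOn ℂ k openStrip)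
    (hC : ∀ s : ℂ, -1 / 2 ≤ s.re → s.re ≤ 3 / 2 → 1 ≤ |s.im| → ‖k s‖ ≤ C / s.im ^ 2)
    (h1 : MeasureTheory.Integrable fun t : ℝ => k ((3 / 2 : ℝ) + t * I))
    (h0 : MeasureTheory.Integrable fun t : ℝ => k ((-1 / 2 : ℝ) + t * I)) :
    ∫ t : ℝ, k ((3 / 2 : ℝ) + t * I) = ∫ t : ℝ, k ((-1 / 2 : ℝ) + t * I) := by
  have hneg : Tendsto (fun T : ℝ => -T) atTop atBot := tendsto_neg_atTop_atBot
  have t1 := MeasureTheory.intervalIntegral_tendsto_integral h1 hneg tendsto_id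
  have t0 := MeasureTheory.intervalIntegral_tendsto_integral h0 hneg tendsto_id
  have hrect : ∀ T : ℝ, (∫ x : ℝ in (-1 / 2)..(3 / 2), k (x + (-T : ℝ) * I)) -
      (∫ x : ℝ in (-1 / 2)..(3 / 2), k (x + (T : ℝ) * I)) +
      I • (∫ y : ℝ in (-T)..T, k ((3 / 2 : ℝ) + y * I)) -
      I • (∫ y : ℝ in (-T)..T, k ((-1 / 2 : ℝ) + y * I)) = 0 := fun T => by
    refine integral_boundary_rect_eq_zero_of_differentiableOn k
      ⟨-1 / 2, -T⟩ ⟨3 / 2, T⟩ (hk.mono fun s hs => ?_)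
    have hs1 : s.re ∈ Set.uIcc (-1 / 2 : ℝ) (3 / 2) := hs.1
    rw [Set.uIcc_of_le (by norm_num)] at hs1
    exact mem_openStrip hs1.1 hs1.2
  have hsmall : Tendsto (fun T : ℝ => 4 * C / T ^ 2) atTop (𝓝 0) :=
    tendsto_const_nhds.div_atTop (tendsto_pow_atTop two_ne_zero)
  have hdiff : Tendsto (fun T : ℝ => (∫ y : ℝ in (-T)..T, k ((3 / 2 : ℝ) + y * I)) -
      ∫ y : ℝ in (-T)..T, k ((-1 / 2 : ℝ) + y * I)) atTop (𝓝 0) := by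
    refine squeeze_zero_norm' ?_ hsmall
    filter_upwards [eventually_ge_atTop 1] with T hT
    have hb : ∀ u : ℝ, |u| = T → ‖∫ x : ℝ in (-1 / 2)..(3 / 2), k (x + (u : ℝ) * I)‖ ≤
        C / T ^ 2 * |3 / 2 - (-1 / 2)| := fun u hu => by
      refine intervalIntegral.norm_integral_le_of_norm_le_const fun x hx => ?_
      rw [Set.uIoc_of_le (by norm_num)] at hx
      have := hC (x + u * I) (by simpa using hx.1.le) (by simpa using hx.2) (by simp [hu, hT])
      simpa [← hu] using this
    have e := hrect T
    have e2 : (∫ y : ℝ in (-T)..T, k ((3 / 2 : ℝ) + y * I)) -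
        (∫ y : ℝ in (-T)..T, k ((-1 / 2 : ℝ) + y * I)) =
        I * ((∫ x : ℝ in (-1 / 2)..(3 / 2), k (x + (-T : ℝ) * I)) -
        ∫ x : ℝ in (-1 / 2)..(3 / 2), k (x + (T : ℝ) * I)) := by
      simp only [smul_eq_mul] at e
      linear_combination (-I) * e + ((∫ y : ℝ in (-T)..T, k ((-1 / 2 : ℝ) + y * I)) -
        ∫ y : ℝ in (-T)..T, k ((3 / 2 : ℝ) + y * I)) * (-I_sq)
    rw [e2, norm_mul, norm_I, one_mul]
    refine (norm_sub_le _ _).trans ?_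
    have b1 := hb (-T) (by rw [abs_neg, abs_of_nonneg (by linarith)])
    have b2 := hb T (abs_of_nonneg (by linarith))
    refine (add_le_add b1 b2).trans (le_of_eq ?_)
    rw [show |(3 : ℝ) / 2 - -1 / 2| = 2 by norm_num]
    ring
  exact sub_eq_zero.1 (tendsto_nhds_unique (t1.sub t0) hdiff)

lemma norm_mul_sub_one_ge {s : ℂ} (hs : s.re = 3 / 2 ∨ s.re = -1 / 2) :
    (1 + s.im ^ 2) / 4 ≤ ‖s * (s - 1)‖ := by
  have key : ((1 + s.im ^ 2) / 4) ^ 2 ≤ ‖s * (s - 1)‖ ^ 2 := by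
    rw [norm_mul, mul_pow, ← normSq_eq_norm_sq, ← normSq_eq_norm_sq, normSq_apply, normSq_apply]
    rcases hs with h | h <;> simp [h] <;> nlinarith [sq_nonneg s.im, sq_nonneg (s.im ^ 2)]
  exact (sq_le_sq₀ (by positivity) (norm_nonneg _)).1 key

lemma norm_div_mul_sub_one_le {z s : ℂ} {B : ℝ} (hz : ‖z‖ ≤ B) (hs : s.im ≠ 0) :
    ‖z / (s * (s - 1))‖ ≤ B / s.im ^ 2 := by
  have hB : 0 ≤ B := (norm_nonneg _).trans hz
  have h1 : |s.im| ≤ ‖s‖ := abs_im_le_norm s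
  have h2 : |s.im| ≤ ‖s - 1‖ := by simpa using abs_im_le_norm (s - 1)
  rw [norm_div, norm_mul]
  refine div_le_div₀ hB hz (by positivity) ?_
  rw [← sq_abs, sq]
  exact mul_le_mul h1 h2 (abs_nonneg _) (norm_nonneg _)

lemma integrable_div_mul_sub_one {h : ℂ → ℂ} (hd : DifferentiableOn ℂ h openStrip) {B : ℝ}
    (hB : ∀ s : ℂ, -1 / 2 ≤ s.re → s.re ≤ 3 / 2 → ‖h s‖ ≤ B) {σ : ℝ}
    (hσ : σ = 3 / 2 ∨ σ = -1 / 2) :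
    MeasureTheory.Integrable fun t : ℝ =>
      h (σ + t * I) / ((σ + t * I) * (σ + t * I - 1)) := by
  have hr : -1 / 2 ≤ σ ∧ σ ≤ 3 / 2 := by rcases hσ with h | h <;> rw [h] <;> norm_num
  have hge : ∀ t : ℝ, (1 + t ^ 2) / 4 ≤ ‖((σ : ℂ) + t * I) * (σ + t * I - 1)‖ := fun t => by
    simpa using norm_mul_sub_one_ge (s := (σ : ℂ) + t * I) (by simpa using hσ)
  have hmem : ∀ t : ℝ, (σ : ℂ) + t * I ∈ openStrip := fun t =>
    mem_openStrip (by simpa using hr.1) (by simpa using hr.2)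
  have hcont : Continuous fun t : ℝ => h (σ + t * I) := continuous_iff_continuousAt.2 fun t =>
    ContinuousAt.comp (f := fun t : ℝ => (σ : ℂ) + t * I)
      (hd.differentiableAt (isOpen_openStrip.mem_nhds (hmem t))).continuousAt (by fun_prop)
  refine (integrable_inv_one_add_sq.const_mul (4 * B)).mono' ?_ (Eventually.of_forall fun t => ?_)
  · refine Continuous.aestronglyMeasurable (hcont.div (by fun_prop) fun t h0 => ?_)
    have := hge t
    rw [h0, norm_zero] at this
    nlinarith [sq_nonneg t]
  · have hb := hB (σ + t * I) (by simpa using hr.1) (by simpa using hr.2)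
    have hB0 : 0 ≤ B := (norm_nonneg _).trans hb
    rw [norm_div, ← div_eq_mul_inv]
    calc _ ≤ B / ((1 + t ^ 2) / 4) := div_le_div₀ hB0 hb (by positivity) (hge t)
      _ = _ := by field_simp

lemma integral_vertical_eq_of_zeros {h : ℂ → ℂ} (hd : DifferentiableOn ℂ h openStrip) {B : ℝ}
    (hB : ∀ s : ℂ, -1 / 2 ≤ s.re → s.re ≤ 3 / 2 → ‖h s‖ ≤ B) (h0 : h 0 = 0) (h1 : h 1 = 0) :
    ∫ t : ℝ, h ((3 / 2 : ℝ) + t * I) / (((3 / 2 : ℝ) + t * I) * ((3 / 2 : ℝ) + t * I - 1)) =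
    ∫ t : ℝ, h ((-1 / 2 : ℝ) + t * I) /
      (((-1 / 2 : ℝ) + t * I) * ((-1 / 2 : ℝ) + t * I - 1)) := by
  have hm0 : (0 : ℂ) ∈ openStrip := ⟨by simp, by simp⟩
  have hm1 : (1 : ℂ) ∈ openStrip := ⟨by simp, by simp⟩
  set k := dslope (dslope h 0) 1
  have hk : DifferentiableOn ℂ k openStrip :=
    (differentiableOn_dslope (isOpen_openStrip.mem_nhds hm1)).2
      ((differentiableOn_dslope (isOpen_openStrip.mem_nhds hm0)).2 hd)
  have hkeq : ∀ s : ℂ, s ≠ 0 → s ≠ 1 → k s = h s / (s * (s - 1)) := fun s hs0 hs1 => by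
    simp only [k]
    rw [dslope_of_ne _ hs1, slope_def_field, dslope_of_ne _ hs0, dslope_of_ne _ one_ne_zero,
      slope_def_field, slope_def_field, h0, h1]
    have : s - 1 ≠ 0 := sub_ne_zero.2 hs1
    field_simp
    ring
  have hσ : ∀ σ : ℝ, σ = 3 / 2 ∨ σ = -1 / 2 → ∀ t : ℝ, k (σ + t * I) =
      h (σ + t * I) / ((σ + t * I) * (σ + t * I - 1)) := fun σ hσ t => by
    refine hkeq _ (fun e => ?_) (fun e => ?_) <;>
    · have := congrArg re e
      simp at this
      rcases hσ with h | h <;> rw [h] at this <;> norm_num at this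
  have e1 := hσ (3 / 2) (Or.inl rfl)
  have e0 := hσ (-1 / 2) (Or.inr rfl)
  simp only [← e1, ← e0]
  refine integral_vertical_eq_of_decay (C := B) hk (fun s hs1 hs2 hs => ?_) ?_ ?_
  · have him : s.im ≠ 0 := fun h => by norm_num [h] at hs
    rw [hkeq s (fun h => him (by simp [h])) (fun h => him (by simp [h]))]
    exact norm_div_mul_sub_one_le (hB s hs1 hs2) him
  · simp only [e1]
    exact integrable_div_mul_sub_one hd hB (Or.inl rfl)
  · simp only [e0]
    exact integrable_div_mul_sub_one hd hB (Or.inr rfl)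

/-- The difference of the integrals of `h s / (s (s - 1))` along the two edges of the strip is a
fixed linear combination of the values of `h` at the poles. -/
lemma exists_integral_sub_integral_eq : ∃ A₀ A₁ : ℂ, ∀ (h : ℂ → ℂ) (B : ℝ),
    DifferentiableOn ℂ h openStrip →
    (∀ s : ℂ, -1 / 2 ≤ s.re → s.re ≤ 3 / 2 → ‖h s‖ ≤ B) →
    ∫ t : ℝ, h ((3 / 2 : ℝ) + t * I) / (((3 / 2 : ℝ) + t * I) * ((3 / 2 : ℝ) + t * I - 1)) =
    (∫ t : ℝ, h ((-1 / 2 : ℝ) + t * I) /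
      (((-1 / 2 : ℝ) + t * I) * ((-1 / 2 : ℝ) + t * I - 1))) + A₀ * h 0 + A₁ * h 1 := by
  set J : ℝ → (ℂ → ℂ) → ℂ := fun σ f =>
    ∫ t : ℝ, f (σ + t * I) / ((σ + t * I) * (σ + t * I - 1)) with hJ
  set e : ℂ → ℂ := fun s => (s + 2)⁻¹ with he
  set d1 := J (3 / 2) (fun _ => 1) - J (-1 / 2) (fun _ => 1)
  set d2 := J (3 / 2) e - J (-1 / 2) e
  have hone : DifferentiableOn ℂ (fun _ : ℂ => (1 : ℂ)) openStrip := differentiableOn_const _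
  have hed : DifferentiableOn ℂ e openStrip := by
    refine DifferentiableOn.inv (by fun_prop) fun s hs h => ?_
    have := congrArg re h
    have := hs.1
    simp at *
    linarith
  have heB : ∀ s : ℂ, -1 / 2 ≤ s.re → s.re ≤ 3 / 2 → ‖e s‖ ≤ 1 := fun s hs _ => by
    simp only [he, norm_inv]
    refine inv_le_one_of_one_le₀ (le_trans ?_ (re_le_norm _))
    simp
    linarith
  have honeB : ∀ s : ℂ, -1 / 2 ≤ s.re → s.re ≤ 3 / 2 → ‖(1 : ℂ)‖ ≤ 1 := fun s _ _ => by simp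
  refine ⟨-2 * d1 + 6 * d2, 3 * d1 - 6 * d2, fun h B hd hB => ?_⟩
  set p := 3 * h 1 - 2 * h 0
  set r := 6 * (h 0 - h 1)
  set f : ℂ → ℂ := fun s => h s - (p * 1 + r * e s) with hf
  have hfd : DifferentiableOn ℂ f openStrip :=
    hd.sub ((hone.const_mul p).add (hed.const_mul r))
  have hfB : ∀ s : ℂ, -1 / 2 ≤ s.re → s.re ≤ 3 / 2 → ‖f s‖ ≤ B + (‖p‖ * 1 + ‖r‖ * 1) :=
    fun s h1 h2 => by
      refine (norm_sub_le _ _).trans (add_le_add (hB s h1 h2) ((norm_add_le _ _).trans ?_))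
      rw [norm_mul, norm_mul]
      gcongr
      · simp
      · exact heB s h1 h2
  have hf0 : f 0 = 0 := by simp [hf, he, p, r]; ring
  have hf1 : f 1 = 0 := by simp [hf, he, p, r]; norm_num; ring
  have key := integral_vertical_eq_of_zeros hfd hfB hf0 hf1
  have hlin : ∀ σ : ℝ, σ = 3 / 2 ∨ σ = -1 / 2 →
      J σ f = J σ h - (p * J σ (fun _ => 1) + r * J σ e) := fun σ hσ => by
    have i1 := integrable_div_mul_sub_one hd hB hσ
    have i2 := (integrable_div_mul_sub_one hone honeB hσ).const_mul p
    have i3 := (integrable_div_mul_sub_one hed heB hσ).const_mul r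
    simp only [hJ]
    rw [← MeasureTheory.integral_const_mul, ← MeasureTheory.integral_const_mul,
      ← MeasureTheory.integral_add i2 i3]
    refine Eq.trans ?_ (MeasureTheory.integral_sub i1 (i2.add i3))
    congr 1
    funext t
    simp only [hf]
    ring
  change J (3 / 2) f = J (-1 / 2) f at key
  rw [hlin _ (Or.inl rfl), hlin _ (Or.inr rfl)] at key
  change J (3 / 2) h = J (-1 / 2) h + _ + _
  simp only [d1, d2, p, r] at key ⊢
  linear_combination key

/-! ### The completed function -/

/-- The functional equation of degree one. -/
structure DegreeOneEquation (F : ℂ → ℂ) (Q : ℝ) (μ ε : ℂ) : Prop where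
  Q_pos : 0 < Q
  norm_ε : ‖ε‖ = 1
  μ_re : 0 ≤ μ.re
  equation : ∀ s : ℂ, s ≠ 0 → s ≠ 1 → (∀ k : ℕ, s / 2 + μ ≠ -(k : ℂ)) →
    (∀ k : ℕ, (1 - s) / 2 + conj μ ≠ -(k : ℂ)) →
    ε ^ 2 * (Q : ℂ) ^ s * Gamma (s / 2 + μ) * F s =
      (Q : ℂ) ^ (1 - s) * Gamma ((1 - s) / 2 + conj μ) * conj (F (1 - conj s))

lemma HasStarFunctionalEquation.degreeOne {F : ℂ → ℂ} {Q : ℝ} {μ : Fin 1 → ℂ} {ε : ℂ}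
    (h : HasStarFunctionalEquation F 1 Q μ ε) : DegreeOneEquation F Q (μ 0) ε where
  Q_pos := h.Q_pos
  norm_ε := h.norm_ε
  μ_re := h.μ_re 0
  equation s h0 h1 hl hr := by
    simpa using h.equation s h0 h1 (fun i k => by rw [Fin.fin_one_eq_zero i]; exact hl k)
      (fun i k => by rw [Fin.fin_one_eq_zero i]; exact hr k)

lemma ne_neg_natCast_of_re_pos {s : ℂ} (hs : 0 < s.re) (k : ℕ) : s ≠ -(k : ℂ) := fun h => by
  have := congrArg re h
  simp at this
  have : (0 : ℝ) ≤ k := k.cast_nonneg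
  linarith

namespace DegreeOneEquation

variable {F : ℂ → ℂ} {Q : ℝ} {μ ε : ℂ}

lemma Q_ne_zero (h : DegreeOneEquation F Q μ ε) : (Q : ℂ) ≠ 0 := by exact_mod_cast h.Q_pos.ne'

lemma ε_ne_zero (h : DegreeOneEquation F Q μ ε) : ε ≠ 0 := by
  rw [← norm_ne_zero_iff, h.norm_ε]
  exact one_ne_zero

/-- `(s - 1) F(s)` has a limit at `1`. -/
lemma exists_tendsto (h : DegreeOneEquation F Q μ ε) (h0 : ContinuousAt F 0) :
    ∃ l : ℂ, Tendsto (fun s => (s - 1) * F s) (𝓝[≠] 1) (𝓝 l) := by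
  set w : ℂ → ℂ := fun s => (1 - s) / 2 + conj μ with hw
  have hμ := h.μ_re
  obtain ⟨r, hrc, hr⟩ : ∃ r : ℂ → ℂ, ContinuousAt r 1 ∧
      ∀ᶠ s in 𝓝[≠] 1, w s ≠ 0 ∧ (s - 1) / w s = r s := by
    by_cases hμ0 : μ = 0
    · refine ⟨fun _ => -2, continuousAt_const, ?_⟩
      filter_upwards [self_mem_nhdsWithin] with s hs
      have h1 : 1 - s ≠ 0 := sub_ne_zero.2 (Ne.symm hs)
      have h2 : w s = (1 - s) / 2 := by simp [hw, hμ0]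
      refine ⟨by rw [h2]; exact div_ne_zero h1 two_ne_zero, ?_⟩
      rw [h2]
      field_simp
      ring
    · have hw1 : w 1 ≠ 0 := by simpa [hw] using hμ0
      have hwc : ContinuousAt w 1 := by fun_prop
      refine ⟨fun s => (s - 1) / w s, ContinuousAt.div (by fun_prop) hwc hw1, ?_⟩
      filter_upwards [(hwc.eventually_ne hw1).filter_mono nhdsWithin_le_nhds] with s hs
      exact ⟨hs, rfl⟩
  have hpos : ∀ᶠ s : ℂ in 𝓝[≠] 1, 0 < s.re ∧ -1 / 2 < (w s).re := by
    have c1 : ContinuousAt (fun s : ℂ => s.re) 1 := by fun_prop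
    have c2 : ContinuousAt (fun s : ℂ => (w s).re) 1 := by fun_prop
    have e1 := c1.eventually_const_lt (show (0 : ℝ) < (1 : ℂ).re by simp)
    have e2 := c2.eventually_const_lt (show (-1 / 2 : ℝ) < (w 1).re by simp [hw]; linarith)
    exact (e1.and e2).filter_mono nhdsWithin_le_nhds
  set R : ℂ → ℂ := fun s => (ε ^ 2 * (Q : ℂ) ^ s * Gamma (s / 2 + μ))⁻¹ *
    ((Q : ℂ) ^ (1 - s) * (r s * Gamma (w s + 1)) * conj (F (1 - conj s))) with hR
  have hRc : ContinuousAt R 1 := by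
    have hQ := h.Q_ne_zero
    have hg : ContinuousAt (fun s : ℂ => Gamma (s / 2 + μ)) 1 :=
      ContinuousAt.comp (f := fun s : ℂ => s / 2 + μ)
        (continuousAt_Gamma_of_re_pos (by simp; linarith)) (by fun_prop)
    have hg1 : ContinuousAt (fun s : ℂ => Gamma (w s + 1)) 1 :=
      ContinuousAt.comp (f := fun s : ℂ => w s + 1)
        (continuousAt_Gamma_of_re_pos (by simp [hw]; linarith)) (by fun_prop)
    have hF : ContinuousAt (fun s : ℂ => conj (F (1 - conj s))) 1 := by
      refine continuous_conj.continuousAt.comp (ContinuousAt.comp (f := fun s : ℂ => 1 - conj s)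
        (by simpa using h0) ?_)
      exact (continuous_const.sub continuous_conj).continuousAt
    have hq : ContinuousAt (fun s : ℂ => (Q : ℂ) ^ s) 1 :=
      continuousAt_const.cpow continuousAt_id (Or.inl (by simpa using h.Q_pos))
    have hq1 : ContinuousAt (fun s : ℂ => (Q : ℂ) ^ (1 - s)) 1 :=
      continuousAt_const.cpow (by fun_prop) (Or.inl (by simpa using h.Q_pos))
    refine ContinuousAt.mul (ContinuousAt.inv₀ ((continuousAt_const.mul hq).mul hg) ?_)
      ((hq1.mul (hrc.mul hg1)).mul hF)
    refine mul_ne_zero (mul_ne_zero (pow_ne_zero _ h.ε_ne_zero) (by simp [hQ])) ?_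
    exact Gamma_ne_zero_of_re_pos (by simp; linarith)
  refine ⟨R 1, (hRc.tendsto.mono_left nhdsWithin_le_nhds).congr' ?_⟩
  filter_upwards [hr, hpos, self_mem_nhdsWithin] with s ⟨hs0, hs1⟩ ⟨hs2, hs3⟩ hs4
  have hl : 0 < (s / 2 + μ).re := by simp; linarith
  have heq := h.equation s (fun h => by simp [h] at hs2) hs4 (ne_neg_natCast_of_re_pos hl)
    (fun k hk => by
      rcases Nat.eq_zero_or_pos k with rfl | hk0
      · exact hs0 (by simpa using hk)
      · have e := congrArg re hk
        have : (1 : ℝ) ≤ k := by exact_mod_cast hk0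
        change (w s).re = _ at e
        simp at e
        linarith)
  have hne : ε ^ 2 * (Q : ℂ) ^ s * Gamma (s / 2 + μ) ≠ 0 :=
    mul_ne_zero (mul_ne_zero (pow_ne_zero _ h.ε_ne_zero) (by simp [h.Q_ne_zero]))
      (Gamma_ne_zero_of_re_pos hl)
  simp only [hR]
  rw [inv_mul_eq_iff_eq_mul₀ hne, Gamma_add_one _ hs0, ← hs1]
  change ε ^ 2 * (Q : ℂ) ^ s * Gamma (s / 2 + μ) * F s =
      (Q : ℂ) ^ (1 - s) * Gamma (w s) * conj (F (1 - conj s)) at heq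
  rw [← mul_assoc ((s - 1) / w s), div_mul_cancel₀ _ hs0]
  linear_combination (-(s - 1)) * heq

/-- `(s - 1) F(s)` extends to an entire function. -/
lemma exists_entire (h : DegreeOneEquation F Q μ ε) (hd : ∀ s ≠ 1, DifferentiableAt ℂ F s) :
    ∃ H : ℂ → ℂ, Differentiable ℂ H ∧ ∀ s ≠ 1, H s = (s - 1) * F s := by
  obtain ⟨l, hl⟩ := h.exists_tendsto (hd 0 zero_ne_one).continuousAt
  set f : ℂ → ℂ := fun s => (s - 1) * F s
  refine ⟨Function.update f 1 l, ?_, fun s hs => Function.update_of_ne hs _ _⟩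
  rw [← differentiableOn_univ,
    ← differentiableOn_compl_singleton_and_continuousAt_iff (c := 1) univ_mem]
  refine ⟨fun s hs => ?_, continuousAt_update_same.2 hl⟩
  have hs1 : s ≠ 1 := hs.2
  have : DifferentiableAt ℂ f s := by
    have := hd s hs1
    fun_prop
  refine (this.congr_of_eventuallyEq ?_).differentiableWithinAt
  filter_upwards [isOpen_ne.mem_nhds hs1] with z hz using Function.update_of_ne hz _ _

end DegreeOneEquation

lemma pow_le_exp_exp (n : ℕ) : ∃ B : ℝ, ∀ s : ℂ, |s.re| ≤ 2 →
    (‖s‖ + 1) ^ n ≤ B * Real.exp |s.im| := by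
  refine ⟨n.factorial * Real.exp 3, fun s hs => ?_⟩
  have h1 : ‖s‖ + 1 ≤ |s.im| + 3 := by
    have := norm_le_abs_re_add_abs_im s
    linarith
  have h2 := Real.pow_div_factorial_le_exp (x := |s.im| + 3) (by positivity) n
  rw [div_le_iff₀ (by positivity), Real.exp_add] at h2
  calc (‖s‖ + 1) ^ n ≤ (|s.im| + 3) ^ n := by gcongr
    _ ≤ _ := h2
    _ = _ := by ring

/-- In a vertical strip, a function of finite order is at most doubly exponential, with any
polynomial factor to spare. -/
lemma IsOfFiniteOrder.exists_bound {G : ℂ → ℂ} (hG : IsOfFiniteOrder G) (n : ℕ) :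
    ∃ B C T : ℝ, ∀ s : ℂ, |s.re| ≤ 2 → T ≤ |s.im| →
      (‖s‖ + 1) ^ n * ‖G s‖ ≤ C * Real.exp (B * Real.exp |s.im|) := by
  obtain ⟨ρ, hρ⟩ := hG
  obtain ⟨C, hC⟩ := hρ.bound
  rw [← Metric.cobounded_eq_cocompact, ← comap_norm_atTop, eventually_comap] at hC
  obtain ⟨T, hT⟩ := eventually_atTop.1 hC
  obtain ⟨k, hk⟩ := exists_nat_ge ρ
  obtain ⟨B₁, hB₁⟩ := pow_le_exp_exp n
  obtain ⟨B₂, hB₂⟩ := pow_le_exp_exp k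
  refine ⟨B₁ + B₂, |C|, max T 1, fun s hs hTs => ?_⟩
  have him : |s.im| ≤ ‖s‖ := abs_im_le_norm s
  have h1 := hT ‖s‖ (((le_max_left _ _).trans hTs).trans him) s rfl
  have hs1 : 1 ≤ ‖s‖ := ((le_max_right _ _).trans hTs).trans him
  rw [Real.norm_eq_abs, Real.abs_exp] at h1
  have h2 : ‖s‖ ^ ρ ≤ B₂ * Real.exp |s.im| := by
    calc ‖s‖ ^ ρ ≤ ‖s‖ ^ (k : ℝ) := Real.rpow_le_rpow_of_exponent_le hs1 hk
      _ = ‖s‖ ^ k := Real.rpow_natCast _ _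
      _ ≤ (‖s‖ + 1) ^ k := by gcongr; linarith
      _ ≤ _ := hB₂ s hs
  calc (‖s‖ + 1) ^ n * ‖G s‖ ≤ (B₁ * Real.exp |s.im|) * (|C| * Real.exp (B₂ * Real.exp |s.im|)) := by
        refine mul_le_mul (hB₁ s hs) (h1.trans ?_) (norm_nonneg _)
          (le_trans (by positivity) (hB₁ s hs))
        gcongr
        exact le_abs_self C
    _ ≤ Real.exp (B₁ * Real.exp |s.im|) * (|C| * Real.exp (B₂ * Real.exp |s.im|)) := by
        gcongr
        have := Real.add_one_le_exp (B₁ * Real.exp |s.im|)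
        linarith
    _ = _ := by rw [add_mul, Real.exp_add]; ring

lemma conj_ofReal_cpow {x : ℝ} (hx : 0 < x) (s : ℂ) : conj ((x : ℂ) ^ s) = (x : ℂ) ^ conj s := by
  rw [cpow_conj _ _ (by rw [arg_ofReal_of_nonneg hx.le]; exact Real.pi_pos.ne), conj_ofReal]

namespace DegreeOneEquation

variable {F : ℂ → ℂ} {Q : ℝ} {μ ε : ℂ}

/-- The function `s (s - 1) Q ^ s Γ(s / 2 + μ) F(s)` for `Re s > 0`, if `H` extends
`(s - 1) F(s)`. -/
noncomputable def halfXi (H : ℂ → ℂ) (Q : ℝ) (μ s : ℂ) : ℂ :=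
  s * (Q : ℂ) ^ s * Gamma (s / 2 + μ) * H s

/-- The entire function `s (s - 1) Q ^ s Γ(s / 2 + μ) F(s)`. -/
noncomputable def xi (H : ℂ → ℂ) (Q : ℝ) (μ ε s : ℂ) : ℂ :=
  if 0 < s.re then halfXi H Q μ s else (ε ^ 2)⁻¹ * conj (halfXi H Q μ (1 - conj s))

lemma conj_halfXi {H : ℂ → ℂ} (hHF : ∀ s ≠ 1, H s = (s - 1) * F s) (hQ : 0 < Q) {s : ℂ}
    (hs : s ≠ 0) :
    conj (halfXi H Q μ (1 - conj s)) = s * (s - 1) *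
      ((Q : ℂ) ^ (1 - s) * Gamma ((1 - s) / 2 + conj μ) * conj (F (1 - conj s))) := by
  have h1 : 1 - conj s ≠ 1 := by simpa using hs
  simp only [halfXi, hHF _ h1, map_mul, map_sub, map_one, conj_conj, conj_ofReal_cpow hQ,
    ← Gamma_conj, map_add, map_div₀, map_ofNat]
  ring

lemma halfXi_eq (h : DegreeOneEquation F Q μ ε) {H : ℂ → ℂ}
    (hHF : ∀ s ≠ 1, H s = (s - 1) * F s) {s : ℂ} (h0 : 0 < s.re) (h1 : s.re < 1) :
    halfXi H Q μ s = (ε ^ 2)⁻¹ * conj (halfXi H Q μ (1 - conj s)) := by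
  have hμ := h.μ_re
  have hs0 : s ≠ 0 := fun e => by simp [e] at h0
  have hs1 : s ≠ 1 := fun e => by simp [e] at h1
  have heq := h.equation s hs0 hs1 (ne_neg_natCast_of_re_pos (by simp; linarith))
    (ne_neg_natCast_of_re_pos (by simp; linarith))
  rw [conj_halfXi hHF h.Q_pos hs0, eq_inv_mul_iff_mul_eq₀ (pow_ne_zero _ h.ε_ne_zero), ← heq,
    halfXi, hHF s hs1]
  ring

lemma differentiableAt_halfXi (hQ : 0 < Q) (hμ : 0 ≤ μ.re) {H : ℂ → ℂ} (hH : Differentiable ℂ H)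
    {s : ℂ} (hs : 0 < s.re) : DifferentiableAt ℂ (halfXi H Q μ) s := by
  have hg : DifferentiableAt ℂ (fun s : ℂ => Gamma (s / 2 + μ)) s :=
    DifferentiableAt.comp (f := fun s : ℂ => s / 2 + μ) s
      (differentiableAt_Gamma_of_re_pos (by simp; linarith)) (by fun_prop)
  have hq : DifferentiableAt ℂ (fun s : ℂ => (Q : ℂ) ^ s) s :=
    differentiableAt_id.const_cpow (Or.inl (by exact_mod_cast hQ.ne'))
  exact ((differentiableAt_id.mul hq).mul hg).mul hH.differentiableAt

lemma xi_of_lt (h : DegreeOneEquation F Q μ ε) {H : ℂ → ℂ}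
    (hHF : ∀ s ≠ 1, H s = (s - 1) * F s) {s : ℂ} (h1 : s.re < 1) :
    xi H Q μ ε s = (ε ^ 2)⁻¹ * conj (halfXi H Q μ (1 - conj s)) := by
  rw [xi]
  split_ifs with h0
  · exact h.halfXi_eq hHF h0 h1
  · rfl

lemma differentiable_xi (h : DegreeOneEquation F Q μ ε) {H : ℂ → ℂ} (hH : Differentiable ℂ H)
    (hHF : ∀ s ≠ 1, H s = (s - 1) * F s) : Differentiable ℂ (xi H Q μ ε) := by
  intro s
  by_cases hs : 0 < s.re
  · refine (differentiableAt_halfXi h.Q_pos h.μ_re hH hs).congr_of_eventuallyEq ?_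
    filter_upwards [(isOpen_lt continuous_const continuous_re).mem_nhds hs] with z hz
    exact if_pos hz
  · have hs1 : s.re < 1 := by linarith
    have hd : DifferentiableAt ℂ (conj ∘ (fun z => halfXi H Q μ (1 - z)) ∘ conj) s := by
      rw [differentiableAt_conj_conj_iff]
      refine DifferentiableAt.comp (f := fun z : ℂ => 1 - z) _
        (differentiableAt_halfXi h.Q_pos h.μ_re hH (by simpa)) (by fun_prop)
    refine (hd.const_mul (ε ^ 2)⁻¹).congr_of_eventuallyEq ?_
    filter_upwards [(isOpen_lt continuous_re continuous_const).mem_nhds hs1] with z hz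
    exact h.xi_of_lt hHF hz

lemma norm_xi_one_sub_conj (h : DegreeOneEquation F Q μ ε) {H : ℂ → ℂ}
    (hHF : ∀ s ≠ 1, H s = (s - 1) * F s) {s : ℂ} (hs : s.re < 1) :
    ‖xi H Q μ ε s‖ = ‖xi H Q μ ε (1 - conj s)‖ := by
  have h1 : 0 < (1 - conj s).re := by simpa
  rw [h.xi_of_lt hHF hs, norm_mul, norm_inv, norm_pow, h.norm_ε, xi, if_pos h1]
  simp

lemma norm_xi_edge (h : DegreeOneEquation F Q μ ε) {H : ℂ → ℂ}
    (hHF : ∀ s ≠ 1, H s = (s - 1) * F s) {M : ℝ} (hM : ∀ s : ℂ, s.re = 3 / 2 → ‖F s‖ ≤ M) :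
    ∃ C : ℝ, ∀ s : ℂ, s.re = 3 / 2 → ‖xi H Q μ ε s‖ ≤ C := by
  have hμ := h.μ_re
  set K := 3 + 2 * ‖μ‖ * 2 with hK
  refine ⟨K ^ 2 * Real.Gamma (3 / 4 + μ.re + 2) * Q ^ (3 / 2 : ℝ) * M, fun s hs => ?_⟩
  have hs1 : s ≠ 1 := fun e => by norm_num [e] at hs
  set w := s / 2 + μ with hw
  have hwre : w.re = 3 / 4 + μ.re := by simp [hw, hs]; norm_num
  have hw34 : 3 / 4 ≤ ‖w‖ := (by rw [hwre]; linarith : 3 / 4 ≤ w.re).trans (re_le_norm w)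
  have hsw : s = 2 * w - 2 * μ := by rw [hw]; ring
  have hsn : ‖s‖ ≤ K * ‖w‖ := by
    have : ‖s‖ ≤ 2 * ‖w‖ + 2 * ‖μ‖ := by
      conv_lhs => rw [hsw]
      refine (norm_sub_le _ _).trans ?_
      simp
    nlinarith [norm_nonneg μ]
  have hsn1 : ‖s - 1‖ ≤ K * ‖w‖ := by
    have h1 : ‖s - 1‖ ≤ ‖s‖ := by
      rw [← sq_le_sq₀ (norm_nonneg _) (norm_nonneg _), ← normSq_eq_norm_sq, ← normSq_eq_norm_sq,
        normSq_apply, normSq_apply]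
      simp [hs]
      norm_num
    exact h1.trans hsn
  have hg := norm_sq_mul_norm_Gamma_le (s := w) (by rw [hwre]; linarith)
  rw [hwre] at hg
  have hM0 : 0 ≤ M := (norm_nonneg _).trans (hM s hs)
  have hG0 : 0 ≤ Real.Gamma (3 / 4 + μ.re + 2) := (Real.Gamma_pos_of_pos (by linarith)).le
  rw [xi, if_pos (by rw [hs]; norm_num), halfXi, hHF s hs1, norm_mul, norm_mul, norm_mul, norm_mul,
    norm_cpow_eq_rpow_re_of_pos h.Q_pos, hs]
  have hQ0 : 0 ≤ Q ^ (3 / 2 : ℝ) := Real.rpow_nonneg h.Q_pos.le _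
  calc ‖s‖ * Q ^ (3 / 2 : ℝ) * ‖Gamma w‖ * (‖s - 1‖ * ‖F s‖)
      ≤ (K * ‖w‖) * Q ^ (3 / 2 : ℝ) * ‖Gamma w‖ * ((K * ‖w‖) * M) := by
        gcongr
        exact hM s hs
    _ = K ^ 2 * (‖w‖ ^ 2 * ‖Gamma w‖) * Q ^ (3 / 2 : ℝ) * M := by ring
    _ ≤ _ := by gcongr

lemma norm_halfXi_le (hQ : 0 < Q) (hμ : 0 ≤ μ.re) {G H : ℂ → ℂ} {m : ℕ}
    (hGF : ∀ s ≠ 1, G s = (s - 1) ^ m * F s) (hHF : ∀ s ≠ 1, H s = (s - 1) * F s) :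
    ∃ C : ℝ, 0 ≤ C ∧ ∀ s : ℂ, 1 / 2 ≤ s.re → s.re ≤ 3 / 2 → 1 ≤ |s.im| →
      ‖halfXi H Q μ s‖ ≤ C * ((‖s‖ + 1) ^ 2 * ‖G s‖) := by
  have hgc : ContinuousOn (fun σ : ℝ => Q ^ σ * Real.Gamma (σ / 2 + μ.re)) (Set.Icc (1 / 2) (3 / 2)) := by
    intro σ hσ
    have h1 : ContinuousAt (fun σ : ℝ => Real.Gamma (σ / 2 + μ.re)) σ :=
      ContinuousAt.comp (f := fun σ : ℝ => σ / 2 + μ.re)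
        (Real.differentiableAt_Gamma fun k hk => by
          have : (0 : ℝ) ≤ k := k.cast_nonneg
          have := hσ.1
          linarith).continuousAt (by fun_prop)
    exact ((Real.continuousAt_const_rpow hQ.ne').mul h1).continuousWithinAt
  obtain ⟨C, hC⟩ := isCompact_Icc.exists_bound_of_continuousOn hgc
  have hC0 : 0 ≤ C := (norm_nonneg _).trans (hC 1 ⟨by norm_num, by norm_num⟩)
  refine ⟨C, hC0, fun s h1 h2 him => ?_⟩
  have hs1 : s ≠ 1 := fun e => by norm_num [e] at him
  have hsub : 1 ≤ ‖s - 1‖ := him.trans (by simpa using abs_im_le_norm (s - 1))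
  have hF : ‖F s‖ ≤ ‖G s‖ := by
    rw [hGF s hs1, norm_mul, norm_pow]
    exact le_mul_of_one_le_left (norm_nonneg _) (one_le_pow₀ hsub)
  have hg := norm_Gamma_le_Gamma_re (s := s / 2 + μ) (by simp; linarith)
  have hsub2 : ‖s - 1‖ ≤ ‖s‖ + 1 := by simpa using norm_sub_le s 1
  have hb := (le_abs_self _).trans (hC s.re ⟨h1, h2⟩)
  have hg' : ‖Gamma (s / 2 + μ)‖ ≤ Real.Gamma (s.re / 2 + μ.re) := by simpa using hg
  rw [halfXi, hHF s hs1, norm_mul, norm_mul, norm_mul, norm_mul, norm_cpow_eq_rpow_re_of_pos hQ]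
  have hQ0 : 0 ≤ Q ^ s.re := Real.rpow_nonneg hQ.le _
  calc ‖s‖ * Q ^ s.re * ‖Gamma (s / 2 + μ)‖ * (‖s - 1‖ * ‖F s‖)
      ≤ (‖s‖ + 1) * Q ^ s.re * Real.Gamma (s.re / 2 + μ.re) * ((‖s‖ + 1) * ‖G s‖) := by
        have : 0 ≤ Real.Gamma (s.re / 2 + μ.re) := (norm_nonneg _).trans hg'
        gcongr
        linarith
    _ = (Q ^ s.re * Real.Gamma (s.re / 2 + μ.re)) * ((‖s‖ + 1) ^ 2 * ‖G s‖) := by ring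
    _ ≤ _ := by gcongr

/-- The Phragmén–Lindelöf bound for the completed function. -/
lemma exists_norm_xi_le (h : DegreeOneEquation F Q μ ε) {G H : ℂ → ℂ} {m : ℕ}
    (hG : IsOfFiniteOrder G) (hGF : ∀ s ≠ 1, G s = (s - 1) ^ m * F s) (hH : Differentiable ℂ H)
    (hHF : ∀ s ≠ 1, H s = (s - 1) * F s) {M : ℝ} (hM : ∀ s : ℂ, s.re = 3 / 2 → ‖F s‖ ≤ M) :
    ∃ C : ℝ, ∀ s : ℂ, -1 / 2 ≤ s.re → s.re ≤ 3 / 2 → ‖xi H Q μ ε s‖ ≤ C := by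
  obtain ⟨C, hC⟩ := h.norm_xi_edge hHF hM
  obtain ⟨C₁, hC₁0, hC₁⟩ := norm_halfXi_le h.Q_pos h.μ_re hGF hHF
  obtain ⟨B, C₂, T, hB⟩ := hG.exists_bound 2
  have hhalf : ∀ s : ℂ, 1 / 2 ≤ s.re → s.re ≤ 3 / 2 → max T 1 ≤ |s.im| →
      ‖xi H Q μ ε s‖ ≤ C₁ * (C₂ * Real.exp (B * Real.exp |s.im|)) := fun s h1 h2 h3 => by
    rw [xi, if_pos (by linarith)]
    refine (hC₁ s h1 h2 ((le_max_right _ _).trans h3)).trans ?_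
    have := hB s (by rw [abs_le]; constructor <;> linarith) ((le_max_left _ _).trans h3)
    gcongr
  refine ⟨C, fun s h1 h2 => ?_⟩
  refine PhragmenLindelof.vertical_strip (a := -1 / 2) (b := 3 / 2)
    (h.differentiable_xi hH hHF).diffContOnCl ?_ ?_ hC h1 h2
  · refine ⟨1, ?_, B, IsBigO.of_bound (C₁ * C₂) ?_⟩
    · rw [lt_div_iff₀ (by norm_num)]
      linarith [Real.pi_gt_three]
    · have hev : ∀ᶠ s : ℂ in comap (_root_.abs ∘ im) atTop ⊓ 𝓟 (re ⁻¹' Set.Ioo (-1 / 2) (3 / 2)),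
          max T 1 ≤ |s.im| := by
        refine Filter.Eventually.filter_mono inf_le_left ?_
        exact tendsto_comap.eventually (eventually_ge_atTop (max T 1))
      filter_upwards [hev, mem_inf_of_right (mem_principal_self _)] with s hs hs2
      have hs3 : -1 / 2 < s.re ∧ s.re < 3 / 2 := hs2
      rw [Real.norm_eq_abs, Real.abs_exp, one_mul, mul_assoc]
      by_cases hre : 1 / 2 ≤ s.re
      · exact hhalf s hre hs3.2.le hs
      · rw [h.norm_xi_one_sub_conj hHF (by linarith)]
        have := hhalf (1 - conj s) (by simp; linarith) (by simp; linarith) (by simpa using hs)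
        simpa using this
  · intro z hz
    rw [h.norm_xi_one_sub_conj hHF (by linarith)]
    exact hC _ (by simp [hz]; norm_num)

end DegreeOneEquation

/-! ### The transformation formula on the positive reals -/

/-- The exponential series `∑ a n * n ^ (2 μ) * exp (- n z)`. -/
noncomputable def expSeries (a : ℕ → ℂ) (μ z : ℂ) : ℂ :=
  ∑' n : ℕ, a n * (n : ℂ) ^ (2 * μ) * exp (-(n * z))

/-- The general term of the series dual to `expSeries`. -/
noncomputable def dualTerm (a : ℕ → ℂ) (μ : ℂ) (Q : ℝ) (z : ℂ) (n : ℕ) : ℂ :=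
  conj (a n) * (n : ℂ) ^ (-(2 + 2 * μ)) *
    (1 + ((Q ^ 2 / 2 : ℝ) * z / n) ^ 2) ^ ((-(1 + 2 * μ.re) : ℝ) : ℂ)

lemma integrable_cpow_mul {g : ℝ → ℂ} (hg : MeasureTheory.Integrable g) {x : ℝ} (hx : 0 < x)
    (w : ℂ) : MeasureTheory.Integrable fun t : ℝ => (x : ℂ) ^ (-(w + t * I)) * g t := by
  have hx0 : (x : ℂ) ≠ 0 := by exact_mod_cast hx.ne'
  refine hg.bdd_mul (c := x ^ (-w.re)) ?_ (Eventually.of_forall fun t => ?_)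
  · exact (Continuous.const_cpow (by fun_prop) (Or.inl hx0)).aestronglyMeasurable
  · rw [norm_cpow_eq_rpow_re_of_pos hx]
    simp

lemma hasSum_integral_mul_term {a : ℕ → ℂ} {σ : ℝ} (ha : LSeriesSummable a σ) {g : ℝ → ℂ}
    (hg : MeasureTheory.Integrable g) :
    HasSum (fun n => ∫ t : ℝ, g t * LSeries.term a (σ + t * I) n)
      (∫ t : ℝ, g t * LSeries a (σ + t * I)) := by
  have hn : ∀ (t : ℝ) n, ‖LSeries.term a (σ + t * I) n‖ = ‖LSeries.term a σ n‖ := fun t n => by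
    simp [LSeries.norm_term_eq]
  have hint : ∀ n, MeasureTheory.Integrable fun t : ℝ => g t * LSeries.term a (σ + t * I) n := by
    intro n
    refine hg.mul_bdd (c := ‖LSeries.term a σ n‖) ?_ (Eventually.of_forall fun t => (hn t n).le)
    refine Continuous.aestronglyMeasurable ?_
    rcases Nat.eq_zero_or_pos n with rfl | h0
    · simpa using continuous_const
    · have hn0 : (n : ℂ) ≠ 0 := by exact_mod_cast h0.ne'
      simp only [LSeries.term_of_ne_zero h0.ne']
      refine Continuous.div continuous_const (Continuous.const_cpow (by fun_prop) (Or.inl hn0)) ?_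
      simp [hn0]
  have := MeasureTheory.hasSum_integral_of_summable_integral_norm hint (by
    simp only [norm_mul, hn, MeasureTheory.integral_mul_const]
    exact ha.norm.mul_left _)
  simpa only [tsum_mul_left, LSeries] using this

lemma cpow_mul_natCast_cpow {z : ℝ} (hz : 0 < z) {n : ℕ} (hn : n ≠ 0) (s ν : ℂ) :
    (z : ℂ) ^ (-(s + ν)) * (1 / (n : ℂ) ^ s) = (n : ℂ) ^ ν * ((n * z : ℝ) : ℂ) ^ (-(s + ν)) := by
  have hn0 : (n : ℂ) ≠ 0 := by exact_mod_cast hn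
  rw [ofReal_mul, mul_cpow_ofReal_nonneg n.cast_nonneg hz.le, ofReal_natCast, one_div, ← cpow_neg,
    ← mul_assoc, ← cpow_add _ _ hn0, mul_comm]
  congr 2
  ring

/-- The inverse Mellin transform of `Γ(s + 2 μ) F(s)` on the line `Re s = 3 / 2`. -/
lemma integral_Gamma_mul_LSeries {a : ℕ → ℂ} (ha0 : a 0 = 0) {μ : ℂ} (hμ : 0 ≤ μ.re)
    (ha : LSeriesSummable a (3 / 2 : ℝ)) {z : ℝ} (hz : 0 < z) :
    ∫ t : ℝ, (z : ℂ) ^ (-((3 / 2 : ℝ) + t * I + 2 * μ)) * Gamma ((3 / 2 : ℝ) + t * I + 2 * μ) *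
      LSeries a ((3 / 2 : ℝ) + t * I) = 2 * Real.pi * expSeries a μ z := by
  set w : ℂ := (3 / 2 : ℝ) + 2 * μ with hw
  have hwre : 0 < w.re := by simp [hw]; linarith
  have hcomm : ∀ t : ℝ, ((3 / 2 : ℝ) : ℂ) + t * I + 2 * μ = w + t * I := fun t => by
    rw [hw]
    ring
  simp only [hcomm]
  have hs := hasSum_integral_mul_term ha (integrable_cpow_mul (integrable_Gamma_vertical hwre) hz w)
  rw [← hs.tsum_eq, expSeries, ← tsum_mul_left]
  congr 1
  funext n
  rcases Nat.eq_zero_or_pos n with rfl | hn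
  · simp [ha0]
  have hnz : 0 < (n : ℝ) * z := by positivity
  have key := integral_cpow_mul_Gamma hwre hnz
  have hpt : ∀ t : ℝ, (z : ℂ) ^ (-(w + t * I)) * Gamma (w + t * I) *
      LSeries.term a ((3 / 2 : ℝ) + t * I) n = a n * (n : ℂ) ^ (2 * μ) *
      (((n * z : ℝ) : ℂ) ^ (-(w + t * I)) * Gamma (w + t * I)) := fun t => by
    have e := cpow_mul_natCast_cpow hz hn.ne' ((3 / 2 : ℝ) + t * I) (2 * μ)
    rw [hcomm] at e
    rw [LSeries.term_of_ne_zero hn.ne', div_eq_mul_one_div]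
    linear_combination (Gamma (w + t * I) * a n) * e
  simp only [hpt]
  rw [MeasureTheory.integral_const_mul, key]
  push_cast
  ring

lemma cpow_ofReal_cpow {x : ℝ} (hx : 0 < x) (r : ℝ) (v : ℂ) :
    ((x : ℂ) ^ (r : ℂ)) ^ v = (x : ℂ) ^ ((r : ℂ) * v) := by
  rw [cpow_mul]
  · rw [← ofReal_log hx.le, ← ofReal_mul, ofReal_im]
    exact neg_lt_zero.2 Real.pi_pos
  · rw [← ofReal_log hx.le, ← ofReal_mul, ofReal_im]
    exact Real.pi_pos.le

lemma cpow_sub_two_mul_eq {x : ℝ} (hx : 0 < x) (v ν : ℂ) :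
    (x : ℂ) ^ (2 * v - ν) = (x : ℂ) ^ (-ν) * (((x ^ 2)⁻¹ : ℝ) : ℂ) ^ (-v) := by
  have hx0 : (x : ℂ) ≠ 0 := by exact_mod_cast hx.ne'
  have : (((x ^ 2)⁻¹ : ℝ) : ℂ) = (x : ℂ) ^ (((-2 : ℝ)) : ℂ) := by
    rw [← ofReal_cpow hx.le, Real.rpow_neg hx.le, Real.rpow_two]
  rw [this, cpow_ofReal_cpow hx, ← cpow_add _ _ hx0]
  congr 1
  push_cast
  ring

lemma cpow_mul_one_add_inv_rpow {x : ℝ} (hx : 0 < x) (μ : ℂ) :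
    (x : ℂ) ^ (-(2 * conj μ)) * (((1 + (x ^ 2)⁻¹) ^ (-(1 + 2 * μ.re)) : ℝ) : ℂ) =
    (x : ℂ) ^ (2 + 2 * μ) * (1 + (x : ℂ) ^ 2) ^ ((-(1 + 2 * μ.re) : ℝ) : ℂ) := by
  have hx0 : (x : ℂ) ≠ 0 := by exact_mod_cast hx.ne'
  have h1 : 1 + (x ^ 2)⁻¹ = x ^ (-2 : ℝ) * (1 + x ^ 2) := by
    rw [Real.rpow_neg hx.le, Real.rpow_two]
    field_simp
    ring
  rw [h1, Real.mul_rpow (by positivity) (by positivity), ← Real.rpow_mul hx.le, ofReal_mul,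
    ofReal_cpow hx.le, ofReal_cpow (by positivity), ← mul_assoc, ← cpow_add _ _ hx0]
  congr 2
  · push_cast
    have := add_conj μ
    push_cast at this
    linear_combination (-2) * this
  · push_cast
    ring

/-- The inverse Mellin transform of `Γ(1 + μ - s / 2) Γ(s / 2 + conj μ)` times a conjugate
Dirichlet series on the line `Re s = 3 / 2`. -/
lemma integral_Gamma_mul_Gamma_mul_LSeries {a : ℕ → ℂ} (ha0 : a 0 = 0) {μ : ℂ} (hμ : 0 ≤ μ.re)
    (ha : LSeriesSummable a (3 / 2 : ℝ)) {Q : ℝ} (hQ : 0 < Q) {z : ℝ} (hz : 0 < z) :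
    ∫ t : ℝ, ((Q ^ 2 / 2 * z : ℝ) : ℂ) ^ ((3 / 2 : ℝ) + t * I) *
      (Gamma (((3 / 2 : ℝ) + t * I) / 2 + conj μ) * Gamma (1 + μ - ((3 / 2 : ℝ) + t * I) / 2)) *
      LSeries (fun n => conj (a n)) ((3 / 2 : ℝ) + t * I) =
    4 * Real.pi * Gamma ((1 + 2 * μ.re : ℝ) : ℂ) * ((Q ^ 2 / 2 * z : ℝ) : ℂ) ^ (2 + 2 * μ) *
      ∑' n, dualTerm a μ Q z n := by
  set X : ℝ := Q ^ 2 / 2 * z with hX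
  have hX0 : 0 < X := by positivity
  set A : ℝ := 1 + 2 * μ.re with hA
  set w : ℂ := (3 / 4 : ℝ) + conj μ with hw
  have hwre : 0 < w.re := by simp [hw]; linarith
  have hwA : w.re < A := by simp [hw, hA]; linarith
  have hv : ∀ t : ℝ, (((3 / 2 : ℝ) : ℂ) + t * I) / 2 + conj μ = w + (1 / 2 * t : ℝ) * I :=
    fun t => by
      rw [hw]
      push_cast
      ring
  have hAμ : (A : ℂ) = 1 + μ + conj μ := by
    have := add_conj μ
    rw [hA]
    push_cast at this ⊢
    linear_combination -this
  have hv' : ∀ t : ℝ, 1 + μ - (((3 / 2 : ℝ) : ℂ) + t * I) / 2 = A - (w + (1 / 2 * t : ℝ) * I) :=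
    fun t => by rw [← hv, hAμ]; ring
  simp only [hv, hv']
  have hg : MeasureTheory.Integrable fun t : ℝ => (X : ℂ) ^ (((3 / 2 : ℝ) : ℂ) + t * I) *
      (Gamma (w + (1 / 2 * t : ℝ) * I) * Gamma (A - (w + (1 / 2 * t : ℝ) * I))) := by
    have h1 := (integrable_Gamma_mul_Gamma hwre hwA).comp_mul_left' (one_half_pos (α := ℝ)).ne'
    have h2 := integrable_cpow_mul h1 (inv_pos.2 hX0) ((3 / 2 : ℝ) : ℂ)
    refine h2.congr (Eventually.of_forall fun t => ?_)
    simp only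
    rw [ofReal_inv, inv_cpow _ _ (by rw [arg_ofReal_of_nonneg hX0.le]; exact Real.pi_pos.ne),
      ← cpow_neg, neg_neg]
  have ha' : LSeriesSummable (fun n => conj (a n)) (3 / 2 : ℝ) := by
    refine (summable_norm_iff.2 ha).of_norm_bounded_eventually ?_
    refine Eventually.of_forall fun n => le_of_eq ?_
    simp [LSeries.norm_term_eq]
  have hs := hasSum_integral_mul_term ha' hg
  rw [← hs.tsum_eq, ← tsum_mul_left]
  congr 1
  funext n
  rcases Nat.eq_zero_or_pos n with rfl | hn
  · simp [ha0, dualTerm]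
  have hn0 : (n : ℂ) ≠ 0 := by exact_mod_cast hn.ne'
  have hnR : (0 : ℝ) < n := by exact_mod_cast hn
  set x : ℝ := X / n with hx
  have hx0 : 0 < x := by positivity
  have hxn : ∀ s : ℂ, (X : ℂ) ^ s = (x : ℂ) ^ s * (n : ℂ) ^ s := fun s => by
    rw [← ofReal_natCast, ← mul_cpow_ofReal_nonneg hx0.le hnR.le, ← ofReal_mul]
    congr 2
    rw [hx]
    field_simp
  have key := integral_cpow_mul_Gamma_mul_Gamma hwre hwA (x := (x ^ 2)⁻¹) (by positivity)
  have hpt : ∀ t : ℝ, (X : ℂ) ^ (((3 / 2 : ℝ) : ℂ) + t * I) *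
      (Gamma (w + (1 / 2 * t : ℝ) * I) * Gamma (A - (w + (1 / 2 * t : ℝ) * I))) *
      LSeries.term (fun n => conj (a n)) ((3 / 2 : ℝ) + t * I) n =
      conj (a n) * (x : ℂ) ^ (-(2 * conj μ)) *
      (fun t : ℝ => (((x ^ 2)⁻¹ : ℝ) : ℂ) ^ (-(w + t * I)) *
        (Gamma (w + t * I) * Gamma (A - (w + t * I)))) (1 / 2 * t) := fun t => by
    have e : ((3 / 2 : ℝ) : ℂ) + t * I = 2 * (w + (1 / 2 * t : ℝ) * I) - 2 * conj μ := by
      rw [← hv]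
      ring
    simp only
    rw [LSeries.term_of_ne_zero hn.ne', hxn, mul_div_assoc', div_eq_iff (by simp [hn0]), e,
      cpow_sub_two_mul_eq hx0]
    ring
  simp only [hpt]
  have hscale := MeasureTheory.Measure.integral_comp_mul_left
    (fun t : ℝ => (((x ^ 2)⁻¹ : ℝ) : ℂ) ^ (-(w + t * I)) *
      (Gamma (w + t * I) * Gamma (A - (w + t * I)))) (1 / 2 : ℝ)
  rw [MeasureTheory.integral_const_mul, hscale, key, dualTerm]
  have hc := cpow_mul_one_add_inv_rpow hx0 μ
  have hxe : ((Q ^ 2 / 2 : ℝ) : ℂ) * z / n = x := by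
    rw [hx, hX]
    push_cast
    ring
  have e2 : (x : ℂ) ^ (2 + 2 * μ) = (X : ℂ) ^ (2 + 2 * μ) * (n : ℂ) ^ (-(2 + 2 * μ)) := by
    rw [hxn, cpow_neg, mul_inv_cancel_right₀ (by simp [hn0])]
  rw [hxe, ← hA, real_smul, show |(1 / 2 : ℝ)⁻¹| = 2 by norm_num]
  rw [e2, ← hA] at hc
  push_cast at hc ⊢
  linear_combination (4 * Real.pi * Gamma A * conj (a n)) * hc

namespace DegreeOneEquation

variable {F : ℂ → ℂ} {Q : ℝ} {μ ε : ℂ}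

/-- The function whose quotient by `s (s - 1)` is integrated along vertical lines. -/
noncomputable def kernelXi (H : ℂ → ℂ) (Q : ℝ) (μ ε : ℂ) (Y : ℝ) (s : ℂ) : ℂ :=
  Gamma (s / 2 + μ + 1 / 2) * (Y : ℂ) ^ s * xi H Q μ ε s

lemma differentiableOn_kernelXi (h : DegreeOneEquation F Q μ ε) {H : ℂ → ℂ}
    (hH : Differentiable ℂ H) (hHF : ∀ s ≠ 1, H s = (s - 1) * F s) {Y : ℝ} (hY : 0 < Y) :
    DifferentiableOn ℂ (kernelXi H Q μ ε Y) openStrip := by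
  intro s hs
  have hs1 : -1 < s.re := hs.1
  have hμ := h.μ_re
  have hg : DifferentiableAt ℂ (fun s : ℂ => Gamma (s / 2 + μ + 1 / 2)) s :=
    DifferentiableAt.comp (f := fun s : ℂ => s / 2 + μ + 1 / 2) s
      (differentiableAt_Gamma_of_re_pos (by simp; linarith)) (by fun_prop)
  have hq : DifferentiableAt ℂ (fun s : ℂ => (Y : ℂ) ^ s) s :=
    differentiableAt_id.const_cpow (Or.inl (by exact_mod_cast hY.ne'))
  exact ((hg.mul hq).mul (h.differentiable_xi hH hHF s)).differentiableWithinAt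

lemma exists_norm_kernelXi_le (hμ : 0 ≤ μ.re) {H : ℂ → ℂ} {C : ℝ}
    (hC : ∀ s : ℂ, -1 / 2 ≤ s.re → s.re ≤ 3 / 2 → ‖xi H Q μ ε s‖ ≤ C) {Y : ℝ} (hY : 0 < Y) :
    ∃ B : ℝ, ∀ s : ℂ, -1 / 2 ≤ s.re → s.re ≤ 3 / 2 → ‖kernelXi H Q μ ε Y s‖ ≤ B := by
  have hgc : ContinuousOn (fun σ : ℝ => Real.Gamma (σ / 2 + μ.re + 1 / 2) * Y ^ σ)
      (Set.Icc (-1 / 2) (3 / 2)) := by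
    intro σ hσ
    have h1 : ContinuousAt (fun σ : ℝ => Real.Gamma (σ / 2 + μ.re + 1 / 2)) σ :=
      ContinuousAt.comp (f := fun σ : ℝ => σ / 2 + μ.re + 1 / 2)
        (Real.differentiableAt_Gamma fun k hk => by
          have : (0 : ℝ) ≤ k := k.cast_nonneg
          have := hσ.1
          linarith).continuousAt (by fun_prop)
    exact (h1.mul (Real.continuousAt_const_rpow hY.ne')).continuousWithinAt
  obtain ⟨D, hD⟩ := isCompact_Icc.exists_bound_of_continuousOn hgc
  refine ⟨D * C, fun s h1 h2 => ?_⟩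
  have hb := (le_abs_self _).trans (hD s.re ⟨h1, h2⟩)
  have hg := norm_Gamma_le_Gamma_re (s := s / 2 + μ + 1 / 2) (by simp; linarith)
  have hg' : ‖Gamma (s / 2 + μ + 1 / 2)‖ ≤ Real.Gamma (s.re / 2 + μ.re + 1 / 2) := by
    simpa using hg
  rw [kernelXi, norm_mul, norm_mul, norm_cpow_eq_rpow_re_of_pos hY]
  have hY0 : 0 ≤ Y ^ s.re := Real.rpow_nonneg hY.le _
  refine mul_le_mul (le_trans ?_ hb) (hC s h1 h2) (norm_nonneg _)
    ((norm_nonneg _).trans (hD s.re ⟨h1, h2⟩))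
  gcongr

lemma kernelXi_right (hQ : 0 < Q) {H : ℂ → ℂ}
    (hHF : ∀ s ≠ 1, H s = (s - 1) * F s) {z : ℝ} (hz : 0 < z) {s : ℂ} (hs : 1 < s.re) :
    kernelXi H Q μ ε (2 / (Q * z)) s / (s * (s - 1)) =
      2 ^ (1 - 2 * μ) * (√Real.pi : ℝ) * (z : ℂ) ^ (2 * μ) *
        ((z : ℂ) ^ (-(s + 2 * μ)) * Gamma (s + 2 * μ) * F s) := by
  have hs0 : s ≠ 0 := fun e => by norm_num [e] at hs
  have hs1 : s ≠ 1 := fun e => by norm_num [e] at hs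
  have hz0 : (z : ℂ) ≠ 0 := by exact_mod_cast hz.ne'
  have hs1' : s - 1 ≠ 0 := sub_ne_zero.2 hs1
  have hdup := Gamma_mul_Gamma_add_half (s / 2 + μ)
  rw [show 2 * (s / 2 + μ) = s + 2 * μ by ring] at hdup
  have hpow : (2 : ℂ) ^ (-s) * (Q : ℂ) ^ s * ((2 / (Q * z) : ℝ) : ℂ) ^ s =
      (z : ℂ) ^ (2 * μ) * (z : ℂ) ^ (-(s + 2 * μ)) := by
    have e1 : (2 : ℂ) ^ (-s) = (((2 : ℝ)⁻¹ : ℝ) : ℂ) ^ s := by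
      rw [ofReal_inv, inv_cpow _ _ (by rw [arg_ofReal_of_nonneg (by norm_num)]; exact Real.pi_pos.ne),
        cpow_neg]
      norm_num
    rw [e1, ← mul_cpow_ofReal_nonneg (by norm_num) hQ.le, ← ofReal_mul,
      ← mul_cpow_ofReal_nonneg (by positivity) (by positivity), ← ofReal_mul, ← cpow_add _ _ hz0,
      show 2 * μ + -(s + 2 * μ) = -s by ring, cpow_neg,
      ← inv_cpow _ _ (by rw [arg_ofReal_of_nonneg hz.le]; exact Real.pi_pos.ne), ← ofReal_inv]
    congr 2
    field_simp
  have h2 : (2 : ℂ) ^ (1 - (s + 2 * μ)) = 2 ^ (1 - 2 * μ) * 2 ^ (-s) := by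
    rw [← cpow_add _ _ two_ne_zero]
    congr 1
    ring
  rw [h2] at hdup
  rw [kernelXi, xi, if_pos (by linarith), halfXi, hHF s hs1, div_eq_iff (mul_ne_zero hs0 hs1')]
  linear_combination (((2 / (Q * z) : ℝ) : ℂ) ^ s * s * (Q : ℂ) ^ s * (s - 1) * F s) * hdup +
    (Gamma (s + 2 * μ) * 2 ^ (1 - 2 * μ) * (√Real.pi : ℝ) * s * (s - 1) * F s) * hpow

lemma kernelXi_left (h : DegreeOneEquation F Q μ ε) {H : ℂ → ℂ}
    (hHF : ∀ s ≠ 1, H s = (s - 1) * F s) {z : ℝ} (hz : 0 < z) {s : ℂ} (hs : 1 < s.re) :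
    kernelXi H Q μ ε (2 / (Q * z)) (1 - s) / ((1 - s) * ((1 - s) - 1)) =
      (ε ^ 2)⁻¹ * (2 / (Q * z) : ℝ) * (((Q ^ 2 / 2 * z : ℝ) : ℂ) ^ s *
        (Gamma (s / 2 + conj μ) * Gamma (1 + μ - s / 2)) * conj (F (conj s))) := by
  have hs0 : 1 - s ≠ 0 := fun e => by
    have := congrArg re e
    simp at this
    linarith
  have hs1 : (1 - s) - 1 ≠ 0 := fun e => by
    have := congrArg re e
    simp at this
    linarith
  have hY : (0 : ℝ) < 2 / (Q * z) := by have := h.Q_pos; positivity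
  have hpow : ((2 / (Q * z) : ℝ) : ℂ) ^ (1 - s) * (Q : ℂ) ^ s =
      (2 / (Q * z) : ℝ) * ((Q ^ 2 / 2 * z : ℝ) : ℂ) ^ s := by
    rw [cpow_sub _ _ (by exact_mod_cast hY.ne'), cpow_one, div_mul_eq_mul_div, mul_div_assoc,
      div_eq_mul_inv ((Q : ℂ) ^ s),
      ← inv_cpow _ _ (by rw [arg_ofReal_of_nonneg hY.le]; exact Real.pi_pos.ne),
      ← ofReal_inv, ← mul_cpow_ofReal_nonneg h.Q_pos.le (by positivity), ← ofReal_mul]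
    congr 3
    field_simp
  rw [kernelXi, h.xi_of_lt hHF (by simp; linarith), conj_halfXi hHF h.Q_pos hs0,
    div_eq_iff (mul_ne_zero hs0 hs1)]
  have e1 : (1 - s) / 2 + μ + 1 / 2 = 1 + μ - s / 2 := by ring
  have e2 : 1 - (1 - s) = s := by ring
  have e3 : 1 - conj (1 - s) = conj s := by simp
  rw [e1, e2, e3]
  linear_combination (Gamma (1 + μ - s / 2) * (ε ^ 2)⁻¹ * (1 - s) * (1 - s - 1) *
    Gamma (s / 2 + conj μ) * conj (F (conj s))) * hpow

lemma expSeries_eq_of_entire (h : DegreeOneEquation F Q μ ε) {G H : ℂ → ℂ} {m : ℕ}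
    (hG : IsOfFiniteOrder G) (hGF : ∀ s ≠ 1, G s = (s - 1) ^ m * F s) (hH : Differentiable ℂ H)
    (hHF : ∀ s ≠ 1, H s = (s - 1) * F s) {a : ℕ → ℂ} (ha0 : a 0 = 0)
    (ha : ∀ s : ℂ, 1 < s.re → LSeriesHasSum a s (F s)) :
    ∃ C r₀ r₁ : ℂ, C ≠ 0 ∧ ∀ z : ℝ, 0 < z → expSeries a μ z =
      C * z * (∑' n, dualTerm a μ Q z n) + (z : ℂ) ^ (-(2 * μ)) * (r₀ + r₁ / z) := by
  obtain ⟨A₀, A₁, hA⟩ := exists_integral_sub_integral_eq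
  have hsum : LSeriesSummable a (3 / 2 : ℝ) := (ha _ (by simp; norm_num)).LSeriesSummable
  have hL : ∀ s : ℂ, 1 < s.re → F s = LSeries a s := fun s hs => (ha s hs).LSeries_eq.symm
  have hLc : ∀ s : ℂ, 1 < s.re → conj (F (conj s)) = LSeries (fun n => conj (a n)) s :=
    fun s hs => by
      rw [hL _ (by simpa), LSeries, LSeries, conj_tsum]
      congr 1
      funext n
      rcases Nat.eq_zero_or_pos n with rfl | hn
      · simp
      rw [LSeries.term_of_ne_zero hn.ne', LSeries.term_of_ne_zero hn.ne', map_div₀, ← ofReal_natCast,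
        conj_ofReal_cpow (by exact_mod_cast hn), conj_conj]
  have hM : ∀ s : ℂ, s.re = 3 / 2 → ‖F s‖ ≤ ∑' n, ‖LSeries.term a (3 / 2 : ℝ) n‖ := fun s hs => by
    have hn : ∀ n, ‖LSeries.term a s n‖ = ‖LSeries.term a (3 / 2 : ℝ) n‖ := fun n => by
      simp [LSeries.norm_term_eq, hs]
    rw [hL s (by rw [hs]; norm_num), LSeries]
    simp only [← hn]
    exact norm_tsum_le_tsum_norm (by simpa only [hn] using hsum.norm)
  obtain ⟨B, hB⟩ := h.exists_norm_xi_le hG hGF hH hHF hM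
  set c₁ : ℂ := 2 ^ (1 - 2 * μ) * (√Real.pi : ℝ) * (2 * Real.pi) with hc₁
  have hπ : (Real.pi : ℂ) ≠ 0 := by exact_mod_cast Real.pi_ne_zero
  have hsπ : ((√Real.pi : ℝ) : ℂ) ≠ 0 := by exact_mod_cast (Real.sqrt_pos.2 Real.pi_pos).ne'
  have hc₁0 : c₁ ≠ 0 := by
    simp [hc₁, hπ, cpow_eq_zero_iff]
    exact fun h => absurd h (Real.sqrt_pos.2 Real.pi_pos).ne'
  set c₂ : ℂ := (ε ^ 2)⁻¹ * (2 / Q : ℝ) * (4 * Real.pi * Gamma ((1 + 2 * μ.re : ℝ) : ℂ) *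
    ((Q ^ 2 / 2 : ℝ) : ℂ) ^ (2 + 2 * μ)) with hc₂
  have hQ := h.Q_pos
  have hc₂0 : c₂ ≠ 0 := by
    have hμ := h.μ_re
    have h1 : Gamma ((1 + 2 * μ.re : ℝ) : ℂ) ≠ 0 :=
      Gamma_ne_zero_of_re_pos (by rw [ofReal_re]; linarith)
    have h2 : ((Q ^ 2 / 2 : ℝ) : ℂ) ≠ 0 := by exact_mod_cast (by positivity : Q ^ 2 / 2 ≠ 0)
    have h3 : ((2 / Q : ℝ) : ℂ) ≠ 0 := by exact_mod_cast (by positivity : 2 / Q ≠ 0)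
    have h4 : ((Q ^ 2 / 2 : ℝ) : ℂ) ^ (2 + 2 * μ) ≠ 0 := by
      rw [Ne, cpow_eq_zero_iff]
      exact fun h => h2 h.1
    exact mul_ne_zero (mul_ne_zero (inv_ne_zero (pow_ne_zero _ h.ε_ne_zero)) h3)
      (mul_ne_zero (mul_ne_zero (mul_ne_zero (by norm_num) hπ) h1) h4)
  refine ⟨c₂ / c₁, A₀ * (Gamma (μ + 1 / 2) * xi H Q μ ε 0) / c₁,
    A₁ * (Gamma (1 / 2 + μ + 1 / 2) * (2 / Q : ℝ) * xi H Q μ ε 1) / c₁, div_ne_zero hc₂0 hc₁0,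
    fun z hz => ?_⟩
  have hY : (0 : ℝ) < 2 / (Q * z) := by positivity
  obtain ⟨D, hD⟩ := exists_norm_kernelXi_le h.μ_re hB hY
  have key := hA _ D (h.differentiableOn_kernelXi hH hHF hY) hD
  have hzc : (z : ℂ) ≠ 0 := by exact_mod_cast hz.ne'
  have hright : ∫ t : ℝ, kernelXi H Q μ ε (2 / (Q * z)) ((3 / 2 : ℝ) + t * I) /
      (((3 / 2 : ℝ) + t * I) * ((3 / 2 : ℝ) + t * I - 1)) =
      c₁ * ((z : ℂ) ^ (2 * μ) * expSeries a μ z) := by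
    have e : ∀ t : ℝ, _ := fun t : ℝ => kernelXi_right (μ := μ) (ε := ε) h.Q_pos hHF hz
      (s := (3 / 2 : ℝ) + t * I) (by simp; norm_num)
    simp only [e]
    rw [MeasureTheory.integral_const_mul]
    have e2 : ∀ t : ℝ, F ((3 / 2 : ℝ) + t * I) = LSeries a ((3 / 2 : ℝ) + t * I) :=
      fun t => hL _ (by simp; norm_num)
    simp only [e2]
    rw [integral_Gamma_mul_LSeries ha0 h.μ_re hsum hz, hc₁]
    ring
  have hleft : ∫ t : ℝ, kernelXi H Q μ ε (2 / (Q * z)) ((-1 / 2 : ℝ) + t * I) /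
      (((-1 / 2 : ℝ) + t * I) * ((-1 / 2 : ℝ) + t * I - 1)) =
      c₂ * (z : ℂ) ^ (1 + 2 * μ) * ∑' n, dualTerm a μ Q z n := by
    rw [← MeasureTheory.integral_neg_eq_self]
    have e0 : ∀ t : ℝ, ((-1 / 2 : ℝ) : ℂ) + (-t : ℝ) * I = 1 - ((3 / 2 : ℝ) + t * I) := fun t => by
      push_cast
      ring
    have e : ∀ t : ℝ, _ := fun t : ℝ => h.kernelXi_left hHF hz
      (s := (3 / 2 : ℝ) + t * I) (by simp; norm_num)
    have e2 : ∀ t : ℝ, conj (F (conj ((3 / 2 : ℝ) + t * I))) =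
        LSeries (fun n => conj (a n)) ((3 / 2 : ℝ) + t * I) :=
      fun t => hLc _ (by simp; norm_num)
    simp only [e0, e, e2]
    rw [MeasureTheory.integral_const_mul, integral_Gamma_mul_Gamma_mul_LSeries ha0 h.μ_re hsum hQ hz,
      hc₂, ofReal_mul (Q ^ 2 / 2), mul_cpow_ofReal_nonneg (by positivity) hz.le]
    have e3 : (z : ℂ) ^ (2 + 2 * μ) = z * (z : ℂ) ^ (1 + 2 * μ) := by
      rw [show 2 + 2 * μ = 1 + (1 + 2 * μ) by ring, cpow_add _ _ hzc, cpow_one]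
    rw [e3]
    push_cast
    have : (Q : ℂ) ≠ 0 := h.Q_ne_zero
    field_simp
  rw [hright, hleft] at key
  have hz2 : (z : ℂ) ^ (2 * μ) ≠ 0 := by simp [cpow_eq_zero_iff, hzc]
  have e4 : (z : ℂ) ^ (1 + 2 * μ) = z * (z : ℂ) ^ (2 * μ) := by
    rw [cpow_add _ _ hzc, cpow_one]
  rw [e4] at key
  rw [← mul_right_inj' (mul_ne_zero hc₁0 hz2), mul_assoc, key, cpow_neg]
  simp only [kernelXi, zero_div, cpow_zero, zero_add, mul_one, cpow_one]
  have : (Q : ℂ) ≠ 0 := h.Q_ne_zero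
  push_cast
  field_simp
  ring

end DegreeOneEquation

/-! ### Analytic continuation of the transformation formula to the right half-plane -/

/-- The right half-plane. -/
def rightHalfPlane : Set ℂ := {z | 0 < z.re}

lemma isOpen_rightHalfPlane : IsOpen rightHalfPlane := isOpen_lt continuous_const continuous_re

lemma norm_one_add_sq (w : ℂ) : ‖1 + w ^ 2‖ = ‖w - I‖ * ‖w + I‖ := by
  rw [← norm_mul]
  congr 1
  linear_combination I_sq

lemma norm_one_add_sq_ge_half {w : ℂ} (hw : ‖w‖ ^ 2 ≤ 1 / 2) : 1 / 2 ≤ ‖1 + w ^ 2‖ := by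
  have := norm_sub_le (1 + w ^ 2) (w ^ 2)
  simp at this
  linarith

lemma norm_one_add_sq_ge {w : ℂ} (hw : 0 < w.re) : (w.re / ‖w‖) ^ 2 / 2 ≤ ‖1 + w ^ 2‖ := by
  have hw0 : 0 < ‖w‖ := hw.trans_le (re_le_norm w)
  have h1 : w.re / ‖w‖ ≤ 1 := (div_le_one hw0).2 (re_le_norm w)
  rcases le_or_gt (‖w‖ ^ 2) (1 / 2) with h | h
  · have := norm_one_add_sq_ge_half h
    have h2 : (w.re / ‖w‖) ^ 2 ≤ 1 := pow_le_one₀ (by positivity) h1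
    linarith
  · have h2 : w.re ≤ ‖w - I‖ := by simpa using re_le_norm (w - I)
    have h3 : w.re ≤ ‖w + I‖ := by simpa using re_le_norm (w + I)
    calc (w.re / ‖w‖) ^ 2 / 2 = w.re ^ 2 * ((‖w‖ ^ 2)⁻¹ / 2) := by rw [div_pow]; ring
      _ ≤ w.re ^ 2 * 1 := by
        gcongr
        rw [div_le_one two_pos]
        exact inv_le_of_inv_le₀ two_pos (by linarith)
      _ = w.re * w.re := by ring
      _ ≤ ‖w - I‖ * ‖w + I‖ := by gcongr
      _ = _ := (norm_one_add_sq w).symm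

lemma one_add_sq_mem_slitPlane {w : ℂ} (hw : 0 ≤ w.re) (hw' : w.re = 0 → w = 0) :
    1 + w ^ 2 ∈ slitPlane := by
  rw [mem_slitPlane_iff]
  by_cases him : w.im = 0
  · left
    simp [sq, him]
    positivity
  · right
    rcases hw.eq_or_lt with h | h
    · exact absurd (by rw [hw' h.symm]; rfl) him
    · simp only [add_im, one_im, sq, mul_im, zero_add]
      intro h0
      have : w.re * w.im = 0 := by linarith
      exact (mul_ne_zero h.ne' him) this

section Summability

variable {a : ℕ → ℂ} {μ : ℂ}

lemma norm_dual_coeff_le (ha0 : a 0 = 0) (hμ : 0 ≤ μ.re) (n : ℕ) :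
    ‖conj (a n) * (n : ℂ) ^ (-(2 + 2 * μ))‖ ≤ ‖LSeries.term a 2 n‖ := by
  rcases Nat.eq_zero_or_pos n with rfl | hn
  · simp [ha0]
  have hn1 : (1 : ℝ) ≤ n := by exact_mod_cast hn
  rw [LSeries.term_of_ne_zero hn.ne', norm_mul, norm_div, norm_conj, ← ofReal_natCast,
    norm_cpow_eq_rpow_re_of_pos (by linarith), norm_cpow_eq_rpow_re_of_pos (by linarith),
    div_eq_mul_inv, ← Real.rpow_neg (by linarith)]
  gcongr
  simp
  linarith

lemma differentiableAt_dualTerm {Q : ℝ} (n : ℕ) {z : ℂ} (hQ : 0 < Q) (hz : 0 < z.re) :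
    DifferentiableAt ℂ (fun z => dualTerm a μ Q z n) z := by
  unfold dualTerm
  refine DifferentiableAt.const_mul (DifferentiableAt.cpow (by fun_prop) (by fun_prop) ?_) _
  rcases Nat.eq_zero_or_pos n with rfl | hn
  · simp
  have hre : 0 < (((Q ^ 2 / 2 : ℝ) : ℂ) * z / n).re := by
    rw [div_natCast_re, re_ofReal_mul]
    positivity
  exact one_add_sq_mem_slitPlane hre.le fun h => absurd h hre.ne'

lemma differentiableOn_dualSeries (ha0 : a 0 = 0) (hμ : 0 ≤ μ.re) (ha : LSeriesSummable a 2)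
    {Q : ℝ} (hQ : 0 < Q) :
    DifferentiableOn ℂ (fun z => ∑' n, dualTerm a μ Q z n) rightHalfPlane := by
  intro z₀ (hz₀ : 0 < z₀.re)
  set δ := z₀.re / 2
  set R := ‖z₀‖ + 1
  set U : Set ℂ := {z | δ < z.re ∧ ‖z‖ < R}
  have hδ : 0 < δ := half_pos hz₀
  have hR : 0 < R := by positivity
  have hU : IsOpen U :=
    (isOpen_lt continuous_const continuous_re).inter (isOpen_lt continuous_norm continuous_const)
  have hmem : z₀ ∈ U := ⟨half_lt_self hz₀, lt_add_one _⟩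
  set b : ℝ := min 1 ((δ / R) ^ 2 / 2)
  have hb : 0 < b := by positivity
  have key : DifferentiableOn ℂ (fun z => ∑' n, dualTerm a μ Q z n) U := by
    refine differentiableOn_tsum_of_summable_norm
      (u := fun n => ‖LSeries.term a 2 n‖ * b ^ (-(1 + 2 * μ.re))) (ha.norm.mul_right _)
      (fun n z hz => (differentiableAt_dualTerm n hQ (hδ.trans hz.1)).differentiableWithinAt) hU
      fun n z hz => ?_
    rw [dualTerm, norm_mul, norm_cpow_real]
    refine mul_le_mul (norm_dual_coeff_le ha0 hμ n) ?_ (by positivity) (norm_nonneg _)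
    refine Real.rpow_le_rpow_of_nonpos hb ?_ (by linarith)
    rcases Nat.eq_zero_or_pos n with rfl | hn
    · simp [b]
    have hn' : (0 : ℝ) < n := by exact_mod_cast hn
    have hre : (((Q ^ 2 / 2 : ℝ) : ℂ) * z / n).re = Q ^ 2 / 2 * z.re / n := by
      rw [div_natCast_re, re_ofReal_mul]
    have hno : ‖((Q ^ 2 / 2 : ℝ) : ℂ) * z / n‖ = Q ^ 2 / 2 * ‖z‖ / n := by
      rw [norm_div, norm_mul, norm_real, Real.norm_of_nonneg (by positivity), norm_natCast]
    have hz0 : 0 < z.re := hδ.trans hz.1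
    have hzn : 0 < ‖z‖ := hz0.trans_le (re_le_norm z)
    have := norm_one_add_sq_ge (w := ((Q ^ 2 / 2 : ℝ) : ℂ) * z / n) (by rw [hre]; positivity)
    refine le_trans ((min_le_right _ _).trans ?_) this
    have e : Q ^ 2 / 2 * z.re / n / (Q ^ 2 / 2 * ‖z‖ / n) = z.re / ‖z‖ := by field_simp
    rw [hre, hno, e]
    gcongr
    · exact hz.1.le
    · exact hz.2.le
  exact (key.differentiableAt (hU.mem_nhds hmem)).differentiableWithinAt

lemma norm_mul_natCast_cpow_le {C : ℝ} (hC : ∀ n ≠ 0, ‖a n‖ ≤ C * (n : ℝ) ^ (2 : ℝ)) {k : ℕ}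
    (hk : 2 + (2 * μ).re ≤ k) {n : ℕ} (hn : n ≠ 0) :
    ‖a n * (n : ℂ) ^ (2 * μ)‖ ≤ C * (n : ℝ) ^ k := by
  have hnR : (0 : ℝ) < n := by positivity
  have hn1 : (1 : ℝ) ≤ n := by exact_mod_cast Nat.one_le_iff_ne_zero.2 hn
  have hC0 : 0 ≤ C := by
    have := (norm_nonneg _).trans (hC 1 one_ne_zero)
    simpa using this
  rw [norm_mul, ← ofReal_natCast, norm_cpow_eq_rpow_re_of_pos hnR]
  calc ‖a n‖ * (n : ℝ) ^ (2 * μ).re ≤ C * (n : ℝ) ^ (2 : ℝ) * (n : ℝ) ^ (2 * μ).re := by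
        gcongr
        exact hC n hn
    _ = C * (n : ℝ) ^ (2 + (2 * μ).re) := by rw [mul_assoc, ← Real.rpow_add hnR]
    _ ≤ C * (n : ℝ) ^ (k : ℝ) := by
        gcongr
    _ = _ := by rw [Real.rpow_natCast]

lemma exists_summable_bound_expSeries (ha0 : a 0 = 0) (ha : LSeriesSummable a 2) {δ : ℝ}
    (hδ : 0 < δ) : ∃ u : ℕ → ℝ, Summable u ∧ ∀ (n : ℕ) (z : ℂ), δ ≤ z.re →
      ‖a n * (n : ℂ) ^ (2 * μ) * exp (-(n * z))‖ ≤ u n := by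
  obtain ⟨C, hC⟩ := ha.le_const_mul_rpow
  obtain ⟨k, hk⟩ := exists_nat_ge (2 + (2 * μ).re)
  refine ⟨fun n => C * ((n : ℝ) ^ k * Real.exp (-δ * n)),
    (Real.summable_pow_mul_exp_neg_nat_mul k hδ).mul_left C, fun n z hz => ?_⟩
  rcases Nat.eq_zero_or_pos n with rfl | hn
  · simp only [ha0, zero_mul, norm_zero]
    have := (norm_nonneg _).trans (hC 1 one_ne_zero)
    have hC0 : 0 ≤ C := by simpa using this
    positivity
  · simp only
    rw [norm_mul, norm_exp, ← mul_assoc]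
    have h1 := norm_mul_natCast_cpow_le (μ := μ) (by simpa using hC) hk hn.ne'
    refine mul_le_mul h1 ?_ (Real.exp_nonneg _) ((norm_nonneg _).trans h1)
    rw [Real.exp_le_exp]
    simp
    nlinarith [(by exact_mod_cast hn : (0 : ℝ) < n)]

lemma summable_expSeries (ha0 : a 0 = 0) (ha : LSeriesSummable a 2) {z : ℂ} (hz : 0 < z.re) :
    Summable fun n : ℕ => a n * (n : ℂ) ^ (2 * μ) * exp (-(n * z)) := by
  obtain ⟨u, hu, hb⟩ := exists_summable_bound_expSeries (μ := μ) ha0 ha hz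
  exact hu.of_norm_bounded fun n => hb n z le_rfl

lemma differentiableOn_expSeries (ha0 : a 0 = 0) (ha : LSeriesSummable a 2) :
    DifferentiableOn ℂ (expSeries a μ) rightHalfPlane := by
  intro z₀ (hz₀ : 0 < z₀.re)
  obtain ⟨u, hu, hb⟩ := exists_summable_bound_expSeries (μ := μ) ha0 ha (half_pos hz₀)
  have hU : IsOpen {z : ℂ | z₀.re / 2 < z.re} := isOpen_lt continuous_const continuous_re
  have key : DifferentiableOn ℂ (expSeries a μ) {z : ℂ | z₀.re / 2 < z.re} :=
    differentiableOn_tsum_of_summable_norm hu (fun n => by fun_prop) hU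
      fun n z hz => hb n z (le_of_lt hz)
  exact (key.differentiableAt (hU.mem_nhds (half_lt_self hz₀))).differentiableWithinAt

end Summability

lemma eqOn_rightHalfPlane_of_ofReal {f g : ℂ → ℂ} (hf : DifferentiableOn ℂ f rightHalfPlane)
    (hg : DifferentiableOn ℂ g rightHalfPlane) (h : ∀ x : ℝ, 0 < x → f x = g x) :
    Set.EqOn f g rightHalfPlane := by
  have hpre : IsPreconnected rightHalfPlane := (convex_halfSpace_re_gt 0).isPreconnected
  refine AnalyticOnNhd.eqOn_of_preconnected_of_frequently_eq
    (hf.analyticOnNhd isOpen_rightHalfPlane) (hg.analyticOnNhd isOpen_rightHalfPlane) hpre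
    (z₀ := ((1 : ℝ) : ℂ)) (by simp [rightHalfPlane]) ?_
  have hreal : ∃ᶠ x : ℝ in 𝓝[≠] 1, f x = g x := by
    refine Eventually.frequently ?_
    filter_upwards [nhdsWithin_le_nhds (Ioi_mem_nhds zero_lt_one)] with x hx using h x hx
  refine Tendsto.frequently (f := fun x : ℝ => (x : ℂ)) ?_ hreal
  exact tendsto_nhdsWithin_iff.2 ⟨(continuous_ofReal.tendsto 1).mono_left nhdsWithin_le_nhds,
    by filter_upwards [self_mem_nhdsWithin] with x hx using by simpa using hx⟩

/-! ### Boundary behaviour of the exponential series on the imaginary axis -/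

/-- The coefficients `a n * n ^ (2 i Im μ)`. -/
noncomputable def twist (a : ℕ → ℂ) (μ : ℂ) (n : ℕ) : ℂ := a n * (n : ℂ) ^ (2 * μ.im * I)

lemma tendsto_ofReal_cpow_zero {A : ℝ} (hA : 0 < A) :
    Tendsto (fun y : ℝ => (y : ℂ) ^ (A : ℂ)) (𝓝[>] 0) (𝓝 0) := by
  rw [tendsto_zero_iff_norm_tendsto_zero]
  have h : Tendsto (fun y : ℝ => y ^ A) (𝓝[>] 0) (𝓝 (0 ^ A)) :=
    (Real.continuousAt_rpow_const 0 A (Or.inr hA.le)).tendsto.mono_left nhdsWithin_le_nhds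
  rw [Real.zero_rpow hA.ne'] at h
  refine h.congr' ?_
  filter_upwards [self_mem_nhdsWithin] with y (hy : 0 < y)
  rw [norm_cpow_eq_rpow_re_of_pos hy, ofReal_re]

lemma tendsto_add_mul_I (x : ℝ) :
    Tendsto (fun y : ℝ => (y : ℂ) + x * I) (𝓝[>] 0) (𝓝 (x * I)) := by
  have : ContinuousAt (fun y : ℝ => (y : ℂ) + x * I) 0 := by fun_prop
  simpa [ContinuousAt] using this.tendsto.mono_left nhdsWithin_le_nhds

lemma tendsto_kernel_pole {A η : ℝ} (hη : 0 < η) :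
    Tendsto (fun y : ℝ => (y : ℂ) ^ (A : ℂ) * (1 + (I + (η * y : ℝ)) ^ 2) ^ ((-A : ℝ) : ℂ))
      (𝓝[>] 0) (𝓝 ((η : ℂ) ^ ((-A : ℝ) : ℂ) * (2 * I) ^ ((-A : ℝ) : ℂ))) := by
  have hc : ContinuousAt (fun y : ℝ => (2 * I + (η * y : ℝ)) ^ ((-A : ℝ) : ℂ)) 0 := by
    refine ContinuousAt.cpow (by fun_prop) continuousAt_const ?_
    simp [mem_slitPlane_iff]
  have hl : Tendsto (fun y : ℝ => (η : ℂ) ^ ((-A : ℝ) : ℂ) *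
      (2 * I + (η * y : ℝ)) ^ ((-A : ℝ) : ℂ)) (𝓝[>] 0)
      (𝓝 ((η : ℂ) ^ ((-A : ℝ) : ℂ) * (2 * I) ^ ((-A : ℝ) : ℂ))) := by
    have := (hc.tendsto.mono_left (nhdsWithin_le_nhds (s := Set.Ioi 0))).const_mul
      ((η : ℂ) ^ ((-A : ℝ) : ℂ))
    simpa using this
  refine hl.congr' ?_
  filter_upwards [self_mem_nhdsWithin] with y (hy : 0 < y)
  have hy0 : (y : ℂ) ≠ 0 := by exact_mod_cast hy.ne'
  have e : 1 + (I + (η * y : ℝ)) ^ 2 = ((η * y : ℝ) : ℂ) * (2 * I + (η * y : ℝ)) := by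
    linear_combination I_sq
  have e2 : (((η * y : ℝ) : ℂ) * (2 * I + (η * y : ℝ))) ^ ((-A : ℝ) : ℂ) =
      ((η * y : ℝ) : ℂ) ^ ((-A : ℝ) : ℂ) * (2 * I + (η * y : ℝ)) ^ ((-A : ℝ) : ℂ) := by
    have hp : 0 < η * y := by positivity
    have hne : (2 * I + ((η * y : ℝ) : ℂ)) ≠ 0 := fun h => by simpa using congrArg im h
    rw [cpow_def_of_ne_zero (mul_ne_zero (by exact_mod_cast hp.ne') hne),
      cpow_def_of_ne_zero (by exact_mod_cast hp.ne'), cpow_def_of_ne_zero hne,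
      log_ofReal_mul hp hne, ← exp_add, ofReal_log hp.le, add_mul]
  have e3 : (y : ℂ) ^ (A : ℂ) * (y : ℂ) ^ ((-A : ℝ) : ℂ) = 1 := by
    rw [← cpow_add _ _ hy0]
    simp
  rw [e, e2, ofReal_mul η y, mul_cpow_ofReal_nonneg hη.le hy.le]
  linear_combination (-(η : ℂ) ^ ((-A : ℝ) : ℂ) * (2 * I + η * y) ^ ((-A : ℝ) : ℂ)) * e3

section Boundary

variable {a : ℕ → ℂ} {μ : ℂ} {Q : ℝ}

/-- The limit of `y ^ (1 + 2 Re μ)` times the `n`-th term of the dual series at `y + i x`. -/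
noncomputable def dualLimit (a : ℕ → ℂ) (μ : ℂ) (Q x : ℝ) (n : ℕ) : ℂ :=
  if Q ^ 2 / 2 * x = n then conj (a n) * (n : ℂ) ^ (-(2 + 2 * μ)) *
    (((Q ^ 2 / 2 / n : ℝ) : ℂ) ^ ((-(1 + 2 * μ.re) : ℝ) : ℂ) *
      (2 * I) ^ ((-(1 + 2 * μ.re) : ℝ) : ℂ)) else 0

lemma tendsto_dualTerm (ha0 : a 0 = 0) (hμ : 0 ≤ μ.re) (hQ : 0 < Q) {x : ℝ} (hx : 0 < x) (n : ℕ) :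
    Tendsto (fun y : ℝ => (y : ℂ) ^ ((1 + 2 * μ.re : ℝ) : ℂ) * dualTerm a μ Q (y + x * I) n)
      (𝓝[>] 0) (𝓝 (dualLimit a μ Q x n)) := by
  rcases Nat.eq_zero_or_pos n with rfl | hn
  · simp [dualTerm, dualLimit, ha0]
  have hn0 : (n : ℂ) ≠ 0 := by exact_mod_cast hn.ne'
  have hnR : (0 : ℝ) < n := by exact_mod_cast hn
  set A : ℝ := 1 + 2 * μ.re with hA
  rw [dualLimit]
  split_ifs with h
  · have hη : 0 < Q ^ 2 / 2 / n := by positivity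
    refine ((tendsto_kernel_pole (A := A) hη).const_mul
      (conj (a n) * (n : ℂ) ^ (-(2 + 2 * μ)))).congr fun y => ?_
    have e : ((Q ^ 2 / 2 : ℝ) : ℂ) * (y + x * I) / n = I + (Q ^ 2 / 2 / n * y : ℝ) := by
      have h' : ((Q ^ 2 / 2 : ℝ) : ℂ) * x = n := by exact_mod_cast h
      rw [div_eq_iff hn0]
      push_cast at h' ⊢
      field_simp at h' ⊢
      linear_combination I * h'
    rw [dualTerm, e, ← hA]
    ring
  · set w : ℂ := (Q ^ 2 / 2 : ℝ) * (x * I) / n with hw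
    have hwne : 1 + w ^ 2 ≠ 0 := by
      have e : 1 + w ^ 2 = ((1 - (Q ^ 2 / 2 * x / n) ^ 2 : ℝ) : ℂ) := by
        rw [hw]
        push_cast
        linear_combination ((Q : ℂ) ^ 2 / 2 * x / n) ^ 2 * I_sq
      rw [e]
      norm_cast
      intro h0
      have h1 : (Q ^ 2 / 2 * x / n) ^ 2 = 1 := by linarith
      rw [pow_eq_one_iff_of_nonneg (by positivity) two_ne_zero, div_eq_one_iff_eq hnR.ne'] at h1
      exact h h1
    have hcont : ContinuousAt (fun z : ℂ => ‖1 + ((Q ^ 2 / 2 : ℝ) * z / n) ^ 2‖ ^ (-A)) (x * I) :=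
      ContinuousAt.rpow_const (by fun_prop) (Or.inl (norm_ne_zero_iff.2 hwne))
    have hlim := (hcont.tendsto.comp (tendsto_add_mul_I x)).const_mul
      ‖conj (a n) * (n : ℂ) ^ (-(2 + 2 * μ))‖
    have hprod := (tendsto_ofReal_cpow_zero (A := A) (by linarith)).norm.mul hlim
    rw [norm_zero, zero_mul] at hprod
    rw [tendsto_zero_iff_norm_tendsto_zero]
    refine hprod.congr fun y => ?_
    rw [dualTerm, norm_mul ((y : ℂ) ^ (A : ℂ)), norm_mul (conj (a n) * _), norm_cpow_real,
      norm_cpow_real]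
    rfl

lemma norm_one_add_sq_ge_mul {c x y : ℝ} (hc : 0 < c) (hx : 0 < x) (hy : 0 < y) (hy1 : y ≤ 1)
    {n : ℕ} (hn : 0 < n) :
    y / (2 * (1 + x)) ≤ ‖1 + ((c : ℂ) * (y + x * I) / n) ^ 2‖ := by
  have hnR : (0 : ℝ) < n := by exact_mod_cast hn
  set w : ℂ := (c : ℂ) * (y + x * I) / n with hw
  have hre : w.re = c * y / n := by
    rw [hw, div_natCast_re, re_ofReal_mul]
    simp
  have him : w.im = c * x / n := by
    rw [hw, div_natCast_im, im_ofReal_mul]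
    simp
  rcases le_or_gt (‖w‖ ^ 2) (1 / 2) with h | h
  · refine le_trans ?_ (norm_one_add_sq_ge_half h)
    rw [div_le_div_iff₀ (by positivity) two_pos]
    nlinarith
  · have hcn : 1 / (2 * (1 + x)) ≤ c / n := by
      rw [← normSq_eq_norm_sq, normSq_apply, hre, him] at h
      rw [div_le_div_iff₀ (by positivity) hnR, one_mul]
      by_contra! hlt
      have h2 : c / n * (1 + x) < 1 / 2 := by
        rw [div_mul_eq_mul_div, div_lt_iff₀ hnR]
        linarith
      have h3 : 0 < c / n := by positivity
      have e : c * y / n * (c * y / n) + c * x / n * (c * x / n) =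
          (c / n) ^ 2 * (y ^ 2 + x ^ 2) := by ring
      rw [e] at h
      have h4 : y ^ 2 + x ^ 2 ≤ (1 + x) ^ 2 := by nlinarith
      have h5 : (c / n) ^ 2 * (y ^ 2 + x ^ 2) ≤ (c / n * (1 + x)) ^ 2 := by
        rw [mul_pow]
        gcongr
      have h6 : (c / n * (1 + x)) ^ 2 ≤ (1 / 2) ^ 2 := by
        gcongr
      linarith
    have h1 : w.re ≤ ‖w - I‖ := by simpa using re_le_norm (w - I)
    have h2 : 1 ≤ ‖w + I‖ := by
      refine le_trans ?_ (im_le_norm (w + I))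
      simp [him]
      positivity
    rw [norm_one_add_sq]
    calc y / (2 * (1 + x)) = 1 / (2 * (1 + x)) * y := by ring
      _ ≤ c / n * y := by gcongr
      _ = w.re * 1 := by rw [hre]; ring
      _ ≤ _ := by gcongr

lemma tendsto_dualSeries (ha0 : a 0 = 0) (hμ : 0 ≤ μ.re) (hQ : 0 < Q) (ha : LSeriesSummable a 2)
    {x : ℝ} (hx : 0 < x) :
    Tendsto (fun y : ℝ => (y : ℂ) ^ ((1 + 2 * μ.re : ℝ) : ℂ) *
      ∑' n, dualTerm a μ Q (y + x * I) n) (𝓝[>] 0) (𝓝 (∑' n, dualLimit a μ Q x n)) := by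
  simp only [← tsum_mul_left]
  refine tendsto_tsum_of_dominated_convergence (bound := fun n => ‖LSeries.term a 2 n‖ *
    (1 / (2 * (1 + x))) ^ (-(1 + 2 * μ.re))) (ha.norm.mul_right _)
    (tendsto_dualTerm ha0 hμ hQ hx) ?_
  filter_upwards [self_mem_nhdsWithin, nhdsWithin_le_nhds (Iic_mem_nhds zero_lt_one)]
    with y (hy : 0 < y) (hy1 : y ≤ 1) n
  rcases Nat.eq_zero_or_pos n with rfl | hn
  · simp [dualTerm, ha0]
  set A : ℝ := 1 + 2 * μ.re
  have hA : 0 ≤ A := by positivity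
  rw [dualTerm, mul_left_comm, norm_mul]
  refine mul_le_mul (norm_dual_coeff_le ha0 hμ n) ?_ (norm_nonneg _) (norm_nonneg _)
  rw [norm_mul, norm_cpow_real, norm_cpow_real, norm_real, Real.norm_of_nonneg hy.le]
  have hge := norm_one_add_sq_ge_mul (c := Q ^ 2 / 2) (by positivity) hx hy hy1 hn
  have h1 : ‖1 + (((Q ^ 2 / 2 : ℝ) : ℂ) * (y + x * I) / n) ^ 2‖ ^ (-A) ≤
      (y / (2 * (1 + x))) ^ (-A) :=
    Real.rpow_le_rpow_of_nonpos (by positivity) hge (by linarith)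
  calc _ ≤ y ^ A * (y / (2 * (1 + x))) ^ (-A) := by gcongr
    _ = (y ^ A * y ^ (-A)) * (1 / (2 * (1 + x))) ^ (-A) := by
      rw [mul_assoc, ← Real.mul_rpow hy.le (by positivity)]
      congr 2
      ring
    _ = _ := by rw [← Real.rpow_add hy, add_neg_cancel, Real.rpow_zero, one_mul]

lemma tsum_dualLimit_of_eq {x : ℝ} {m : ℕ} (hm : 0 < m) (hQ : 0 < Q) (hx : Q ^ 2 / 2 * x = m) :
    x * ∑' n, dualLimit a μ Q x n = (Q ^ 2 / 2 : ℝ)⁻¹ *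
      (((Q ^ 2 / 2 : ℝ) : ℂ) ^ ((-(1 + 2 * μ.re) : ℝ) : ℂ) *
      (2 * I) ^ ((-(1 + 2 * μ.re) : ℝ) : ℂ)) * conj (twist a μ m) := by
  have hmR : (0 : ℝ) < m := by exact_mod_cast hm
  have hm0 : (m : ℂ) ≠ 0 := by exact_mod_cast hm.ne'
  have hc : (0 : ℝ) < Q ^ 2 / 2 := by positivity
  rw [tsum_eq_single m fun n hn => by
    rw [dualLimit, if_neg]
    rw [hx]
    exact_mod_cast hn.symm, dualLimit, if_pos hx, twist, map_mul]
  have hxe : x = (Q ^ 2 / 2)⁻¹ * m := by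
    rw [← hx]
    field_simp
  have h1 : ((Q ^ 2 / 2 / m : ℝ) : ℂ) ^ ((-(1 + 2 * μ.re) : ℝ) : ℂ) =
      ((Q ^ 2 / 2 : ℝ) : ℂ) ^ ((-(1 + 2 * μ.re) : ℝ) : ℂ) *
        (m : ℂ) ^ ((1 + 2 * μ.re : ℝ) : ℂ) := by
    rw [div_eq_mul_inv, ofReal_mul, mul_cpow_ofReal_nonneg hc.le (by positivity), ofReal_inv,
      inv_cpow _ _ (by rw [arg_ofReal_of_nonneg hmR.le]; exact Real.pi_pos.ne), ← cpow_neg]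
    simp
  have h2 : conj ((m : ℂ) ^ (2 * μ.im * I)) = (m : ℂ) * (m : ℂ) ^ (-(2 + 2 * μ)) *
      (m : ℂ) ^ ((1 + 2 * μ.re : ℝ) : ℂ) := by
    rw [← ofReal_natCast, conj_ofReal_cpow hmR, ofReal_natCast]
    nth_rewrite 2 [← cpow_one (m : ℂ)]
    rw [← cpow_add _ _ hm0, ← cpow_add _ _ hm0]
    congr 1
    simp only [map_mul, map_ofNat, conj_ofReal, conj_I]
    push_cast
    linear_combination (-2 : ℂ) * re_add_im μ
  rw [h1, h2, hxe]
  push_cast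
  ring

lemma tsum_dualLimit_of_ne {x : ℝ} (ha0 : a 0 = 0) (hx : ∀ m : ℕ, 0 < m → Q ^ 2 / 2 * x ≠ m) :
    ∑' n, dualLimit a μ Q x n = 0 := by
  refine (tsum_congr fun n => ?_).trans tsum_zero
  rcases Nat.eq_zero_or_pos n with rfl | hn
  · simp [dualLimit, ha0]
  · rw [dualLimit, if_neg (hx n hn)]

/-- The boundary behaviour of the exponential series at the points of the upper imaginary axis. -/
lemma exists_tendsto_expSeries (ha0 : a 0 = 0) (hμ : 0 ≤ μ.re) (hQ : 0 < Q)
    (ha : LSeriesSummable a 2) {C r₀ r₁ : ℂ} (hC : C ≠ 0)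
    (hreal : ∀ z : ℝ, 0 < z → expSeries a μ z =
      C * z * (∑' n, dualTerm a μ Q z n) + (z : ℂ) ^ (-(2 * μ)) * (r₀ + r₁ / z)) :
    ∃ K : ℂ, K ≠ 0 ∧ ∀ x : ℝ, 0 < x →
      (∀ m : ℕ, 0 < m → Q ^ 2 / 2 * x = m → Tendsto (fun y : ℝ =>
        (y : ℂ) ^ ((1 + 2 * μ.re : ℝ) : ℂ) * expSeries a μ (y + x * I)) (𝓝[>] 0)
        (𝓝 (K * conj (twist a μ m)))) ∧
      ((∀ m : ℕ, 0 < m → Q ^ 2 / 2 * x ≠ m) → Tendsto (fun y : ℝ =>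
        (y : ℂ) ^ ((1 + 2 * μ.re : ℝ) : ℂ) * expSeries a μ (y + x * I)) (𝓝[>] 0) (𝓝 0)) := by
  have hA : 0 < 1 + 2 * μ.re := by positivity
  have hdr : DifferentiableOn ℂ (fun z => z ^ (-(2 * μ)) * (r₀ + r₁ / z)) rightHalfPlane := by
    intro z (hz : 0 < z.re)
    have hz0 : z ≠ 0 := fun h => by simp [h] at hz
    refine DifferentiableAt.differentiableWithinAt (DifferentiableAt.mul ?_ ?_)
    · exact DifferentiableAt.cpow (by fun_prop) (by fun_prop) (Or.inl hz)
    · exact DifferentiableAt.add (by fun_prop) (DifferentiableAt.div (by fun_prop) (by fun_prop) hz0)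
  have heq := eqOn_rightHalfPlane_of_ofReal (differentiableOn_expSeries (μ := μ) ha0 ha)
    (g := fun z => C * z * (∑' n, dualTerm a μ Q z n) + z ^ (-(2 * μ)) * (r₀ + r₁ / z))
    (((differentiableOn_id.const_mul C).mul (differentiableOn_dualSeries ha0 hμ ha hQ)).add hdr)
    hreal
  have hlim : ∀ x : ℝ, 0 < x → Tendsto (fun y : ℝ =>
      (y : ℂ) ^ ((1 + 2 * μ.re : ℝ) : ℂ) * expSeries a μ (y + x * I)) (𝓝[>] 0)
      (𝓝 (C * I * (x * ∑' n, dualLimit a μ Q x n))) := fun x hx => by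
    have h1 := ((tendsto_add_mul_I x).const_mul C).mul (tendsto_dualSeries ha0 hμ hQ ha hx)
    have hxI : (x : ℂ) * I ≠ 0 := mul_ne_zero (by exact_mod_cast hx.ne') I_ne_zero
    have hcr : ContinuousAt (fun z : ℂ => z ^ (-(2 * μ)) * (r₀ + r₁ / z)) (x * I) := by
      refine ContinuousAt.mul (ContinuousAt.cpow (by fun_prop) (by fun_prop) ?_)
        (ContinuousAt.add (by fun_prop) (ContinuousAt.div (by fun_prop) (by fun_prop) hxI))
      simp [mem_slitPlane_iff, hx.ne']
    have h2 := (tendsto_ofReal_cpow_zero hA).mul (hcr.tendsto.comp (tendsto_add_mul_I x))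
    have h3 := h1.add h2
    rw [zero_mul, add_zero] at h3
    refine (h3.congr' ?_).trans (le_of_eq ?_)
    · filter_upwards [self_mem_nhdsWithin] with y (hy : 0 < y)
      rw [heq (show (y : ℂ) + x * I ∈ rightHalfPlane by simpa [rightHalfPlane] using hy)]
      simp only [Function.comp]
      ring
    · congr 1
      ring
  set K₀ : ℂ := (Q ^ 2 / 2 : ℝ)⁻¹ * (((Q ^ 2 / 2 : ℝ) : ℂ) ^ ((-(1 + 2 * μ.re) : ℝ) : ℂ) *
      (2 * I) ^ ((-(1 + 2 * μ.re) : ℝ) : ℂ)) with hK₀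
  have hcne : ((Q ^ 2 / 2 : ℝ) : ℂ) ≠ 0 := by exact_mod_cast (by positivity : Q ^ 2 / 2 ≠ 0)
  have hK₀ne : K₀ ≠ 0 := by
    refine mul_ne_zero ?_ (mul_ne_zero ?_ ?_)
    · rw [ofReal_inv]
      exact inv_ne_zero hcne
    · rw [Ne, cpow_eq_zero_iff]
      exact fun h => hcne h.1
    · rw [Ne, cpow_eq_zero_iff]
      exact fun h => mul_ne_zero two_ne_zero I_ne_zero h.1
  refine ⟨C * I * K₀, mul_ne_zero (mul_ne_zero hC I_ne_zero) hK₀ne, fun x hx =>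
    ⟨fun m hm hxm => ?_, fun hxm => ?_⟩⟩
  · have := hlim x hx
    rwa [tsum_dualLimit_of_eq hm hQ hxm, ← hK₀, ← mul_assoc] at this
  · have := hlim x hx
    rwa [tsum_dualLimit_of_ne ha0 hxm, mul_zero, mul_zero] at this

end Boundary

/-! ### Exponential sums over residue classes -/

/-- The sum `∑ (j + 1 + q k) ^ p * exp (- q k y)` over `k`. -/
noncomputable def classSum (q : ℕ) (p y : ℝ) (j : ℕ) : ℝ :=
  ∑' k : ℕ, ((j + q * k + 1 : ℕ) : ℝ) ^ p * Real.exp (-(q * k * y))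

lemma summable_classSum {q : ℕ} (hq : 0 < q) (p : ℝ) {y : ℝ} (hy : 0 < y) (j : ℕ) :
    Summable fun k : ℕ => ((j + q * k + 1 : ℕ) : ℝ) ^ p * Real.exp (-(q * k * y)) := by
  obtain ⟨N, hN⟩ := exists_nat_ge p
  have hinj : Function.Injective fun k : ℕ => j + q * k + 1 := fun k l h => by
    have : q * k = q * l := by
      simp only at h
      omega
    exact Nat.eq_of_mul_eq_mul_left hq this
  have h := ((Real.summable_pow_mul_exp_neg_nat_mul N hy).comp_injective hinj).mul_right
    (Real.exp ((j + 1) * y))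
  refine Summable.of_nonneg_of_le (fun k => by positivity) (fun k => ?_) h
  simp only [Function.comp]
  rw [mul_assoc (_ ^ N), ← Real.exp_add]
  have h1 : (1 : ℝ) ≤ ((j + q * k + 1 : ℕ) : ℝ) := by exact_mod_cast Nat.le_add_left 1 _
  have h2 : ((j + q * k + 1 : ℕ) : ℝ) ^ p ≤ ((j + q * k + 1 : ℕ) : ℝ) ^ N := by
    rw [← Real.rpow_natCast]
    exact Real.rpow_le_rpow_of_exponent_le h1 hN
  refine mul_le_mul h2 (le_of_eq ?_) (Real.exp_nonneg _) (by positivity)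
  congr 1
  push_cast
  ring

lemma classSum_pos {q : ℕ} (hq : 0 < q) (p : ℝ) {y : ℝ} (hy : 0 < y) (j : ℕ) :
    0 < classSum q p y j :=
  (summable_classSum hq p hy j).tsum_pos (fun k => by positivity) 0 (by positivity)

lemma classSum_mono {q : ℕ} (hq : 0 < q) {p : ℝ} (hp : 0 ≤ p) {y : ℝ} (hy : 0 < y) {i j : ℕ}
    (hij : i ≤ j) : classSum q p y i ≤ classSum q p y j := by
  refine (summable_classSum hq p hy i).tsum_le_tsum (fun k => ?_) (summable_classSum hq p hy j)
  gcongr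

lemma classSum_le {q : ℕ} (hq : 0 < q) (p : ℝ) {y : ℝ} (hy : 0 < y) :
    classSum q p y q ≤ Real.exp (q * y) * classSum q p y 0 := by
  have hs := summable_classSum hq p hy 0
  rw [classSum, classSum, ← tsum_mul_left, (hs.mul_left _).tsum_eq_zero_add]
  have e : ∀ k : ℕ, Real.exp (q * y) * (((0 + q * (k + 1) + 1 : ℕ) : ℝ) ^ p *
      Real.exp (-(q * (k + 1 : ℕ) * y))) = ((q + q * k + 1 : ℕ) : ℝ) ^ p *
      Real.exp (-(q * k * y)) := fun k => by
    rw [mul_left_comm, ← Real.exp_add]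
    congr 2
    · congr 1
      ring
    · push_cast
      ring
  simp only [e]
  exact le_add_of_nonneg_left (by positivity)

lemma tendsto_classSum_div {q : ℕ} (hq : 0 < q) {p : ℝ} (hp : 0 ≤ p) {j : ℕ} (hj : j < q) :
    Tendsto (fun y : ℝ => Real.exp (-((j + 1) * y)) * (classSum q p y j / classSum q p y 0))
      (𝓝[>] 0) (𝓝 1) := by
  have h1 : Tendsto (fun y : ℝ => Real.exp (-((j + 1) * y))) (𝓝[>] 0) (𝓝 1) := by
    have : ContinuousAt (fun y : ℝ => Real.exp (-((j + 1) * y))) 0 := by fun_prop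
    simpa [ContinuousAt] using this.tendsto.mono_left nhdsWithin_le_nhds
  have h2 : Tendsto (fun y : ℝ => Real.exp (q * y)) (𝓝[>] 0) (𝓝 1) := by
    have : ContinuousAt (fun y : ℝ => Real.exp (q * y)) 0 := by fun_prop
    simpa [ContinuousAt] using this.tendsto.mono_left nhdsWithin_le_nhds
  have h3 : Tendsto (fun y : ℝ => classSum q p y j / classSum q p y 0) (𝓝[>] 0) (𝓝 1) := by
    refine tendsto_of_tendsto_of_tendsto_of_le_of_le' tendsto_const_nhds h2 ?_ ?_
    · filter_upwards [self_mem_nhdsWithin] with y (hy : 0 < y)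
      rw [le_div_iff₀ (classSum_pos hq p hy 0), one_mul]
      exact classSum_mono hq hp hy (Nat.zero_le j)
    · filter_upwards [self_mem_nhdsWithin] with y (hy : 0 < y)
      rw [div_le_iff₀ (classSum_pos hq p hy 0)]
      exact (classSum_mono hq hp hy hj.le).trans (classSum_le hq p hy)
  simpa using h1.mul h3

/-! ### Integrality of the conductor and periodicity of the coefficients -/

lemma expSeries_add_two_pi_I (a : ℕ → ℂ) (μ z : ℂ) :
    expSeries a μ (z + 2 * Real.pi * I) = expSeries a μ z := by
  unfold expSeries
  congr 1
  funext n
  congr 1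
  rw [exp_eq_exp_iff_exists_int]
  refine ⟨-n, ?_⟩
  push_cast
  ring

/-- The description of the boundary behaviour of `expSeries` on the upper imaginary axis. -/
def HasBoundaryValues (a : ℕ → ℂ) (μ : ℂ) (c : ℝ) (K : ℂ) : Prop :=
  ∀ x : ℝ, 0 < x →
    (∀ m : ℕ, 0 < m → c * x = m → Tendsto (fun y : ℝ =>
      (y : ℂ) ^ ((1 + 2 * μ.re : ℝ) : ℂ) * expSeries a μ (y + x * I)) (𝓝[>] 0)
      (𝓝 (K * conj (twist a μ m)))) ∧
    ((∀ m : ℕ, 0 < m → c * x ≠ m) → Tendsto (fun y : ℝ =>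
      (y : ℂ) ^ ((1 + 2 * μ.re : ℝ) : ℂ) * expSeries a μ (y + x * I)) (𝓝[>] 0) (𝓝 0))

namespace HasBoundaryValues

variable {a : ℕ → ℂ} {μ : ℂ} {c : ℝ} {K : ℂ}

lemma tendsto_add (h : HasBoundaryValues a μ c K) (hc : 0 < c) {m : ℕ} (hm : 0 < m) :
    Tendsto (fun y : ℝ => (y : ℂ) ^ ((1 + 2 * μ.re : ℝ) : ℂ) *
      expSeries a μ (y + ((m / c + 2 * Real.pi : ℝ) : ℂ) * I)) (𝓝[>] 0)
      (𝓝 (K * conj (twist a μ m))) := by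
  have hmR : (0 : ℝ) < m := by exact_mod_cast hm
  refine ((h (m / c) (by positivity)).1 m hm (by field_simp)).congr fun y => ?_
  rw [← expSeries_add_two_pi_I a μ (y + ((m / c : ℝ) : ℂ) * I)]
  congr 2
  push_cast
  ring

lemma exists_conductor (h : HasBoundaryValues a μ c K) (hc : 0 < c) (hK : K ≠ 0) (ha : a 1 = 1) :
    ∃ q : ℕ, 0 < q ∧ 2 * Real.pi * c = q ∧ ∀ n : ℕ, 0 < n → twist a μ (n + q) = twist a μ n := by
  have h1 : twist a μ 1 = 1 := by simp [twist, ha]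
  have hpos : ∀ n : ℕ, 0 < n → 0 < (n / c + 2 * Real.pi : ℝ) := fun n _ => by positivity
  obtain ⟨m, hm0, hm⟩ : ∃ m : ℕ, 0 < m ∧ c * ((1 : ℕ) / c + 2 * Real.pi) = m := by
    by_contra! hcon
    have l1 := h.tendsto_add hc one_pos
    have l2 := (h _ (hpos 1 one_pos)).2 hcon
    have := tendsto_nhds_unique l1 l2
    simp [h1, hK] at this
  have hm' : 1 + 2 * Real.pi * c = m := by
    rw [← hm]
    push_cast
    field_simp
  have hm1 : 1 < m := by
    have : (1 : ℝ) < m := by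
      rw [← hm']
      have := Real.pi_pos
      have : 0 < 2 * Real.pi * c := by positivity
      linarith
    exact_mod_cast this
  have hq : 2 * Real.pi * c = (m - 1 : ℕ) := by
    rw [Nat.cast_sub hm1.le]
    push_cast
    linarith
  refine ⟨m - 1, by omega, hq, fun n hn => ?_⟩
  have l1 := h.tendsto_add hc hn
  have l2 := (h _ (hpos n hn)).1 (n + (m - 1)) (by omega) (by
    rw [Nat.cast_add, ← hq]
    field_simp)
  have := mul_left_cancel₀ hK (tendsto_nhds_unique l1 l2)
  have := congrArg conj this
  rwa [conj_conj, conj_conj, eq_comm] at this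

end HasBoundaryValues

/-! ### The discrete Fourier transform of the coefficients -/

lemma natCast_cpow_eq_mul {n : ℕ} (hn : n ≠ 0) (μ : ℂ) :
    (n : ℂ) ^ (2 * μ) = (n : ℂ) ^ (2 * μ.im * I) * (((n : ℝ) ^ (2 * μ.re) : ℝ) : ℂ) := by
  have hn0 : (n : ℂ) ≠ 0 := by exact_mod_cast hn
  rw [ofReal_cpow n.cast_nonneg, ofReal_natCast, ← cpow_add _ _ hn0]
  congr 1
  push_cast
  linear_combination (-2 : ℂ) * re_add_im μ

section Fourier

variable {a : ℕ → ℂ} {μ : ℂ} {q : ℕ} [NeZero q]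

/-- If the twisted coefficients agree with a function modulo `q`, then the exponential series at
`y + 2 π i m / q` is a combination of sums over residue classes. -/
lemma expSeries_eq_sum (ha0 : a 0 = 0) (ha : LSeriesSummable a 2) {Φ : ZMod q → ℂ}
    (hΦ : ∀ n : ℕ, 0 < n → Φ n = twist a μ n) (m : ℕ) {y : ℝ} (hy : 0 < y) :
    expSeries a μ (y + ((2 * Real.pi * m / q : ℝ) : ℂ) * I) =
      ∑ j : ZMod q, Φ (j + 1) * ZMod.stdAddChar (-((j + 1) * (m : ZMod q))) *
        ((Real.exp (-((j.val + 1) * y)) * classSum q (2 * μ.re) y j.val : ℝ) : ℂ) := by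
  have hs := summable_expSeries (μ := μ) ha0 ha
    (z := y + ((2 * Real.pi * m / q : ℝ) : ℂ) * I) (by simpa using hy)
  have hs1 := (summable_nat_add_iff 1).2 hs
  have hq0 : (q : ℂ) ≠ 0 := by exact_mod_cast NeZero.ne q
  rw [expSeries, hs.tsum_eq_zero_add, ha0, zero_mul, zero_mul, zero_add,
    Nat.sumByResidueClasses hs1 q]
  refine Finset.sum_congr rfl fun j _ => ?_
  rw [classSum, ofReal_mul, ofReal_tsum, ← tsum_mul_left, ← tsum_mul_left]
  congr 1
  funext k
  have hn : j.val + q * k + 1 ≠ 0 := Nat.succ_ne_zero _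
  set n := j.val + q * k + 1 with hndef
  have hcast : ((n : ℕ) : ZMod q) = j + 1 := by
    rw [hndef]
    push_cast
    simp
  have h1 : a n * (n : ℂ) ^ (2 * μ) = Φ (j + 1) * (((n : ℝ) ^ (2 * μ.re) : ℝ) : ℂ) := by
    rw [← hcast, hΦ n (Nat.pos_of_ne_zero hn), twist, natCast_cpow_eq_mul hn]
    ring
  have h2 : exp (-(n * (y + ((2 * Real.pi * m / q : ℝ) : ℂ) * I))) =
      ZMod.stdAddChar (-((j + 1) * (m : ZMod q))) * (Real.exp (-((j.val + 1) * y)) *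
        Real.exp (-(q * k * y)) : ℝ) := by
    have e : (-((j + 1) * (m : ZMod q))) = ((-(n * m : ℕ) : ℤ) : ZMod q) := by
      push_cast
      rw [hcast]
    rw [e, ZMod.stdAddChar_coe, ← Real.exp_add, ofReal_exp, ← exp_add]
    congr 1
    rw [hndef]
    push_cast
    field_simp
    ring
  rw [h1, h2]
  push_cast
  ring

/-- The discrete Fourier transform of the twisted coefficients is proportional to their
conjugate. -/
lemma exists_dft_eq (ha0 : a 0 = 0) (ha1 : a 1 = 1) (ha : LSeriesSummable a 2) (hμ : 0 ≤ μ.re)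
    {K : ℂ} (hK : K ≠ 0) {c : ℝ} (h : HasBoundaryValues a μ c K) (hc : 2 * Real.pi * c = q)
    {Φ : ZMod q → ℂ} (hΦ : ∀ n : ℕ, 0 < n → Φ n = twist a μ n) :
    ∃ κ : ℂ, ∀ k : ZMod q, ZMod.dft Φ k = κ * conj (Φ k) := by
  have hq : 0 < q := Nat.pos_of_ne_zero (NeZero.ne q)
  have hqR : (0 : ℝ) < q := by exact_mod_cast hq
  set D : ℝ → ℂ := fun y => (y : ℂ) ^ ((1 + 2 * μ.re : ℝ) : ℂ) *
    (classSum q (2 * μ.re) y 0 : ℝ) with hD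
  set S : ℕ → ℝ → ℂ := fun m y => ∑ j : ZMod q, Φ (j + 1) * ZMod.stdAddChar (-((j + 1) * (m : ZMod q))) *
    ((Real.exp (-((j.val + 1) * y)) *
      (classSum q (2 * μ.re) y j.val / classSum q (2 * μ.re) y 0) : ℝ) : ℂ) with hS
  have hSlim : ∀ m : ℕ, Tendsto (S m) (𝓝[>] 0) (𝓝 (ZMod.dft Φ m)) := fun m => by
    have e : ZMod.dft Φ m = ∑ j : ZMod q, Φ (j + 1) * ZMod.stdAddChar (-((j + 1) * (m : ZMod q))) *
        ((1 : ℝ) : ℂ) := by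
      rw [ZMod.dft_apply, ← Equiv.sum_comp (Equiv.addRight (1 : ZMod q))]
      refine Finset.sum_congr rfl fun j _ => ?_
      simp [mul_comm]
    rw [e]
    refine tendsto_finsetSum _ fun j _ => Tendsto.const_mul _ ?_
    exact (continuous_ofReal.tendsto 1).comp
      (tendsto_classSum_div hq (by positivity) (ZMod.val_lt j))
  have hDS : ∀ m : ℕ, 0 < m → Tendsto (fun y => D y * S m y) (𝓝[>] 0) (𝓝 (K * conj (Φ m))) :=
    fun m hm => by
      have hmR : (0 : ℝ) < m := by exact_mod_cast hm
      have := (h (2 * Real.pi * m / q) (by have := Real.pi_pos; positivity)).1 m hm (by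
        field_simp
        linear_combination hc)
      rw [← hΦ m hm] at this
      refine this.congr' ?_
      filter_upwards [self_mem_nhdsWithin] with y (hy : 0 < y)
      have hne : ((classSum q (2 * μ.re) y 0 : ℝ) : ℂ) ≠ 0 := by
        exact_mod_cast (classSum_pos hq _ hy 0).ne'
      rw [expSeries_eq_sum ha0 ha hΦ m hy, hD, hS]
      simp only [mul_assoc]
      congr 1
      rw [Finset.mul_sum]
      refine Finset.sum_congr rfl fun j _ => ?_
      push_cast
      field_simp
  have hrep : ∀ k : ZMod q, ∃ m : ℕ, 0 < m ∧ (m : ZMod q) = k := fun k =>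
    ⟨k.val + q, by omega, by simp⟩
  have h11 : Φ 1 = 1 := by
    have := hΦ 1 one_pos
    simpa [twist, ha1] using this
  obtain ⟨k₀, hk₀⟩ : ∃ k, ZMod.dft Φ k ≠ 0 := by
    by_contra! hcon
    have : Φ = 0 := by
      rw [← LinearEquiv.map_eq_zero_iff (ZMod.dft (N := q) (E := ℂ))]
      funext k
      exact hcon k
    simp [this] at h11
  obtain ⟨m₀, hm₀, rfl⟩ := hrep k₀
  set w := K * conj (Φ m₀) / ZMod.dft Φ m₀ with hw
  have hDlim : Tendsto D (𝓝[>] 0) (𝓝 w) := by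
    refine ((hDS m₀ hm₀).div (hSlim m₀) hk₀).congr' ?_
    filter_upwards [(hSlim m₀).eventually_ne hk₀] with y hy
    rw [Pi.div_apply, mul_div_cancel_right₀ _ hy]
  have hall : ∀ k : ZMod q, w * ZMod.dft Φ k = K * conj (Φ k) := fun k => by
    obtain ⟨m, hm, rfl⟩ := hrep k
    exact tendsto_nhds_unique (hDlim.mul (hSlim m)) (hDS m hm)
  have hw0 : w ≠ 0 := fun h0 => by
    have := hall 1
    rw [h0, h11, zero_mul, map_one, mul_one] at this
    exact hK this.symm
  refine ⟨K / w, fun k => ?_⟩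
  rw [div_mul_eq_mul_div, ← hall k, mul_div_cancel_left₀ _ hw0]

end Fourier

/-! ### Coefficients of a Dirichlet series with an Euler product -/

/-- `w` is the sequence of coefficients of minus the logarithmic derivative of the Dirichlet
series with coefficients `c`. -/
def IsLogDerivCoeff (c w : ℕ → ℂ) : Prop :=
  ∀ n : ℕ, n ≠ 0 → log n * c n = ∑ d ∈ n.divisors, c (n / d) * w d

lemma abscissaOfAbsConv_le_one {f : ℕ → ℂ} (hf : ∀ s : ℂ, 1 < s.re → LSeriesSummable f s) :
    LSeries.abscissaOfAbsConv f ≤ (1 : ℝ) :=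
  LSeries.abscissaOfAbsConv_le_of_forall_lt_LSeriesSummable fun y hy => hf y (by simpa using hy)

lemma deriv_LSeries_of_eq_exp {c b : ℕ → ℂ} (hb : ∀ s : ℂ, 1 < s.re → LSeriesSummable b s)
    (hexp : ∀ s : ℂ, 1 < s.re → exp (LSeries b s) = LSeries c s) {s : ℂ} (hs : 1 < s.re) :
    deriv (LSeries c) s = -LSeries c s * LSeries (LSeries.logMul b) s := by
  have hs' : LSeries.abscissaOfAbsConv b < s.re :=
    (abscissaOfAbsConv_le_one hb).trans_lt (by exact_mod_cast hs)
  have hev : LSeries c =ᶠ[𝓝 s] fun z => exp (LSeries b z) := by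
    filter_upwards [(isOpen_lt continuous_const continuous_re).mem_nhds hs] with z hz
    exact (hexp z hz).symm
  rw [hev.deriv_eq, (LSeries_hasDerivAt hs').cexp.deriv, hexp s hs]
  ring

lemma isLogDerivCoeff_of_eq_exp {c b : ℕ → ℂ} (hc : ∀ s : ℂ, 1 < s.re → LSeriesSummable c s)
    (hb : ∀ s : ℂ, 1 < s.re → LSeriesSummable b s)
    (hexp : ∀ s : ℂ, 1 < s.re → exp (LSeries b s) = LSeries c s) :
    IsLogDerivCoeff c (LSeries.logMul b) := by
  have hca := abscissaOfAbsConv_le_one hc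
  have hba := abscissaOfAbsConv_le_one hb
  have hlt : ∀ s : ℂ, 1 < s.re → ((1 : ℝ) : EReal) < s.re := fun s hs => by exact_mod_cast hs
  have hbs : ∀ s : ℂ, 1 < s.re → LSeriesSummable (LSeries.logMul b) s := fun s hs =>
    LSeriesSummable_logMul_of_lt_re (hba.trans_lt (hlt s hs))
  intro n hn
  have key := LSeries.eq_of_LSeries_eventually_eq (f := LSeries.logMul c)
    (g := LSeries.convolution c (LSeries.logMul b))
    (by rw [LSeries.abscissaOfAbsConv_logMul]; exact hca.trans_lt (EReal.coe_lt_top 1))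
    ((abscissaOfAbsConv_le_one fun s hs => (hc s hs).convolution (hbs s hs)).trans_lt
      (EReal.coe_lt_top 1)) (by
      filter_upwards [eventually_gt_atTop 1] with x hx
      have hx' : 1 < ((x : ℝ) : ℂ).re := by simpa using hx
      have h1 := LSeries_deriv (hca.trans_lt (hlt _ hx'))
      rw [deriv_LSeries_of_eq_exp hb hexp hx'] at h1
      rw [LSeries_convolution' (hc _ hx') (hbs _ hx')]
      linear_combination h1) hn
  rw [LSeries.convolution_def] at key
  rw [← Nat.sum_divisorsAntidiagonal' fun d e => c d * LSeries.logMul b e]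
  exact key

lemma DirichletCharacter.isLogDerivCoeff {N : ℕ} (χ : DirichletCharacter ℂ N) :
    IsLogDerivCoeff (fun n => χ n) fun n => χ n * ArithmeticFunction.vonMangoldt n := by
  intro n hn
  have h := congrFun (DirichletCharacter.convolution_twist_vonMangoldt χ) n
  simp only [LSeries.convolution_def, Pi.mul_apply] at h
  rw [Nat.sum_divisorsAntidiagonal (fun d e : ℕ =>
    χ d * (ArithmeticFunction.vonMangoldt d : ℂ) * χ e)] at h
  rw [mul_comm, ← h]
  exact Finset.sum_congr rfl fun d _ => mul_comm _ _

namespace IsLogDerivCoeff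

variable {c w : ℕ → ℂ}

lemma log_mul_eq (h : IsLogDerivCoeff c w) (hw : ∀ n, ¬ IsPrimePow n → w n = 0) {n : ℕ}
    (hn : n ≠ 0) : log n * c n = ∑ d ∈ n.divisors with IsPrimePow d, c (n / d) * w d := by
  rw [h n hn, Finset.sum_filter]
  refine Finset.sum_congr rfl fun d _ => ?_
  split_ifs with hd
  · rfl
  · rw [hw d hd, mul_zero]

lemma log_natCast_ne_zero {n : ℕ} (hn : 1 < n) : log (n : ℂ) ≠ 0 := by
  rw [← natCast_log]
  have h : (1 : ℝ) < n := by exact_mod_cast hn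
  exact_mod_cast (Real.log_pos h).ne'

lemma coprime_mul (h : IsLogDerivCoeff c w) (hw : ∀ n, ¬ IsPrimePow n → w n = 0) (hc : c 1 = 1)
    {m n : ℕ} (hm : m ≠ 0) (hn : n ≠ 0) (hmn : m.Coprime n) : c (m * n) = c m * c n := by
  induction hk : m * n using Nat.strong_induction_on generalizing m n with
  | _ k ih =>
  subst hk
  rcases eq_or_ne (m * n) 1 with h1 | h1
  · obtain ⟨rfl, rfl⟩ := mul_eq_one.1 h1
    simp [hc]
  have hlt : 1 < m * n := by
    have := Nat.mul_ne_zero hm hn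
    omega
  refine mul_left_cancel₀ (log_natCast_ne_zero hlt) ?_
  have hdisj : Disjoint (m.divisors.filter IsPrimePow) (n.divisors.filter IsPrimePow) := by
    rw [Finset.disjoint_left]
    intro d hd hd'
    simp only [Finset.mem_filter, Nat.mem_divisors] at hd hd'
    exact hd.2.ne_one (Nat.eq_one_of_dvd_coprimes hmn hd.1.1 hd'.1.1)
  have hlog : log ((m * n : ℕ) : ℂ) = log m + log n := by
    rw [← natCast_log, ← natCast_log, ← natCast_log, Nat.cast_mul,
      Real.log_mul (by exact_mod_cast hm) (by exact_mod_cast hn), ofReal_add]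
  rw [h.log_mul_eq hw (Nat.mul_ne_zero hm hn), Nat.mul_divisors_filter_prime_pow hmn,
    Finset.filter_union, Finset.sum_union hdisj, hlog]
  have e1 : ∑ d ∈ m.divisors with IsPrimePow d, c (m * n / d) * w d = log m * c m * c n := by
    rw [h.log_mul_eq hw hm, Finset.sum_mul]
    refine Finset.sum_congr rfl fun d hd => ?_
    simp only [Finset.mem_filter, Nat.mem_divisors] at hd
    obtain ⟨⟨⟨r, rfl⟩, _⟩, hpp⟩ := hd
    have hd0 : 0 < d := hpp.pos
    have hr : r ≠ 0 := right_ne_zero_of_mul hm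
    rw [mul_assoc, Nat.mul_div_cancel_left _ hd0, Nat.mul_div_cancel_left _ hd0,
      ih (r * n) ?_ hr hn (hmn.coprime_dvd_left (dvd_mul_left _ _)) rfl]
    · ring
    · rw [mul_assoc]
      exact lt_mul_of_one_lt_left (Nat.pos_of_ne_zero (Nat.mul_ne_zero hr hn)) hpp.one_lt
  have e2 : ∑ d ∈ n.divisors with IsPrimePow d, c (m * n / d) * w d = log n * c n * c m := by
    rw [h.log_mul_eq hw hn, Finset.sum_mul]
    refine Finset.sum_congr rfl fun d hd => ?_
    simp only [Finset.mem_filter, Nat.mem_divisors] at hd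
    obtain ⟨⟨⟨r, rfl⟩, _⟩, hpp⟩ := hd
    have hd0 : 0 < d := hpp.pos
    have hr : r ≠ 0 := right_ne_zero_of_mul hn
    rw [mul_left_comm, Nat.mul_div_cancel_left _ hd0, Nat.mul_div_cancel_left _ hd0,
      ih (m * r) ?_ hm hr (hmn.coprime_dvd_right (dvd_mul_left _ _)) rfl]
    · ring
    · rw [mul_left_comm]
      exact lt_mul_of_one_lt_left (Nat.pos_of_ne_zero (Nat.mul_ne_zero hm hr)) hpp.one_lt
  rw [e1, e2]
  ring

/-- The coefficients of the logarithmic derivative at integers prime to `q` are determined by the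
values of `c` at such integers. -/
lemma eq_of_coprime {c' w' : ℕ → ℂ} (h : IsLogDerivCoeff c w) (h' : IsLogDerivCoeff c' w')
    (hc : c 1 = 1) {q : ℕ} (hcc : ∀ n, n ≠ 0 → n.Coprime q → c n = c' n) {n : ℕ} (hn : n ≠ 0)
    (hnq : n.Coprime q) : w n = w' n := by
  induction n using Nat.strong_induction_on with
  | _ n ih =>
  have h1 := h n hn
  rw [hcc n hn hnq, h' n hn, ← Finset.sum_erase_add _ _ (Nat.mem_divisors_self n hn),
    ← Finset.sum_erase_add _ (fun d => c (n / d) * w d) (Nat.mem_divisors_self n hn)] at h1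
  have h2 : ∑ d ∈ n.divisors.erase n, c' (n / d) * w' d =
      ∑ d ∈ n.divisors.erase n, c (n / d) * w d := by
    refine Finset.sum_congr rfl fun d hd => ?_
    rw [Finset.mem_erase, Nat.mem_divisors] at hd
    obtain ⟨hdn, hd, _⟩ := hd
    rw [ih d (lt_of_le_of_ne (Nat.le_of_dvd (Nat.pos_of_ne_zero hn) hd) hdn)
      (ne_zero_of_dvd_ne_zero hn hd) (hnq.coprime_dvd_left hd),
      hcc (n / d) (Nat.div_ne_zero_iff_of_dvd hd |>.2 ⟨hn, ne_zero_of_dvd_ne_zero hn hd⟩)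
        (hnq.coprime_dvd_left (Nat.div_dvd_of_dvd hd))]
  rw [h2, Nat.div_self (Nat.pos_of_ne_zero hn), ← hcc 1 one_ne_zero (Nat.coprime_one_left q), hc]
    at h1
  linear_combination -h1

/-- The coefficients are determined by those of the logarithmic derivative. -/
lemma eq_of_eq {c' : ℕ → ℂ} (h : IsLogDerivCoeff c w) (h' : IsLogDerivCoeff c' w)
    (hw : w 1 = 0) (hc : c 1 = 1) (hc' : c' 1 = 1) {n : ℕ} (hn : n ≠ 0) : c n = c' n := by
  induction n using Nat.strong_induction_on with
  | _ n ih =>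
  rcases eq_or_ne n 1 with rfl | h1
  · rw [hc, hc']
  refine mul_left_cancel₀ (log_natCast_ne_zero (n := n) (by omega)) ?_
  rw [h n hn, h' n hn]
  refine Finset.sum_congr rfl fun d hd => ?_
  rw [Nat.mem_divisors] at hd
  rcases eq_or_ne d 1 with rfl | hd1
  · simp [hw]
  have hd0 : d ≠ 0 := ne_zero_of_dvd_ne_zero hn hd.1
  rw [ih (n / d) (Nat.div_lt_self (Nat.pos_of_ne_zero hn) (by omega))
    ((Nat.div_ne_zero_iff_of_dvd hd.1).2 ⟨hn, hd0⟩)]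

end IsLogDerivCoeff

/-! ### Periodic multiplicative functions -/

/-- A multiplicative function which is periodic modulo `q` is a Dirichlet character at the integers
prime to `q`. -/
lemma exists_dirichletCharacter {q : ℕ} [NeZero q] {Φ : ZMod q → ℂ} (h1 : Φ 1 = 1)
    (hmul : ∀ m n : ℕ, m ≠ 0 → n ≠ 0 → m.Coprime n → Φ ((m * n : ℕ) : ZMod q) = Φ m * Φ n) :
    ∃ χ : DirichletCharacter ℂ q, ∀ u : ZMod q, IsUnit u → ∀ x, Φ (u * x) = χ u * Φ x := by
  have key : ∀ u : ZMod q, IsUnit u → ∀ x, Φ (u * x) = Φ u * Φ x := fun u hu x => by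
    obtain ⟨p, hp, hpp, rfl⟩ := Nat.forall_exists_prime_gt_and_eq_mod hu (x.val + q)
    have hq := NeZero.ne q
    have := hmul p (x.val + q) hpp.ne_zero (by omega)
      ((Nat.Prime.coprime_iff_not_dvd hpp).2 fun hd => by
        have := Nat.le_of_dvd (by omega) hd
        omega)
    simpa using this
  let f : (ZMod q)ˣ →* ℂ :=
    { toFun := fun u => Φ u
      map_one' := by simpa using h1
      map_mul' := fun u v => by simpa using key u u.isUnit v }
  refine ⟨MulChar.ofUnitHom f.toHomUnits, fun u hu x => ?_⟩
  obtain ⟨u, rfl⟩ := hu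
  rw [key u u.isUnit x, MulChar.ofUnitHom_coe]
  rfl

/-! ### Dirichlet series supported on the powers of finitely many primes -/

lemma summable_rpow_factoredNumbers {δ : ℝ} (hδ : 0 < δ) (S : Finset ℕ) :
    Summable fun n : Nat.factoredNumbers S => ((n : ℕ) : ℝ) ^ (-δ) := by
  let f : ℕ →* ℝ :=
    { toFun := fun n => (n : ℝ) ^ (-δ)
      map_one' := by simp
      map_mul' := fun m n => by
        rw [Nat.cast_mul, Real.mul_rpow m.cast_nonneg n.cast_nonneg] }
  have h := (EulerProduct.summable_and_hasSum_factoredNumbers_prod_filter_prime_geometric (f := f)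
    (fun {p} hp => by
      change ‖(p : ℝ) ^ (-δ)‖ < 1
      rw [Real.norm_of_nonneg (by positivity)]
      exact Real.rpow_lt_one_of_one_lt_of_neg (by exact_mod_cast hp.one_lt) (neg_lt_zero.2 hδ))
    S).2.summable
  exact h

lemma mem_factoredNumbers_of_isPrimePow {q n : ℕ} (hq : q ≠ 0) (hn : IsPrimePow n)
    (hnq : ¬ n.Coprime q) : n ∈ Nat.factoredNumbers q.primeFactors := by
  obtain ⟨p, k, hp, hk, rfl⟩ := hn
  have hp' : p.Prime := Nat.prime_iff.2 hp
  have hpq : p ∣ q := by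
    by_contra h
    exact hnq (Nat.Coprime.pow_left k ((Nat.Prime.coprime_iff_not_dvd hp').2 h))
  rw [Nat.mem_factoredNumbers]
  refine ⟨pow_ne_zero _ hp'.ne_zero, fun r hr => ?_⟩
  rw [hp'.primeFactorsList_pow] at hr
  rw [List.eq_of_mem_replicate hr]
  exact Nat.mem_primeFactors.2 ⟨hp', hpq, hq⟩

lemma LSeriesSummable_of_isBigO_of_support {e : ℕ → ℂ} {q : ℕ} (hq : q ≠ 0) {θ : ℝ}
    (he : e =O[atTop] fun n : ℕ => (n : ℝ) ^ θ)
    (hsupp : ∀ n : ℕ, e n ≠ 0 → IsPrimePow n ∧ ¬ n.Coprime q) {s : ℂ} (hs : θ < s.re) :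
    LSeriesSummable e s := by
  set S := q.primeFactors with hS
  have hsum : Summable ((Nat.factoredNumbers S).indicator fun n : ℕ => (n : ℝ) ^ (-(s.re - θ))) :=
    summable_subtype_iff_indicator.1 (summable_rpow_factoredNumbers (sub_pos.2 hs) S)
  refine summable_of_isBigO_nat hsum ?_
  obtain ⟨C, hC⟩ := he.bound
  refine IsBigO.of_bound C ?_
  filter_upwards [hC, eventually_gt_atTop 0] with n hn hn0
  have hnR : (0 : ℝ) < n := by exact_mod_cast hn0
  rw [LSeries.term_of_ne_zero hn0.ne']
  by_cases h0 : e n = 0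
  · rw [h0, zero_div, norm_zero]
    have : 0 ≤ C := by
      rw [h0, norm_zero] at hn
      exact nonneg_of_mul_nonneg_left hn (norm_pos_iff.2 (by positivity))
    positivity
  · obtain ⟨h1, h2⟩ := hsupp n h0
    rw [Set.indicator_of_mem (mem_factoredNumbers_of_isPrimePow hq h1 h2), norm_div,
      norm_natCast_cpow_of_pos hn0, Real.norm_of_nonneg (by positivity), neg_sub,
      Real.rpow_sub hnR, ← mul_div_assoc]
    rw [Real.norm_of_nonneg (by positivity)] at hn
    gcongr

/-! ### The functional equation of a periodic Dirichlet series -/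

lemma differentiableAt_conj_comp_conj {f : ℂ → ℂ} {s : ℂ} (hf : DifferentiableAt ℂ f (conj s)) :
    DifferentiableAt ℂ (fun z => conj (f (conj z))) s := by
  have := hf.hasDerivAt.star_conj
  simpa [Function.comp_def] using this.differentiableAt

lemma isPreconnected_compl_one : IsPreconnected ({1}ᶜ : Set ℂ) :=
  (isConnected_compl_singleton_of_one_lt_rank (by rw [rank_real_complex]; norm_num)
    1).isPreconnected

/-- Two functions which are differentiable away from `1` and agree for `Re s > 1` are equal. -/
lemma eq_of_eq_of_one_lt_re {f g : ℂ → ℂ} (hf : ∀ s ≠ 1, DifferentiableAt ℂ f s)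
    (hg : ∀ s ≠ 1, DifferentiableAt ℂ g s) (hfg : ∀ s : ℂ, 1 < s.re → f s = g s) {s : ℂ}
    (hs : s ≠ 1) : f s = g s := by
  have hopen : IsOpen ({1}ᶜ : Set ℂ) := isOpen_compl_singleton
  have ha : ∀ h : ℂ → ℂ, (∀ s ≠ 1, DifferentiableAt ℂ h s) → AnalyticOnNhd ℂ h {1}ᶜ :=
    fun h hh => DifferentiableOn.analyticOnNhd (fun z hz => (hh z hz).differentiableWithinAt) hopen
  refine (ha f hf).eqOn_of_preconnected_of_eventuallyEq (ha g hg) isPreconnected_compl_one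
    (z₀ := 2) (by simp) ?_ hs
  filter_upwards [(isOpen_lt continuous_const continuous_re).mem_nhds
    (show (1 : ℝ) < (2 : ℂ).re by norm_num)] with z hz
  exact hfg z hz

lemma conj_LSeries (f : ℕ → ℂ) (s : ℂ) :
    conj (LSeries f (conj s)) = LSeries (fun n => conj (f n)) s := by
  rw [LSeries, LSeries, conj_tsum]
  refine tsum_congr fun n => ?_
  rcases eq_or_ne n 0 with rfl | hn
  · simp
  · rw [LSeries.term_of_ne_zero hn, LSeries.term_of_ne_zero hn, map_div₀]
    congr 1
    rw [← ofReal_natCast, conj_ofReal_cpow (by exact_mod_cast Nat.pos_of_ne_zero hn), conj_conj]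

lemma conj_LFunction {N : ℕ} [NeZero N] (Φ : ZMod N → ℂ) {s : ℂ} (hs : s ≠ 1) :
    conj (ZMod.LFunction Φ (conj s)) = ZMod.LFunction (fun x => conj (Φ x)) s := by
  have hne : ∀ z : ℂ, z ≠ 1 → conj z ≠ 1 := fun z hz h => hz (by
    simpa using congrArg conj h)
  refine eq_of_eq_of_one_lt_re (f := fun z => conj (ZMod.LFunction Φ (conj z)))
    (fun z hz => differentiableAt_conj_comp_conj
      (ZMod.differentiableAt_LFunction Φ _ (Or.inl (hne z hz))))
    (fun z hz => ZMod.differentiableAt_LFunction _ _ (Or.inl hz)) (fun z hz => ?_) hs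
  rw [ZMod.LFunction_eq_LSeries _ (by simpa using hz), ZMod.LFunction_eq_LSeries _ hz,
    conj_LSeries]

lemma LFunction_const_mul {N : ℕ} [NeZero N] (r : ℂ) (Φ : ZMod N → ℂ) (s : ℂ) :
    ZMod.LFunction (fun x => r * Φ x) s = r * ZMod.LFunction Φ s := by
  simp only [ZMod.LFunction, Finset.mul_sum]
  exact Finset.sum_congr rfl fun j _ => by ring

/-- The gamma factor in the functional equation of a Dirichlet `L`-function of parity `σ`. -/
noncomputable def parityGamma (σ s : ℂ) : ℂ :=
  (2 * Real.pi : ℂ) ^ (-s) * Gamma s * (exp (Real.pi * I * s / 2) + σ * exp (-Real.pi * I * s / 2))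

/-- The functional equation for a function of given parity whose discrete Fourier transform is
proportional to its conjugate. -/
lemma LFunction_eq_parityGamma_mul {N : ℕ} [NeZero N] {Φ : ZMod N → ℂ} {κ σ : ℂ}
    (hdft : ∀ k, ZMod.dft Φ k = κ * conj (Φ k)) (hσ : ∀ x, Φ (-x) = σ * Φ x) {s : ℂ}
    (hs : s.im ≠ 0) : ZMod.LFunction Φ s =
      N ^ (-s) * parityGamma σ (1 - s) * κ * conj (ZMod.LFunction Φ (1 - conj s)) := by
  have him : (1 - s).im ≠ 0 := by simpa using hs
  have hne1 : 1 - s ≠ 1 := fun h => him (by simp [h])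
  have h := ZMod.LFunction_one_sub Φ (s := 1 - s) (fun n h => him (by simp [h])) (Or.inr hne1)
  have e1 : ZMod.LFunction (ZMod.dft Φ) (1 - s) =
      κ * conj (ZMod.LFunction Φ (1 - conj s)) := by
    rw [show ZMod.dft Φ = fun k => κ * conj (Φ k) from funext hdft, LFunction_const_mul,
      ← conj_LFunction Φ hne1, map_sub, map_one]
  have e2 : ZMod.LFunction (ZMod.dft fun x => Φ (-x)) (1 - s) =
      σ * (κ * conj (ZMod.LFunction Φ (1 - conj s))) := by
    rw [← e1, ← LFunction_const_mul]
    congr 1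
    rw [show (fun x => Φ (-x)) = σ • Φ from funext hσ, map_smul]
    rfl
  rw [e1, e2, sub_sub_cancel, show 1 - s - 1 = -s by ring] at h
  rw [h, parityGamma]
  ring

/-! ### Comparison of two functional equations -/

lemma hasDerivAt_reflection {f : ℂ → ℂ} {s : ℂ} (hf : DifferentiableAt ℂ f (1 - conj s)) :
    HasDerivAt (fun z => conj (f (1 - conj z))) (-conj (deriv f (1 - conj s))) s := by
  have h1 : HasDerivAt (fun z => f (1 - z)) (deriv f (1 - conj s) * (-1)) (conj s) :=
    hf.hasDerivAt.comp (conj s) ((hasDerivAt_id (conj s)).const_sub 1)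
  have := h1.star_conj
  simpa [Function.comp_def] using this

lemma eventually_ne_zero_of_differentiableOn_im_pos {f : ℂ → ℂ}
    (hf : DifferentiableOn ℂ f {s | 0 < s.im}) {s₁ : ℂ} (hs₁ : 0 < s₁.im) (hne : f s₁ ≠ 0)
    {s : ℂ} (hs : 0 < s.im) : ∀ᶠ z in 𝓝[≠] s, f z ≠ 0 := by
  have hopen : IsOpen {s : ℂ | 0 < s.im} := isOpen_lt continuous_const continuous_im
  have ha := hf.analyticOnNhd hopen
  rcases (ha s hs).eventually_eq_zero_or_eventually_ne_zero with h | h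
  · exact absurd (ha.eqOn_zero_of_preconnected_of_eventuallyEq_zero
      (convex_halfSpace_im_gt 0).isPreconnected hs h hs₁) hne
  · exact h

/-- If the functions `f` and `g` satisfy functional equations with the same gamma factor, and the
difference of their logarithmic derivatives is holomorphic for `Re s > θ`, then that difference
satisfies a functional equation. -/
lemma add_reflection_eq_neg_log {f g E : ℂ → ℂ} {θ r : ℝ} {K : ℂ} (hr : 0 < r)
    (hf : ∀ s ≠ 1, DifferentiableAt ℂ f s) (hg : ∀ s ≠ 1, DifferentiableAt ℂ g s)
    (hE : DifferentiableOn ℂ E {s | θ < s.re}) (hf0 : ∀ s : ℂ, 1 < s.re → f s ≠ 0)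
    (hg0 : ∀ s : ℂ, 1 < s.re → g s ≠ 0)
    (hfg : ∀ s : ℂ, 1 < s.re → deriv f s * g s - deriv g s * f s = -(E s * (f s * g s)))
    (hfe : ∀ s : ℂ, s.im ≠ 0 → f s * conj (g (1 - conj s)) =
      K * (r : ℂ) ^ s * (conj (f (1 - conj s)) * g s))
    {s : ℂ} (h1 : θ < s.re) (h2 : s.re < 1 - θ) (him : 0 < s.im) :
    E s + conj (E (1 - conj s)) = -Real.log r := by
  have hne1 : ∀ z : ℂ, 0 < z.im → z ≠ 1 := fun z hz h => by simp [h] at hz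
  have hne1' : ∀ z : ℂ, 0 < z.im → 1 - conj z ≠ 1 := fun z hz h => by
    have := congrArg im h
    simp at this
    exact hz.ne' this
  have hopenH : IsOpen {s : ℂ | 0 < s.im} := isOpen_lt continuous_const continuous_im
  -- the identity for logarithmic derivatives extends to `Re s > θ`
  have hU : ∀ z : ℂ, θ < z.re → 0 < z.im →
      deriv f z * g z - deriv g z * f z = -(E z * (f z * g z)) := by
    intro z hz hzi
    have hopen : IsOpen {s : ℂ | θ < s.re ∧ 0 < s.im} :=
      (isOpen_lt continuous_const continuous_re).inter hopenH
    have hfa : AnalyticOnNhd ℂ f {s : ℂ | θ < s.re ∧ 0 < s.im} :=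
      DifferentiableOn.analyticOnNhd
        (fun z hz => (hf z (hne1 z hz.2)).differentiableWithinAt) hopen
    have hga : AnalyticOnNhd ℂ g {s : ℂ | θ < s.re ∧ 0 < s.im} :=
      DifferentiableOn.analyticOnNhd
        (fun z hz => (hg z (hne1 z hz.2)).differentiableWithinAt) hopen
    have hEa : AnalyticOnNhd ℂ E {s : ℂ | θ < s.re ∧ 0 < s.im} :=
      (hE.mono fun z hz => hz.1).analyticOnNhd hopen
    have hpre : IsPreconnected {s : ℂ | θ < s.re ∧ 0 < s.im} :=
      ((convex_halfSpace_re_gt θ).inter (convex_halfSpace_im_gt 0)).isPreconnected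
    set z₁ : ℂ := (max 1 θ + 1 : ℝ) + I with hz₁
    have hre : z₁.re = max 1 θ + 1 := by simp [hz₁]
    have him : z₁.im = 1 := by simp [hz₁]
    refine ((hfa.deriv.mul hga).sub (hga.deriv.mul hfa)).eqOn_of_preconnected_of_eventuallyEq
      (hEa.mul (hfa.mul hga)).neg hpre (z₀ := z₁) ⟨?_, ?_⟩ ?_ ⟨hz, hzi⟩
    · rw [hre]
      have := le_max_right 1 θ
      linarith
    · rw [him]
      exact one_pos
    · filter_upwards [(isOpen_lt continuous_const continuous_re).mem_nhds
        (show (1 : ℝ) < z₁.re by rw [hre]; have := le_max_left 1 θ; linarith)] with w hw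
      exact hfg w hw
  -- the functions do not vanish identically
  have hrefl : ∀ h : ℂ → ℂ, (∀ s ≠ 1, DifferentiableAt ℂ h s) →
      DifferentiableOn ℂ (fun z => conj (h (1 - conj z))) {s | 0 < s.im} := fun h hh z hz =>
    (hasDerivAt_reflection (hh _ (hne1' z hz))).differentiableAt.differentiableWithinAt
  have hev : ∀ h : ℂ → ℂ, (∀ s ≠ 1, DifferentiableAt ℂ h s) → (∀ s : ℂ, 1 < s.re → h s ≠ 0) →
      ∀ᶠ z in 𝓝[≠] s, h z ≠ 0 ∧ conj (h (1 - conj z)) ≠ 0 := fun h hh h0 => by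
    refine (eventually_ne_zero_of_differentiableOn_im_pos (s₁ := 2 + I)
      (fun z hz => (hh z (hne1 z hz)).differentiableWithinAt) (by simp) (h0 _ (by simp)) him).and
      (eventually_ne_zero_of_differentiableOn_im_pos (s₁ := -1 + I) (hrefl h hh) (by simp) ?_ him)
    rw [Ne, map_eq_zero]
    exact h0 _ (by norm_num)
  have hstrip : IsOpen {z : ℂ | θ < z.re ∧ z.re < 1 - θ ∧ 0 < z.im} :=
    (isOpen_lt continuous_const continuous_re).inter
      ((isOpen_lt continuous_re continuous_const).inter hopenH)
  have hmain : ∀ᶠ z in 𝓝[≠] s, E z + conj (E (1 - conj z)) = -Real.log r := by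
    filter_upwards [hev f hf hf0, hev g hg hg0,
      nhdsWithin_le_nhds (hstrip.mem_nhds ⟨h1, h2, him⟩)] with z hzf hzg hz
    obtain ⟨hz1, hz2, hz3⟩ := hz
    have hfr := hasDerivAt_reflection (hf _ (hne1' z hz3))
    have hgr := hasDerivAt_reflection (hg _ (hne1' z hz3))
    have hd1 := (hf z (hne1 z hz3)).hasDerivAt.mul hgr
    have hd2 := (((hasDerivAt_id z).const_cpow (c := (r : ℂ))
      (Or.inl (by exact_mod_cast hr.ne'))).const_mul K).mul
        (hfr.mul (hg z (hne1 z hz3)).hasDerivAt)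
    have hd : _ = _ := (hd1.congr_of_eventuallyEq (by
      filter_upwards [hopenH.mem_nhds hz3] with w hw
      exact (hfe w hw.ne').symm)).unique hd2
    have i1 := hU z hz1 hz3
    have i2 := congrArg conj (hU (1 - conj z) (by simp; linarith) (by simpa using hz3))
    have i3 := hfe z hz3.ne'
    simp only [map_sub, map_mul, map_neg, id, Pi.mul_apply] at i2 hd hzf hzg i3
    rw [← ofReal_log hr.le] at hd
    obtain ⟨f1, f2⟩ := hzf
    obtain ⟨g1, g2⟩ := hzg
    generalize conj (f (1 - conj z)) = fr at *
    generalize conj (g (1 - conj z)) = gr at *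
    generalize conj (deriv f (1 - conj z)) = fr' at *
    generalize conj (deriv g (1 - conj z)) = gr' at *
    refine mul_left_cancel₀ (mul_ne_zero (mul_ne_zero f1 g1) (mul_ne_zero f2 g2)) ?_
    linear_combination (fr * gr) * i1 + (f z * g z) * i2 - fr * g z * hd +
      (fr * deriv g z - fr' * g z + Real.log r * fr * g z) * i3
  have hcont : ContinuousAt (fun z => E z + conj (E (1 - conj z))) s := by
    have hopen : IsOpen {z : ℂ | θ < z.re} := isOpen_lt continuous_const continuous_re
    refine (hE.differentiableAt (hopen.mem_nhds h1)).continuousAt.add ?_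
    exact (hasDerivAt_reflection (hE.differentiableAt (hopen.mem_nhds
      (show θ < (1 - conj s).re by simp; linarith)))).continuousAt
  exact tendsto_nhds_unique_of_eventuallyEq (hcont.tendsto.mono_left nhdsWithin_le_nhds)
    tendsto_const_nhds hmain

/-- A Dirichlet series which converges absolutely for `Re s > θ`, where `θ < 1 / 2`, and satisfies
a functional equation relating `s` and `1 - s` is constant. -/
lemma eq_zero_of_add_reflection_eq {e : ℕ → ℂ} {θ : ℝ} (hθ : θ < 1 / 2) {C : ℂ}
    (he : ∀ s : ℂ, θ < s.re → LSeriesSummable e s) (he1 : e 1 = 0)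
    (hC : ∀ s : ℂ, θ < s.re → s.re < 1 - θ → 0 < s.im →
      LSeries e s + conj (LSeries e (1 - conj s)) = C) :
    (∀ n, n ≠ 0 → e n = 0) ∧ C = 0 := by
  have habs : LSeries.abscissaOfAbsConv e ≤ θ :=
    LSeries.abscissaOfAbsConv_le_of_forall_lt_LSeriesSummable fun y hy => he y (by simpa using hy)
  have hopen : IsOpen {z : ℂ | θ < z.re} := isOpen_lt continuous_const continuous_re
  have hopen' : IsOpen {z : ℂ | z.re < 1 - θ} := isOpen_lt continuous_re continuous_const
  have hdiff : DifferentiableOn ℂ (LSeries e) {s | θ < s.re} :=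
    (LSeries_differentiableOn e).mono fun s (hs : θ < s.re) =>
      habs.trans_lt (by exact_mod_cast hs)
  have hrefl : DifferentiableOn ℂ (fun s => conj (LSeries e (1 - conj s))) {s | s.re < 1 - θ} :=
    fun s (hs : s.re < 1 - θ) => (hasDerivAt_reflection (hdiff.differentiableAt (hopen.mem_nhds
      (show θ < (1 - conj s).re by simp; linarith)))).differentiableAt.differentiableWithinAt
  -- the functional equation holds in the whole strip
  have hstrip : Set.EqOn (fun s => LSeries e s + conj (LSeries e (1 - conj s))) (fun _ => C)
      {s | θ < s.re ∧ s.re < 1 - θ} := by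
    have hpre : IsPreconnected {s : ℂ | θ < s.re ∧ s.re < 1 - θ} :=
      ((convex_halfSpace_re_gt θ).inter (convex_halfSpace_re_lt (1 - θ))).isPreconnected
    have ha := ((hdiff.mono fun s hs => hs.1).add (hrefl.mono fun s hs => hs.2)).analyticOnNhd
      (s := {s : ℂ | θ < s.re ∧ s.re < 1 - θ}) (hopen.inter hopen')
    have hhalf : θ < ((1 / 2 : ℝ) + I : ℂ).re ∧ ((1 / 2 : ℝ) + I : ℂ).re < 1 - θ := by
      rw [add_re, ofReal_re, I_re, add_zero]
      constructor <;> linarith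
    refine ha.eqOn_of_preconnected_of_eventuallyEq analyticOnNhd_const hpre
      (z₀ := (1 / 2 : ℝ) + I) hhalf ?_
    filter_upwards [(hopen.inter hopen').mem_nhds hhalf,
      (isOpen_lt continuous_const continuous_im).mem_nhds
        (show (0 : ℝ) < ((1 / 2 : ℝ) + I : ℂ).im by simp)] with z hz hz'
    exact hC z hz.1 hz.2 hz'
  -- hence the Dirichlet series extends to a bounded entire function
  set G : ℂ → ℂ := fun s => if 1 / 2 ≤ s.re then LSeries e s else C - conj (LSeries e (1 - conj s))
    with hG
  have hG1 : Set.EqOn G (LSeries e) {s | θ < s.re} := fun s (hs : θ < s.re) => by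
    simp only [hG]
    split_ifs with h
    · rfl
    · rw [sub_eq_iff_eq_add]
      exact (hstrip (x := s) ⟨hs, by linarith⟩).symm
  have hG2 : Set.EqOn G (fun s => C - conj (LSeries e (1 - conj s))) {s | s.re < 1 - θ} :=
    fun s (hs : s.re < 1 - θ) => by
    simp only [hG]
    split_ifs with h
    · rw [eq_sub_iff_add_eq]
      exact hstrip (x := s) ⟨by linarith, hs⟩
    · rfl
  have hGdiff : Differentiable ℂ G := fun s => by
    rcases lt_or_ge θ s.re with h | h
    · exact (hdiff.congr hG1).differentiableAt (hopen.mem_nhds h)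
    · exact ((hrefl.const_sub C).congr hG2).differentiableAt
        (hopen'.mem_nhds (show s.re < 1 - θ by linarith))
  obtain ⟨M, hM⟩ : ∃ M, ∀ s : ℂ, 1 / 2 ≤ s.re → ‖LSeries e s‖ ≤ M := by
    have hs := he (1 / 2 : ℝ) (by simpa using hθ)
    refine ⟨∑' n, ‖LSeries.term e (1 / 2 : ℝ) n‖, fun s hs' => ?_⟩
    have hle : ∀ n, ‖LSeries.term e s n‖ ≤ ‖LSeries.term e (1 / 2 : ℝ) n‖ := fun n =>
      LSeries.norm_term_le_of_re_le_re e (by simpa using hs') n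
    exact (norm_tsum_le_tsum_norm (hs.norm.of_nonneg_of_le (fun _ => norm_nonneg _) hle)).trans
      ((hs.norm.of_nonneg_of_le (fun _ => norm_nonneg _) hle).tsum_le_tsum hle hs.norm)
  have hbdd : Bornology.IsBounded (Set.range G) := by
    rw [isBounded_iff_forall_norm_le]
    refine ⟨‖C‖ + M, ?_⟩
    rintro _ ⟨s, rfl⟩
    simp only [hG]
    split_ifs with h
    · have := hM s h
      have := norm_nonneg C
      linarith
    · refine (norm_sub_le _ _).trans ?_
      rw [RCLike.norm_conj]
      have := hM (1 - conj s) (by simp; linarith)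
      linarith
  have hconst := hGdiff.apply_eq_apply_of_bounded hbdd
  have hzero : ∀ s, G s = 0 := fun s => by
    have hlim := LSeries.tendsto_atTop (habs.trans_lt (EReal.coe_lt_top θ))
    rw [he1] at hlim
    refine tendsto_nhds_unique (tendsto_const_nhds.congr' ?_) hlim
    filter_upwards [eventually_gt_atTop θ] with x hx
    rw [← hG1 (x := (x : ℂ)) (by simpa using hx)]
    exact hconst _ _
  refine ⟨fun n hn => ?_, ?_⟩
  · refine LSeries.eq_of_LSeries_eventually_eq (g := 0) (habs.trans_lt (EReal.coe_lt_top θ))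
      ((abscissaOfAbsConv_le_one fun _ _ => LSeriesSummable_zero).trans_lt (EReal.coe_lt_top 1))
      ?_ hn
    filter_upwards [eventually_gt_atTop θ] with x hx
    rw [← hG1 (x := (x : ℂ)) (by simpa using hx), hzero]
    simp
  · have h1 := hG1 (x := (1 / 2 : ℝ)) (by simpa using hθ)
    have h2 := hstrip (x := (1 / 2 : ℝ)) ⟨by simpa using hθ, by simp; linarith⟩
    have e : 1 - conj ((1 / 2 : ℝ) : ℂ) = ((1 / 2 : ℝ) : ℂ) := by
      rw [conj_ofReal]
      push_cast
      norm_num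
    simp only [e, ← h1, hzero, map_zero, add_zero] at h2
    exact h2.symm

/-! ### Self-dual periodic functions with an Euler product are primitive characters -/

lemma isBigO_log_natCast_rpow {δ : ℝ} (hδ : 0 < δ) :
    (fun n : ℕ => Real.log n) =O[atTop] fun n : ℕ => (n : ℝ) ^ δ :=
  (isLittleO_log_rpow_atTop hδ).isBigO.comp_tendsto tendsto_natCast_atTop_atTop

lemma isBigO_logMul {b : ℕ → ℂ} {θ θ' : ℝ} (hθ : θ < θ')
    (hb : b =O[atTop] fun n : ℕ => (n : ℝ) ^ θ) :
    LSeries.logMul b =O[atTop] fun n : ℕ => (n : ℝ) ^ θ' := by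
  have hlog : (fun n : ℕ => log (n : ℂ)) =O[atTop] fun n : ℕ => (n : ℝ) ^ (θ' - θ) := by
    refine IsBigO.of_norm_left ((isBigO_log_natCast_rpow (sub_pos.2 hθ)).norm_left.congr_left
      fun n => ?_)
    rw [← natCast_log, norm_real]
  refine (hlog.mul hb).congr' EventuallyEq.rfl ?_
  filter_upwards [eventually_gt_atTop 0] with n hn
  rw [← Real.rpow_add (by exact_mod_cast hn), sub_add_cancel]

lemma isBigO_mul_vonMangoldt {N : ℕ} (χ : DirichletCharacter ℂ N) {θ : ℝ} (hθ : 0 < θ) :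
    (fun n : ℕ => χ n * ArithmeticFunction.vonMangoldt n) =O[atTop] fun n : ℕ => (n : ℝ) ^ θ := by
  refine IsBigO.trans (IsBigO.of_bound 1 (Eventually.of_forall fun n => ?_))
    (isBigO_log_natCast_rpow hθ)
  rw [norm_mul, one_mul, norm_real, Real.norm_of_nonneg ArithmeticFunction.vonMangoldt_nonneg,
    Real.norm_of_nonneg (Real.log_natCast_nonneg n)]
  exact (mul_le_of_le_one_left ArithmeticFunction.vonMangoldt_nonneg (χ.norm_le_one _)).trans
    ArithmeticFunction.vonMangoldt_le_log

lemma DirichletCharacter.primitiveCharacter_natCast {q : ℕ} (χ : DirichletCharacter ℂ q) {n : ℕ}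
    (hn : n.Coprime q) : χ.primitiveCharacter n = χ n := by
  have := χ.primitiveCharacter_apply_of_isCoprime (a := n) (Nat.isCoprime_iff_coprime.2 hn)
  simpa using this

lemma DirichletCharacter.primitiveCharacter_neg_one {q : ℕ} (χ : DirichletCharacter ℂ q) :
    χ.primitiveCharacter (-1) = χ (-1) := by
  have := χ.primitiveCharacter_apply_of_isCoprime (a := -1) isCoprime_one_left.neg_left
  simpa using this

lemma DirichletCharacter.IsPrimitive.dft_eq_mul_conj {N : ℕ} [NeZero N]
    {ψ : DirichletCharacter ℂ N} (hψ : ψ.IsPrimitive) :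
    ∃ κ : ℂ, κ ≠ 0 ∧ ∀ k, ZMod.dft ψ k = κ * conj (ψ k) := by
  have h : ∀ k, ZMod.dft ψ k = ψ⁻¹ (-1) * gaussSum ψ ZMod.stdAddChar * conj (ψ k) := fun k => by
    rw [hψ.fourierTransform_eq_inv_mul_gaussSum, neg_eq_neg_one_mul, map_mul,
      ← MulChar.star_apply' ψ k]
    simp only [RCLike.star_def]
    ring
  refine ⟨_, fun h0 => ?_, h⟩
  have h1 : ZMod.dft ψ = 0 := funext fun k => by rw [h, h0, zero_mul, Pi.zero_apply]
  rw [LinearEquiv.map_eq_zero_iff] at h1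
  have := congrFun h1 1
  simp at this

/-- The difference of the logarithmic derivatives of two Dirichlet series, with denominators
cleared. -/
lemma deriv_mul_sub_deriv_mul_eq {c w c' w' : ℕ → ℂ} {s : ℂ}
    (h : deriv (LSeries c) s = -LSeries c s * LSeries w s)
    (h' : deriv (LSeries c') s = -LSeries c' s * LSeries w' s)
    (hw : LSeriesSummable w s) (hw' : LSeriesSummable w' s) :
    deriv (LSeries c) s * LSeries c' s - deriv (LSeries c') s * LSeries c s =
      -(LSeries (w - w') s * (LSeries c s * LSeries c' s)) := by
  rw [h, h', LSeries_sub hw hw']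
  ring

lemma deriv_LFunction_eq {N : ℕ} [NeZero N] (Φ : ZMod N → ℂ) {s : ℂ} (hs : 1 < s.re) :
    deriv (ZMod.LFunction Φ) s = deriv (LSeries fun n => Φ n) s := by
  refine EventuallyEq.deriv_eq ?_
  filter_upwards [(isOpen_lt continuous_const continuous_re).mem_nhds hs] with z hz
  exact ZMod.LFunction_eq_LSeries Φ hz

theorem exists_isPrimitive_of_dft_eq {q : ℕ} [NeZero q] {Φ : ZMod q → ℂ} {b : ℕ → ℂ} {κ : ℂ}
    {θ : ℝ} (h1 : Φ 1 = 1) (hdft : ∀ k, ZMod.dft Φ k = κ * conj (Φ k))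
    (hb : ∀ n, ¬ IsPrimePow n → b n = 0) (hθ : θ < 1 / 2)
    (hbO : b =O[atTop] fun n : ℕ => (n : ℝ) ^ θ)
    (hsum : ∀ s : ℂ, 1 < s.re → LSeriesSummable b s)
    (hexp : ∀ s : ℂ, 1 < s.re → exp (LSeries b s) = LSeries (fun n => Φ n) s) :
    ∃ χ : DirichletCharacter ℂ q, χ.IsPrimitive ∧ ∀ x, Φ x = χ x := by
  have hq : q ≠ 0 := NeZero.ne q
  set c : ℕ → ℂ := fun n => Φ n with hc
  set w := LSeries.logMul b with hwdef
  have hcs : ∀ s : ℂ, 1 < s.re → LSeriesSummable c s := fun s hs => by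
    obtain ⟨M, hM⟩ := (Set.finite_range fun x => ‖Φ x‖).bddAbove
    exact LSeriesSummable_of_bounded_of_one_lt_re (m := M) (fun n _ => hM ⟨(n : ZMod q), rfl⟩) hs
  have hws : ∀ s : ℂ, 1 < s.re → LSeriesSummable w s := fun s hs =>
    LSeriesSummable_logMul_of_lt_re
      ((abscissaOfAbsConv_le_one hsum).trans_lt (by exact_mod_cast hs))
  have hrec : IsLogDerivCoeff c w := isLogDerivCoeff_of_eq_exp hcs hsum hexp
  have hw : ∀ n, ¬ IsPrimePow n → w n = 0 := fun n hn => by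
    rw [hwdef, LSeries.logMul, hb n hn, mul_zero]
  have hc1 : c 1 = 1 := by simpa [hc] using h1
  obtain ⟨χ, hχ⟩ := exists_dirichletCharacter h1 fun m n hm hn hmn =>
    hrec.coprime_mul hw hc1 hm hn hmn
  have hcχ : ∀ n : ℕ, n.Coprime q → c n = χ n := fun n hn => by
    have := hχ n ((ZMod.isUnit_iff_coprime n q).2 hn) 1
    rwa [mul_one, h1, mul_one] at this
  have : NeZero χ.conductor := ⟨χ.conductor_ne_zero⟩
  set ψ := χ.primitiveCharacter with hψdef
  have hψ : ψ.IsPrimitive := χ.primitiveCharacter_isPrimitive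
  set v : ℕ → ℂ := fun n => ψ n * ArithmeticFunction.vonMangoldt n with hv
  have hrec' : IsLogDerivCoeff (fun n => ψ n) v := DirichletCharacter.isLogDerivCoeff ψ
  -- the coefficients of the difference of the logarithmic derivatives
  set e : ℕ → ℂ := w - v with he
  have hsupp : ∀ n, e n ≠ 0 → IsPrimePow n ∧ ¬ n.Coprime q := fun n hn => by
    have hpp : IsPrimePow n := by
      by_contra hcon
      apply hn
      rw [he, Pi.sub_apply, hw n hcon, hv]
      simp [ArithmeticFunction.vonMangoldt_apply, hcon]
    refine ⟨hpp, fun hcop => hn ?_⟩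
    rw [he, Pi.sub_apply, sub_eq_zero]
    exact hrec.eq_of_coprime hrec' hc1 (fun m _ hm => by
      rw [hcχ m hm, hψdef, χ.primitiveCharacter_natCast hm]) hpp.ne_zero hcop
  obtain ⟨θ', hθ'1, hθ'2⟩ := exists_between (max_lt hθ one_half_pos)
  have heO : e =O[atTop] fun n : ℕ => (n : ℝ) ^ θ' :=
    (isBigO_logMul ((le_max_left _ _).trans_lt hθ'1) hbO).sub
      (isBigO_mul_vonMangoldt ψ ((le_max_right _ _).trans_lt hθ'1))
  have hes : ∀ s : ℂ, θ' < s.re → LSeriesSummable e s := fun s hs =>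
    LSeriesSummable_of_isBigO_of_support hq heO hsupp hs
  have heD : DifferentiableOn ℂ (LSeries e) {s | θ' < s.re} :=
    (LSeries_differentiableOn e).mono fun s (hs : θ' < s.re) =>
      (LSeries.abscissaOfAbsConv_le_of_forall_lt_LSeriesSummable fun y hy =>
        hes y (by simpa using hy)).trans_lt (by exact_mod_cast hs)
  -- the functional equations
  obtain ⟨κ', hκ', hdft'⟩ := hψ.dft_eq_mul_conj
  have hqR : (0 : ℝ) < q := by exact_mod_cast Nat.pos_of_ne_zero hq
  have hNR : (0 : ℝ) < χ.conductor := by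
    exact_mod_cast Nat.pos_of_ne_zero χ.conductor_ne_zero
  have hN0 : (χ.conductor : ℂ) ≠ 0 := by exact_mod_cast hNR.ne'
  have hr : (0 : ℝ) < χ.conductor / q := by positivity
  have hfe : ∀ s : ℂ, s.im ≠ 0 →
      ZMod.LFunction Φ s * conj (ZMod.LFunction ψ (1 - conj s)) =
        κ / κ' * ((χ.conductor / q : ℝ) : ℂ) ^ s *
          (conj (ZMod.LFunction Φ (1 - conj s)) * ZMod.LFunction ψ s) := fun s hs => by
    rw [LFunction_eq_parityGamma_mul hdft (σ := χ (-1)) (fun x => by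
      rw [neg_eq_neg_one_mul, hχ _ isUnit_one.neg]) hs,
      LFunction_eq_parityGamma_mul hdft' (σ := χ (-1)) (fun x => by
      rw [neg_eq_neg_one_mul, map_mul, hψdef, χ.primitiveCharacter_neg_one]) hs]
    have e1 : (χ.conductor : ℂ) ^ s = ((χ.conductor / q : ℝ) : ℂ) ^ s * (q : ℂ) ^ s := by
      rw [← ofReal_natCast q, ← mul_cpow_ofReal_nonneg hr.le hqR.le, ← ofReal_mul,
        div_mul_cancel₀ _ hqR.ne', ofReal_natCast]
    have e2 : ((χ.conductor / q : ℝ) : ℂ) ^ s ≠ 0 := by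
      rw [Ne, cpow_eq_zero_iff]
      exact fun h => hr.ne' (by exact_mod_cast h.1)
    rw [cpow_neg, cpow_neg, e1]
    field_simp
  have hstrip := eq_zero_of_add_reflection_eq hθ'2 hes (by
      rw [he, Pi.sub_apply, hw 1 not_isPrimePow_one, hv]
      simp) fun s hs1 hs2 him => add_reflection_eq_neg_log hr
    (fun s hs => ZMod.differentiableAt_LFunction Φ s (Or.inl hs))
    (fun s hs => ZMod.differentiableAt_LFunction ψ s (Or.inl hs)) heD
    (fun s hs => by
      rw [ZMod.LFunction_eq_LSeries Φ hs, ← hexp s hs]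
      exact exp_ne_zero _)
    (fun s hs => by
      rw [ZMod.LFunction_eq_LSeries ψ hs]
      exact ψ.LSeries_ne_zero_of_one_lt_re hs)
    (fun s hs => by
      rw [deriv_LFunction_eq Φ hs, deriv_LFunction_eq ψ hs, ZMod.LFunction_eq_LSeries Φ hs, ZMod.LFunction_eq_LSeries ψ hs]
      refine deriv_mul_sub_deriv_mul_eq (deriv_LSeries_of_eq_exp hsum hexp hs) ?_ (hws s hs)
        (DirichletCharacter.LSeriesSummable_mul ψ
          (ArithmeticFunction.LSeriesSummable_vonMangoldt hs))
      have := ψ.LSeries_twist_vonMangoldt_eq hs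
      rw [eq_div_iff (ψ.LSeries_ne_zero_of_one_lt_re hs)] at this
      change _ = -_ * LSeries ((fun n : ℕ => ψ n) * fun n : ℕ =>
        (ArithmeticFunction.vonMangoldt n : ℂ)) s
      linear_combination this)
    hfe hs1 hs2 him
  obtain ⟨he0, hlog⟩ := hstrip
  have hNq : χ.conductor = q := by
    have h : Real.log (χ.conductor / q) = 0 := by exact_mod_cast neg_eq_zero.1 hlog
    rcases Real.log_eq_zero.1 h with h | h | h
    · exact absurd h hr.ne'
    · exact_mod_cast (div_eq_one_iff_eq hqR.ne').1 h
    · linarith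
  refine ⟨χ, hNq, fun x => ?_⟩
  have hwv : ∀ n, n ≠ 0 → w n = v n := fun n hn => sub_eq_zero.1 (he0 n hn)
  have hrec'' : IsLogDerivCoeff (fun n => ψ n) w := fun n hn => by
    rw [hrec' n hn]
    exact Finset.sum_congr rfl fun d hd => by
      rw [hwv d (ne_zero_of_dvd_ne_zero hn (Nat.dvd_of_mem_divisors hd))]
  have hcψ : c (x.val + q) = ψ (x.val + q : ℕ) :=
    hrec.eq_of_eq hrec'' (hw 1 not_isPrimePow_one) hc1 (by simp) (by omega)
  have hx : ((x.val + q : ℕ) : ZMod q) = x := by simp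
  by_cases hcop : (x.val + q).Coprime q
  · rw [← hx]
    exact hcχ _ hcop
  · have h0 : χ x = 0 := by
      rw [← hx]
      exact χ.map_nonunit fun h => hcop ((ZMod.isUnit_iff_coprime _ q).1 h)
    rw [h0, ← hx]
    refine hcψ.trans (ψ.map_nonunit fun h => hcop ?_)
    rw [ZMod.isUnit_iff_coprime, hNq] at h
    exact h

/-! ### Classification -/

lemma norm_twist (f : ℕ → ℂ) (μ : ℂ) {n : ℕ} (hn : 0 < n) : ‖twist f μ n‖ = ‖f n‖ := by
  rw [twist, norm_mul, norm_natCast_cpow_of_pos hn]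
  simp

lemma term_twist (f : ℕ → ℂ) (μ s : ℂ) :
    LSeries.term (twist f μ) s = LSeries.term f (s - 2 * μ.im * I) := by
  funext n
  rcases eq_or_ne n 0 with rfl | hn
  · simp
  have hn0 : (n : ℂ) ≠ 0 := by exact_mod_cast hn
  rw [LSeries.term_of_ne_zero hn, LSeries.term_of_ne_zero hn, twist, cpow_sub _ _ hn0]
  have h1 : (n : ℂ) ^ s ≠ 0 := by simp [cpow_eq_zero_iff, hn]
  have h2 : (n : ℂ) ^ (2 * μ.im * I) ≠ 0 := by simp [cpow_eq_zero_iff, hn]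
  field_simp

lemma one_lt_re_sub {s μ : ℂ} (hs : 1 < s.re) : 1 < (s - 2 * μ.im * I).re := by
  simpa using hs

lemma LSeriesSummable_twist {f : ℕ → ℂ} (hf : ∀ s : ℂ, 1 < s.re → LSeriesSummable f s) (μ : ℂ)
    {s : ℂ} (hs : 1 < s.re) : LSeriesSummable (twist f μ) s := by
  rw [LSeriesSummable, term_twist]
  exact hf _ (one_lt_re_sub hs)

lemma LSeries_twist (f : ℕ → ℂ) (μ s : ℂ) :
    LSeries (twist f μ) s = LSeries f (s - 2 * μ.im * I) := by
  rw [LSeries, term_twist, LSeries]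

namespace SelbergAxioms

variable {F : ℂ → ℂ} {a : ℕ → ℂ}

lemma differentiableAt (hF : SelbergAxioms F a) {s : ℂ} (hs : s ≠ 1) : DifferentiableAt ℂ F s := by
  obtain ⟨m, G, hG, -, hGF⟩ := hF.analyticity
  have h : DifferentiableAt ℂ (fun z => G z / (z - 1) ^ m) s :=
    (hG s).div (by fun_prop) (pow_ne_zero m (sub_ne_zero.2 hs))
  refine h.congr_of_eventuallyEq ?_
  filter_upwards [isOpen_compl_singleton.mem_nhds hs] with z hz
  rw [hGF z hz, mul_div_cancel_left₀ _ (pow_ne_zero m (sub_ne_zero.2 hz))]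

/-- If `F(s) = L(s + iα, χ)` for `Re s > 1` then this holds wherever `L(s + iα, χ)` has no pole. -/
lemma eq_LFunction (hF : SelbergAxioms F a) {q : ℕ} [NeZero q] (χ : DirichletCharacter ℂ q) (α : ℝ)
    (h : ∀ s : ℂ, 1 < s.re → F s = χ.LFunction (s + I * α)) {s : ℂ}
    (hs : χ ≠ 1 ∨ s + I * α ≠ 1) : F s = χ.LFunction (s + I * α) := by
  have hL : ∀ s : ℂ, s + I * α ≠ 1 ∨ χ ≠ 1 →
      DifferentiableAt ℂ (fun z => χ.LFunction (z + I * α)) s := fun s hs =>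
    (χ.differentiableAt_LFunction _ hs).comp s (by fun_prop)
  set S : Set ℂ := {1, 1 - I * α} with hS
  have hfin : S.Finite := by simp [hS]
  have hopen : IsOpen Sᶜ := hfin.isClosed.isOpen_compl
  have hpre : IsPreconnected Sᶜ := (hfin.countable.isConnected_compl_of_one_lt_rank
    (by rw [rank_real_complex]; norm_num)).isPreconnected
  have hmem : ∀ z ∈ Sᶜ, z ≠ 1 ∧ z + I * α ≠ 1 := fun z hz => by
    simp only [hS, Set.mem_compl_iff, Set.mem_insert_iff, Set.mem_singleton_iff, not_or] at hz
    exact ⟨hz.1, fun h => hz.2 (eq_sub_of_add_eq h)⟩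
  have hF' : AnalyticOnNhd ℂ F Sᶜ := DifferentiableOn.analyticOnNhd (fun z hz =>
    (hF.differentiableAt (hmem z hz).1).differentiableWithinAt) hopen
  have hL' : AnalyticOnNhd ℂ (fun z => χ.LFunction (z + I * α)) Sᶜ :=
    DifferentiableOn.analyticOnNhd (fun z hz =>
      (hL z (Or.inl (hmem z hz).2)).differentiableWithinAt) hopen
  have heq : Set.EqOn F (fun z => χ.LFunction (z + I * α)) Sᶜ := by
    have h2 : (2 : ℂ) ∈ Sᶜ := by
      simp only [hS, Set.mem_compl_iff, Set.mem_insert_iff, Set.mem_singleton_iff, not_or]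
      refine ⟨by norm_num, fun h => ?_⟩
      have := congrArg re h
      simp at this
    refine hF'.eqOn_of_preconnected_of_eventuallyEq hL' hpre h2 ?_
    filter_upwards [(isOpen_lt continuous_const continuous_re).mem_nhds
      (show (1 : ℝ) < (2 : ℂ).re by norm_num)] with z hz
    exact h z hz
  have hev : (fun z => χ.LFunction (z + I * α)) =ᶠ[𝓝[≠] s] F := by
    have h1 : Sᶜ ∈ 𝓝[≠] s := by
      have := (hfin.subset (Set.sdiff_subset (t := {s}))).isClosed.isOpen_compl.mem_nhds
        (x := s) (by simp)
      filter_upwards [nhdsWithin_le_nhds this, self_mem_nhdsWithin] with z hz hzs hzS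
      exact hz ⟨hzS, hzs⟩
    filter_upwards [h1] with z hz
    exact (heq hz).symm
  have hlim : Tendsto F (𝓝[≠] s) (𝓝 (χ.LFunction (s + I * α))) :=
    ((hL s hs.symm).continuousAt.tendsto.mono_left nhdsWithin_le_nhds).congr' hev
  have hcont : ContinuousAt F s := by
    rcases eq_or_ne s 1 with rfl | hs1
    · exact hF.regular_at_one ⟨_, hlim⟩
    · exact (hF.differentiableAt hs1).continuousAt
  exact tendsto_nhds_unique (hcont.tendsto.mono_left nhdsWithin_le_nhds) hlim

end SelbergAxioms

/-- A periodic function on the positive integers comes from a function on `ZMod q`. -/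
lemma exists_zmod_eq {q : ℕ} [NeZero q] {c : ℕ → ℂ} (hc : ∀ n : ℕ, 0 < n → c (n + q) = c n) :
    ∃ Φ : ZMod q → ℂ, ∀ n : ℕ, 0 < n → Φ n = c n := by
  have hmul : ∀ k n : ℕ, 0 < n → c (n + q * k) = c n := fun k n hn => by
    induction k with
    | zero => simp
    | succ k ih => rw [Nat.mul_succ, ← add_assoc, hc _ (by omega), ih]
  have hq : 0 < q := Nat.pos_of_ne_zero (NeZero.ne q)
  refine ⟨fun x => c (x.val + q), fun n hn => ?_⟩
  have hdiv := Nat.mod_add_div n q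
  change c ((n : ZMod q).val + q) = c n
  rw [ZMod.val_natCast, ← hmul (n / q) (n % q + q) (by omega), add_right_comm, hdiv, hc n hn]

theorem theorem5p1 (F : ℂ → ℂ) (hF : F ∈ SelbergStar 1)
    (Q : ℝ) (μ : Fin 1 → ℂ) (ε : ℂ) (hfe : HasStarFunctionalEquation F 1 Q μ ε) :
    ∃ q : ℕ+, starConductor 1 Q = ((q : ℕ) : ℝ) ∧
      ∃ χ : DirichletCharacter ℂ (q : ℕ), χ.IsPrimitive ∧
        ∃ α : ℝ, ∀ s : ℂ, (χ ≠ 1 ∨ s + I * (α : ℂ) ≠ 1) →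
          F s = DirichletCharacter.LFunction χ (s + I * (α : ℂ)) := by
  obtain ⟨⟨a₀, hF⟩, -⟩ := hF
  have h := hfe.degreeOne
  obtain ⟨m, G, -, hG, hGF⟩ := hF.analyticity
  obtain ⟨H, hH, hHF⟩ := h.exists_entire fun s hs => hF.differentiableAt hs
  set a : ℕ → ℂ := fun n => if n = 0 then 0 else a₀ n with ha
  have ha0 : a 0 = 0 := by simp [ha]
  have ha1 : a 1 = 1 := by simp [ha, hF.eulerProduct.1]
  have hD : ∀ s : ℂ, 1 < s.re → LSeriesHasSum a s (F s) := fun s hs =>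
    (LSeriesHasSum_congr s _ fun hn => by simp [ha, hn]).1 (hF.dirichletSeries s hs)
  have hsum : ∀ s : ℂ, 1 < s.re → LSeriesSummable a s := fun s hs => (hD s hs).LSeriesSummable
  have hsum2 : LSeriesSummable a 2 := hsum 2 (by norm_num)
  obtain ⟨C, r₀, r₁, hC, hexp⟩ := h.expSeries_eq_of_entire hG hGF hH hHF ha0 hD
  obtain ⟨K, hK, hbd⟩ := exists_tendsto_expSeries ha0 h.μ_re h.Q_pos hsum2 hC hexp
  have hbv : HasBoundaryValues a (μ 0) (Q ^ 2 / 2) K := hbd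
  have hQ := h.Q_pos
  obtain ⟨q, hq, hqQ, hper⟩ := hbv.exists_conductor (by positivity) hK ha1
  have : NeZero q := ⟨hq.ne'⟩
  obtain ⟨Φ, hΦ⟩ := exists_zmod_eq hper
  obtain ⟨κ, hκ⟩ := exists_dft_eq ha0 ha1 hsum2 h.μ_re hK hbv hqQ hΦ
  have hΦ1 : Φ 1 = 1 := by
    have := hΦ 1 one_pos
    simpa [twist, ha1] using this
  obtain ⟨-, b, hb, ⟨θ, hθ, hbO⟩, hbF⟩ := hF.eulerProduct
  have hLΦ : ∀ s, LSeries (fun n => Φ n) s = LSeries a (s - 2 * (μ 0).im * I) := fun s => by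
    rw [← LSeries_twist]
    exact LSeries_congr (fun {n} hn => hΦ n (Nat.pos_of_ne_zero hn)) s
  obtain ⟨χ, hχ, hΦχ⟩ := exists_isPrimitive_of_dft_eq (b := twist b (μ 0)) hΦ1 hκ
    (fun n hn => by rw [twist, hb n hn, zero_mul]) hθ
    ((IsBigO.of_norm_left (hbO.norm_left.congr' (by
      filter_upwards [eventually_gt_atTop 0] with n hn
      rw [norm_twist b _ hn]) EventuallyEq.rfl)))
    (fun s hs => LSeriesSummable_twist (fun s hs => (hbF s hs).1) _ hs)
    (fun s hs => by
      rw [LSeries_twist, (hbF _ (one_lt_re_sub hs)).2, hLΦ, (hD _ (one_lt_re_sub hs)).LSeries_eq])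
  refine ⟨⟨q, hq⟩, ?_, χ, hχ, 2 * (μ 0).im, fun s hs => ?_⟩
  · rw [starConductor, PNat.mk_coe, ← hqQ]
    ring
  · refine hF.eq_LFunction χ _ (fun s hs => ?_) hs
    rw [DirichletCharacter.LFunction_eq_LSeries χ (by simpa using hs), ← (hD s hs).LSeries_eq]
    have := hLΦ (s + I * (2 * (μ 0).im : ℝ))
    rw [show s + I * ((2 * (μ 0).im : ℝ) : ℂ) - 2 * (μ 0).im * I = s by push_cast; ring] at this
    rw [← this]
    simp only [hΦχ]
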